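/- **Model.** There are $T\ge 1$ rounds (the horizon $T$ is known) and $K$ actions. The latent vector $\theta\in\mathbb R^d$ has a Gaussian prior $N(\bar\theta,\Sigma)$ with $\Sigma$ invertible. Independently of $\theta$, in each round $t=1,\dots,T$ a tuple $(\mu_{1,t},\dots,\mu_{K,t})\in(\mathbb R^d\cup\{\perp\})^K$ is drawn i.i.d. from a fixed distribution $D_\mu$; here $\perp$ means that the action is unavailable, almost surely at least one action is available, and $\|\mu_{a,t}\|_2\le 1$ for available actions. The context vectors of the available actions are perturbed: $x_{a,t}=\mu_{a,t}+\varepsilon_{a,t}$, where all components of all $\varepsilon_{a,t}$ are independent $N(0,\rho^2)$ and $0<\rho\le 1/\sqrt d$. The algorithm sees the context tuple, chooses an available action $a_t$, and observes $r_t=\theta^\top x_t+\eta_{a_t,t}$ with $x_t=x_{a_t,t}$ and independent noises $\eta_{a,t}\sim N(0,1)$. Write $h_t=((x_1,r_1),\dots,(x_t,r_t))$. The Bayesian regret is $\mathbb E\big[\sum_{t=1}^T(\max_a\theta^\top x_{a,t}-\theta^\top x_{a_t,t})\big]$, the maximum being over available actions and the expectation over everything, including $\theta$. **Algorithms** (ties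 broken arbitrarily, by a measurable function of the history and the current contexts). * LinUCB with parameters $S,L,c_0$ chooses in round $t$ an action maximizing $x_{a,t}^\top\hat\theta_t+f(t)\sqrt{x_{a,t}^\top V_t^{-1}x_{a,t}}$, where $V_t=I+\sum_{\tau<t}x_\tau x_\tau^\top$, $\hat\theta_t=V_t^{-1}\sum_{\tau<t}r_\tau x_\tau$ and $f(t)=S+\sqrt{d\,c_0\log(T+tTL^2)}$. * The batched greedy algorithms with batch duration $Y$ divide time into batches of $Y$ consecutive rounds. In round $t$, with $t_0$ the last round of the previous batch, BatchBayesGreedy chooses an action maximizing $x_{a,t}^\top\,\mathbb E[\theta\mid h_{t_0}]$, and BatchFreqGreedy chooses an action maximizing $x_{a,t}^\top\hat\theta$, where $\hat\theta$ is a minimizer of $\theta'\mapsto\sum_{\tau\le t_0}(\theta'^\top x_\tau-r_\tau)^2$ that depends only on $h_{t_0}$. **Theorem.** There are universal constants $A,C>0$ and $p,q\in\mathbb N$ such that the following holds for all $d,K,T$ and all problem instances $(D_\mu,\bar\theta,\Sigma,\rho)$ for which all eigenvalues of $\Sigma$ are at most $1$ and $\|\bar\theta\|_2\ge 1+\sqrt{3\log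 T}$. Put $\Lambda=C\,(1+\log(TKd))^q\,\|\bar\theta\|_2$ and $Y_0=A\,(1+\log(dT))^p/\rho^2$. (a) LinUCB with parameters $S=\|\bar\theta\|_2+\sqrt{3d\log T}$, $L=1+\rho\sqrt{2d\log(2T^3Kd)}$, $c_0=1$ has Bayesian regret at most $$\Lambda\cdot\frac{d^2K^{2/3}}{\rho^2}\,T^{1/3}.$$ (b) For every batch duration $Y\ge Y_0$, both BatchBayesGreedy and BatchFreqGreedy have Bayesian regret at most $$\Lambda\cdot\Big(\frac{d^2K^{2/3}}{\rho^2}\,T^{1/3}+Y\Big).$$ In particular the bound is the one of (a), up to a factor $2$, whenever $Y_0\le Y\le d^2K^{2/3}T^{1/3}/\rho^2$; and, up to polylogarithmic factors, whenever $Y$ is at least $Y_0$ and at most $Y_0$ times a polylogarithmic factor. -/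

import Mathlib

open MeasureTheory ProbabilityTheory

noncomputable section

namespace LinBandit

/-- Feature space `ℝ^d` with the Euclidean norm. -/
abbrev Vec (d : ℕ) : Type := EuclideanSpace ℝ (Fin d)

/-- A context tuple for `K` actions: `Sum.inl x` is the context vector of an available action,
`Sum.inr ()` is the symbol `⊥` for an unavailable one. -/
abbrev Contexts (d K : ℕ) : Type := Fin K → Vec d ⊕ Unit

/-- A history of `t` rounds: the pairs (chosen context vector, observed reward). -/
abbrev History (d t : ℕ) : Type := Fin t → Vec d × ℝ

/-- A problem instance: prior mean and covariance, distribution of the mean contexts, and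
perturbation size, with the standing assumptions of the model. -/
structure ProblemInstance (d K : ℕ) where
  /-- prior mean -/
  mean : Vec d
  /-- prior covariance -/
  cov : Matrix (Fin d) (Fin d) ℝ
  cov_posDef : cov.PosDef
  /-- distribution of the tuple of mean context vectors -/
  meanDist : Measure (Contexts d K)
  isProb : IsProbabilityMeasure meanDist
  exists_available : ∀ᵐ m ∂meanDist, ∃ a v, m a = Sum.inl v
  norm_le_one : ∀ᵐ m ∂meanDist, ∀ a v, m a = Sum.inl v → ‖v‖ ≤ 1
  /-- perturbation size -/
  rho : ℝ
  rho_pos : 0 < rho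
  rho_le : rho ≤ 1 / Real.sqrt d

attribute [instance] ProblemInstance.isProb

/-- The primitive random variables of one round: mean contexts, perturbations, reward noises. -/
abbrev RoundDraw (d K : ℕ) : Type := Contexts d K × (Fin K → Vec d) × (Fin K → ℝ)

/-- The sample space: the latent vector and the draws of all rounds. -/
abbrev Sample (d K : ℕ) : Type := Vec d × (ℕ → RoundDraw d K)

/-- A perturbation: independent centred Gaussian components of standard deviation `rho`. -/
def perturbationLaw (d : ℕ) (rho : ℝ) : Measure (Vec d) :=
  (Measure.pi fun _ : Fin d => gaussianReal 0 (rho ^ 2).toNNReal).map (WithLp.toLp 2)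

instance (d : ℕ) (rho : ℝ) : IsProbabilityMeasure (perturbationLaw d rho) :=
  Measure.isProbabilityMeasure_map (by fun_prop)

/-- Law of the draws of one round. -/
def roundLaw {d K : ℕ} (I : ProblemInstance d K) : Measure (RoundDraw d K) :=
  I.meanDist.prod
    ((Measure.pi fun _ : Fin K => perturbationLaw d I.rho).prod
      (Measure.pi fun _ : Fin K => gaussianReal 0 1))

instance {d K : ℕ} (I : ProblemInstance d K) : IsProbabilityMeasure (roundLaw I) := by
  unfold roundLaw; infer_instance

/-- Joint law: `θ ~ N(mean, cov)`, independent of the i.i.d. draws of the rounds. -/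
def law {d K : ℕ} (I : ProblemInstance d K) : Measure (Sample d K) :=
  (multivariateGaussian I.mean I.cov).prod (Measure.infinitePi fun _ : ℕ => roundLaw I)

/-- Perturbed contexts of round `t` (rounds are numbered from `0`). -/
def contexts {d K : ℕ} (ω : Sample d K) (t : ℕ) : Contexts d K :=
  fun a => Sum.map (fun v => v + (ω.2 t).2.1 a) id ((ω.2 t).1 a)

/-- Context vector of action `a` (with the irrelevant value `0` for an unavailable action). -/
def ctxVec {d K : ℕ} (c : Contexts d K) (a : Fin K) : Vec d :=
  Sum.elim id (fun _ => 0) (c a)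

/-- A bandit algorithm: in each round the action is a measurable function of the history and of
the current context tuple. -/
structure Policy (d K : ℕ) where
  act : (t : ℕ) → History d t → Contexts d K → Fin K
  measurable_act : ∀ t, Measurable fun p : History d t × Contexts d K => act t p.1 p.2

/-- The history after `t` rounds of running `π`; the reward for the chosen action `a` is
`⟪θ, x⟫ + η_a` with `x` its context vector and `η_a` its reward noise. -/
def history {d K : ℕ} (π : Policy d K) (ω : Sample d K) : (t : ℕ) → History d t
  | 0 => Fin.elim0
  | t + 1 =>
    let a := π.act t (history π ω t) (contexts ω t)
    let x := ctxVec (contexts ω t) a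
    Fin.snoc (α := fun _ => Vec d × ℝ) (history π ω t)
      (x, inner ℝ ω.1 x + (ω.2 t).2.2 a)

/-- The action of `π` in round `t`. -/
def action {d K : ℕ} (π : Policy d K) (ω : Sample d K) (t : ℕ) : Fin K :=
  π.act t (history π ω t) (contexts ω t)

/-- `max_a ⟪θ, x_a⟫` over the available actions. -/
def bestReward {d K : ℕ} (θ : Vec d) (c : Contexts d K) : ℝ :=
  sSup {v : ℝ | ∃ a x, c a = Sum.inl x ∧ v = inner ℝ θ x}

/-- `∑_{t < T} (max_a ⟪θ, x_{a,t}⟫ - ⟪θ, x_{a_t,t}⟫)`. -/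
def regret {d K : ℕ} (π : Policy d K) (T : ℕ) (ω : Sample d K) : ℝ :=
  ∑ t ∈ Finset.range T,
    (bestReward ω.1 (contexts ω t) - inner ℝ ω.1 (ctxVec (contexts ω t) (action π ω t)))

/-- The Bayesian regret over `T` rounds is well defined and at most `B`. -/
def BayesRegretLE {d K : ℕ} (I : ProblemInstance d K) (π : Policy d K) (T : ℕ) (B : ℝ) : Prop :=
  Integrable (regret π T) (law I) ∧ ∫ ω, regret π T ω ∂(law I) ≤ B

/-- `a` is available and maximizes `score` among the available actions. -/
def IsArgmax {d K : ℕ} (score : Vec d → ℝ) (c : Contexts d K) (a : Fin K) : Prop :=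
  ∃ x, c a = Sum.inl x ∧ ∀ b y, c b = Sum.inl y → score y ≤ score x

/-- Number of rounds before the batch of round `t`, for batches of `Y` rounds each. -/
def batchStart (Y t : ℕ) : ℕ := Y * (t / Y)

/-- Batched Bayesian greedy: an action maximizing `⟪x, E[θ | h_{t₀}]⟫`, where `h_{t₀}` is the
history up to the end of the previous batch. Ties are broken arbitrarily. -/
def IsBatchBayesGreedy {d K : ℕ} (I : ProblemInstance d K) (T Y : ℕ) (π : Policy d K) : Prop :=
  ∀ t < T, ∀ᵐ ω ∂(law I),
    IsArgmax
      (fun x => inner ℝ x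
        (((law I)[fun ω' : Sample d K => ω'.1 |
          MeasurableSpace.comap (fun ω' => history π ω' (batchStart Y t)) inferInstance]) ω))
      (contexts ω t) (action π ω t)

/-- Sum of squared residuals of `θ` on a history. -/
def sqLoss {d n : ℕ} (h : History d n) (θ : Vec d) : ℝ :=
  ∑ i, (inner ℝ θ (h i).1 - (h i).2) ^ 2

/-- Batched frequentist greedy: an action maximizing `⟪x, θ̂⟫`, where `θ̂` is a least squares
estimate computed from `h_{t₀}` (any minimizer, when there are several). -/
def IsBatchFreqGreedy {d K : ℕ} (I : ProblemInstance d K) (T Y : ℕ) (π : Policy d K) : Prop :=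
  ∃ est : (n : ℕ) → History d n → Vec d,
    (∀ n h, IsMinOn (sqLoss h) Set.univ (est n h)) ∧
    ∀ t < T, ∀ᵐ ω ∂(law I),
      IsArgmax (fun x => inner ℝ x (est _ (history π ω (batchStart Y t))))
        (contexts ω t) (action π ω t)

/-- Empirical covariance matrix `∑ x_i x_iᵀ`. -/
def gram {d n : ℕ} (h : History d n) : Matrix (Fin d) (Fin d) ℝ :=
  ∑ i, Matrix.vecMulVec (h i).1.ofLp (h i).1.ofLp

/-- Ridge regression estimate with regularization parameter `1`. -/
def ridge {d n : ℕ} (h : History d n) : Vec d :=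
  WithLp.toLp 2 (Matrix.mulVec (1 + gram h)⁻¹ (∑ i, (h i).2 • (h i).1.ofLp))

/-- Interval width `S + √(d c₀ log (T + t T L²))`. -/
def width (d T : ℕ) (S L c₀ : ℝ) (t : ℕ) : ℝ :=
  S + Real.sqrt (d * c₀ * Real.log (T + t * T * L ^ 2))

/-- LinUCB with interval width parameters `S`, `L`, `c₀`. The round with index `t` is the
`(t+1)`-st round. -/
def IsLinUCB {d K : ℕ} (I : ProblemInstance d K) (T : ℕ) (S L c₀ : ℝ) (π : Policy d K) : Prop :=
  ∀ t < T, ∀ᵐ ω ∂(law I),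
    IsArgmax
      (fun x => inner ℝ x (ridge (history π ω t)) + width d T S L c₀ (t + 1) *
        Real.sqrt (x.ofLp ⬝ᵥ Matrix.mulVec (1 + gram (history π ω t))⁻¹ x.ofLp))
      (contexts ω t) (action π ω t)

end LinBandit

end

/-!
The regret of a round is paid for in two ways. Fix a width `γ`. If the regret is at most `γ` but not
zero, then the rewards of two actions differ by at most `γ`; by the perturbation of the contexts this
has probability at most `K² γ / (ρ ‖θ‖)` (`roundLaw_gap_le`), and it costs at most `γ`. If the regret
is larger, it is at most its square divided by `γ`. For `γ = ‖θ̄‖ K^(-2/3) T^(-1/3)` both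
contributions have the order of the theorem, provided that the *squared* regrets have a sum of order
`d² ‖θ̄‖² / ρ²` in expectation, up to logarithms (`bayesRegretLE_of_sq`). The length of the prior mean
ensures that `‖θ‖` is rarely below `‖θ̄‖` divided by a logarithm (`law_norm_lt_normFloor_le`).
Exceptional events are charged with the norm of `θ` times the length of the contexts; since they are
independent of the contexts of the round, this costs their probability up to logarithms and a
factor `d`. Independence of a round from its past is expressed by resampling the draw of that round
(`setDraw`, `lintegral_setDraw`).

For every policy, the noise accumulated in the direction of the contexts is controlled by the
self-normalized exponential martingale (`lintegral_expMart_le`): its squared norm with respect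
to the inverse of the design matrix `V = 1 + ∑ x xᵀ`, the noise energy, is hardly larger than
`log det V`, hence of order `d` up to logarithms.

For LinUCB this makes the confidence intervals valid outside of events whose probabilities have a sum
of order `T^(1/3)` (`law_ucbBad_le`). By optimism the squared regret is then at most the squared
width of the intervals, of order `d ‖θ̄‖²`, times `xᵀ V⁻¹ x` (`roundRegret_ucb_sq_le`), and these
quadratic forms have a sum of order `d` by the elliptic potential lemma (`sum_potential_le`).

For the greedy algorithms the perturbations replace optimism. Given the other contexts, an action is
chosen for perturbations in a half-space; pushing the perturbation further into the half-space, and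
along a given direction, changes probabilities by a constant factor only. So the chosen context has a
component of order `ρ`, up to logarithms, in every direction (`roundLaw_diverse`), and in every
round the expected trace of `V⁻¹` decreases by `ρ² (tr V⁻¹)² / d` up to logarithms
(`lintegral_spread_snoc_le`). Therefore `tr V⁻¹` is of order `d / (ρ² n)` after `n` rounds
(`lintegral_spread_le`). The squared error of the least squares estimate is at most the trace times
the noise energy (`norm_isMinOn_sqLoss_sub_sq_le`), and the posterior mean is as good as the ridge
estimate, because it minimizes the conditional squared error up to constants
(`lintegral_sub_condExp_sq_le`). The squared regret of a round is bounded by the squared error of the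
estimate, so its sum is of order `d² / ρ²` times a harmonic sum. The first two batches are charged
with the trivial bound `lintegral_roundRegret_le`, which gives the term `Y`.

The greedy argument needs nonzero estimates, since an action that is greedy for the zero vector is
arbitrary. The least squares estimate vanishes with probability zero, because the last reward has a
density (`law_zeroFitSet_succ`). The posterior mean is a martingale, so `θ` averages to zero on the
event that it vanishes at some time, while the component of `θ` along the prior mean is at least `1`
with high probability; hence this event is rare (`law_exists_condExp_eq_zero_le`).
-/

section
namespace LinBandit
open Matrix

/-! ### Rank one updates of positive definite matrices -/

theorem PosSemidef.dotProduct_mulVec_comm {n : Type*} [Fintype n] {A : Matrix n n ℝ}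
    (hA : A.PosSemidef) (x y : n → ℝ) : x ⬝ᵥ A *ᵥ y = y ⬝ᵥ A *ᵥ x := by
  have : Aᵀ = A := by simpa using hA.isHermitian.eq
  rw [dotProduct_mulVec, ← mulVec_transpose, this, dotProduct_comm]

/-- The Cauchy–Schwarz inequality for a positive semidefinite form. -/
theorem PosSemidef.sq_bilin_le {n : Type*} [Fintype n] {A : Matrix n n ℝ} (hA : A.PosSemidef)
    (x y : n → ℝ) : (x ⬝ᵥ A *ᵥ y) ^ 2 ≤ (x ⬝ᵥ A *ᵥ x) * (y ⬝ᵥ A *ᵥ y) := by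
  have hsymm := PosSemidef.dotProduct_mulVec_comm hA y x
  -- a nonnegative quadratic polynomial has a nonpositive discriminant
  have h : ∀ r : ℝ, 0 ≤ (y ⬝ᵥ A *ᵥ y) * (r * r) + (2 * (x ⬝ᵥ A *ᵥ y)) * r + x ⬝ᵥ A *ᵥ x := by
    intro r
    have := hA.dotProduct_mulVec_nonneg (x + r • y)
    simp only [star_trivial, mulVec_add, mulVec_smul, add_dotProduct, dotProduct_add,
      smul_dotProduct, dotProduct_smul, smul_eq_mul, hsymm] at this
    linarith
  have := discrim_le_zero h
  unfold discrim at this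
  nlinarith

section RankOne
variable {n : Type*} [Fintype n] [DecidableEq n] {A : Matrix n n ℝ}

theorem inv_quad_nonneg (hA : A.PosDef) (x : n → ℝ) : 0 ≤ x ⬝ᵥ A⁻¹ *ᵥ x := by
  simpa using hA.inv.posSemidef.dotProduct_mulVec_nonneg x

/-- The Sherman–Morrison formula. -/
theorem inv_add_vecMulVec (hA : A.PosDef) (x : n → ℝ) :
    (A + vecMulVec x x)⁻¹
      = A⁻¹ - (1 + x ⬝ᵥ A⁻¹ *ᵥ x)⁻¹ • vecMulVec (A⁻¹ *ᵥ x) (A⁻¹ *ᵥ x) := by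
  have hu : IsUnit A.det := (Matrix.isUnit_iff_isUnit_det A).1 hA.isUnit
  have hw : (1 + x ⬝ᵥ A⁻¹ *ᵥ x) ≠ 0 := by linarith [inv_quad_nonneg hA x]
  have hT : (A⁻¹)ᵀ = A⁻¹ := by simpa using hA.inv.isHermitian.eq
  apply inv_eq_right_inv
  have h1 : vecMulVec x x * A⁻¹ = vecMulVec x (A⁻¹ *ᵥ x) := by
    rw [vecMulVec_mul, ← mulVec_transpose, hT]
  have h2 : A * vecMulVec (A⁻¹ *ᵥ x) (A⁻¹ *ᵥ x) = vecMulVec x (A⁻¹ *ᵥ x) := by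
    rw [mul_vecMulVec, mulVec_mulVec, mul_nonsing_inv _ hu, one_mulVec]
  have h3 : vecMulVec x x * vecMulVec (A⁻¹ *ᵥ x) (A⁻¹ *ᵥ x)
      = (x ⬝ᵥ A⁻¹ *ᵥ x) • vecMulVec x (A⁻¹ *ᵥ x) := by
    rw [vecMulVec_mul_vecMulVec]
    ext i j; simp [vecMulVec_apply]; ring
  rw [add_mul, mul_sub, mul_sub, mul_nonsing_inv _ hu, Matrix.mul_smul, Matrix.mul_smul, h1,
    h2, h3]
  ext i j
  simp only [Matrix.add_apply, Matrix.sub_apply, Matrix.smul_apply, smul_eq_mul]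
  field_simp
  ring

theorem det_add_vecMulVec (hA : A.PosDef) (x : n → ℝ) :
    (A + vecMulVec x x).det = A.det * (1 + x ⬝ᵥ A⁻¹ *ᵥ x) := by
  have hu : IsUnit A.det := (Matrix.isUnit_iff_isUnit_det A).1 hA.isUnit
  have := det_add_replicateCol_mul_replicateRow (ι := Unit) hu x x
  rw [vecMulVec_eq Unit, this, Matrix.mul_assoc (replicateRow Unit x), ← replicateCol_mulVec]
  congr 1
  rw [det_unique]
  simp [Matrix.mul_apply, dotProduct]

theorem trace_inv_add_vecMulVec (hA : A.PosDef) (x : n → ℝ) :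
    (A + vecMulVec x x)⁻¹.trace = A⁻¹.trace
      - ((A⁻¹ *ᵥ x) ⬝ᵥ (A⁻¹ *ᵥ x)) / (1 + x ⬝ᵥ A⁻¹ *ᵥ x) := by
  rw [inv_add_vecMulVec hA, trace_sub, trace_smul, trace_vecMulVec, smul_eq_mul]
  ring

/-- The effect on the quadratic form `sᵀ A⁻¹ s` of one observation with context vector `x` and
noise `η`. -/
theorem quad_inv_add_vecMulVec (hA : A.PosDef) (x s : n → ℝ) (η : ℝ) :
    (s + η • x) ⬝ᵥ (A + vecMulVec x x)⁻¹ *ᵥ (s + η • x) = s ⬝ᵥ A⁻¹ *ᵥ s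
      + (2 * η * (x ⬝ᵥ A⁻¹ *ᵥ s) + η ^ 2 * (x ⬝ᵥ A⁻¹ *ᵥ x) - (x ⬝ᵥ A⁻¹ *ᵥ s) ^ 2)
        / (1 + x ⬝ᵥ A⁻¹ *ᵥ x) := by
  have hw : (1 + x ⬝ᵥ A⁻¹ *ᵥ x) ≠ 0 := by linarith [inv_quad_nonneg hA x]
  have hs := PosSemidef.dotProduct_mulVec_comm hA.inv.posSemidef s x
  have h1 : ∀ u, (A⁻¹ *ᵥ x) ⬝ᵥ u = x ⬝ᵥ A⁻¹ *ᵥ u := fun u => by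
    rw [dotProduct_comm, PosSemidef.dotProduct_mulVec_comm hA.inv.posSemidef]
  rw [inv_add_vecMulVec hA]
  simp only [sub_mulVec, smul_mulVec, vecMulVec_mulVec, dotProduct_sub, dotProduct_smul,
    mulVec_add, mulVec_smul, add_dotProduct, dotProduct_add, smul_dotProduct, smul_eq_mul, h1, hs,
    op_smul_eq_smul]
  field_simp
  ring

/-- This turns a bound in the norm given by `A⁻¹` into a bound in the Euclidean norm: the largest
eigenvalue of `A⁻¹` is at most its trace. -/
theorem dotProduct_inv_mulVec_self_le (hA : A.PosDef) (s : n → ℝ) :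
    (A⁻¹ *ᵥ s) ⬝ᵥ (A⁻¹ *ᵥ s) ≤ A⁻¹.trace * (s ⬝ᵥ A⁻¹ *ᵥ s) := by
  rw [trace, Finset.sum_mul, dotProduct]
  refine Finset.sum_le_sum fun i _ => ?_
  have := PosSemidef.sq_bilin_le hA.inv.posSemidef (Pi.single i 1) s
  simp only [single_one_dotProduct, mulVec_single_one, col_apply] at this
  simpa [pow_two] using this

/-- Cauchy–Schwarz for the diagonal entries; the sum on the right is the squared Frobenius norm of
`A⁻¹`, written as the sum of the squared lengths of its columns. -/
theorem sq_trace_inv_le : A⁻¹.trace ^ 2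
      ≤ Fintype.card n * ∑ i, (A⁻¹ *ᵥ Pi.single i 1) ⬝ᵥ (A⁻¹ *ᵥ Pi.single i 1) := by
  have h := sq_sum_le_card_mul_sum_sq (s := Finset.univ) (f := fun i => A⁻¹ i i)
  refine h.trans ?_
  rw [Finset.card_univ]
  gcongr with i
  simp only [mulVec_single_one, dotProduct, col_apply]
  rw [pow_two]
  exact Finset.single_le_sum (f := fun j => A⁻¹ j i * A⁻¹ j i)
    (fun j _ => mul_self_nonneg _) (Finset.mem_univ i)

/-- The inequality between the geometric and the arithmetic mean of the eigenvalues. -/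
theorem log_det_le [Nonempty n] (hA : A.PosDef) :
    Real.log A.det ≤ Fintype.card n * Real.log (A.trace / Fintype.card n) := by
  have hd : (0:ℝ) < Fintype.card n := by exact_mod_cast Fintype.card_pos
  have hp : ∀ i, 0 < hA.1.eigenvalues i := hA.eigenvalues_pos
  have h1 : A.det = ∏ i, hA.1.eigenvalues i := by simpa using hA.1.det_eq_prod_eigenvalues
  have h2 : A.trace = ∑ i, hA.1.eigenvalues i := by simpa using hA.1.trace_eq_sum_eigenvalues
  have hS : 0 < ∑ i, hA.1.eigenvalues i := Finset.sum_pos (fun i _ => hp i) Finset.univ_nonempty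
  set m := (∑ i, hA.1.eigenvalues i) / Fintype.card n with hm
  have hm0 : 0 < m := div_pos hS hd
  rw [h1, h2, Real.log_prod (fun i _ => (hp i).ne'), ← hm]
  -- the tangent of the logarithm at the mean `m` of the eigenvalues
  calc ∑ i, Real.log (hA.1.eigenvalues i)
      ≤ ∑ i, (Real.log m + (hA.1.eigenvalues i / m - 1)) := by
        refine Finset.sum_le_sum fun i _ => ?_
        have := Real.log_le_sub_one_of_pos (div_pos (hp i) hm0)
        rw [Real.log_div (hp i).ne' hm0.ne'] at this
        linarith
    _ = Fintype.card n * Real.log m := by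
        rw [Finset.sum_add_distrib, Finset.sum_sub_distrib, ← Finset.sum_div]
        simp only [Finset.sum_const, Finset.card_univ, nsmul_eq_mul, mul_one]
        have : (∑ i, hA.1.eigenvalues i) / m = Fintype.card n := by
          rw [hm]; field_simp
        rw [this]; ring

theorem inv_mulVec_cancel (hA : A.PosDef) (x : n → ℝ) : A *ᵥ (A⁻¹ *ᵥ x) = x := by
  rw [mulVec_mulVec, mul_nonsing_inv _ ((Matrix.isUnit_iff_isUnit_det A).1 hA.isUnit), one_mulVec]

theorem inv_mulVec_cancel' (hA : A.PosDef) (x : n → ℝ) : A⁻¹ *ᵥ (A *ᵥ x) = x := by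
  rw [mulVec_mulVec, nonsing_inv_mul _ ((Matrix.isUnit_iff_isUnit_det A).1 hA.isUnit), one_mulVec]

end RankOne

/-! ### Design matrix and least squares estimates of a history -/

section Design
variable {d t : ℕ}

/-- The regularized empirical covariance matrix `1 + ∑ x_i x_iᵀ` of a history. -/
noncomputable def design (h : History d t) : Matrix (Fin d) (Fin d) ℝ := 1 + gram h

theorem gram_posSemidef (h : History d t) : (gram h).PosSemidef :=
  posSemidef_sum _ fun i _ => by simpa using posSemidef_vecMulVec_self_star (h i).1.ofLp

theorem design_posDef (h : History d t) : (design h).PosDef :=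
  PosDef.one.add_posSemidef (gram_posSemidef h)

/-- Sum of the noises times the context vectors of a history, when the latent vector is `θ`. -/
noncomputable def noiseSum (θ : Vec d) (h : History d t) : Fin d → ℝ :=
  ∑ i, ((h i).2 - inner ℝ θ (h i).1) • (h i).1.ofLp

/-- The squared norm of `noiseSum θ h` with respect to the inverse of the design matrix. -/
noncomputable def noiseEnergy (θ : Vec d) (h : History d t) : ℝ :=
  noiseSum θ h ⬝ᵥ (design h)⁻¹ *ᵥ noiseSum θ h

/-- The trace of the inverse design matrix. -/
noncomputable def spread (h : History d t) : ℝ := (design h)⁻¹.trace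

/-- The logarithm of the determinant of the design matrix. -/
noncomputable def logDet (h : History d t) : ℝ := Real.log (design h).det

theorem noiseEnergy_nonneg (θ : Vec d) (h : History d t) : 0 ≤ noiseEnergy θ h :=
  inv_quad_nonneg (design_posDef h) _

theorem gram_snoc (h : History d t) (p : Vec d × ℝ) :
    gram (Fin.snoc (α := fun _ => Vec d × ℝ) h p : History d (t + 1))
      = gram h + vecMulVec p.1.ofLp p.1.ofLp := by
  simp [gram, Fin.sum_univ_castSucc]

theorem design_snoc (h : History d t) (p : Vec d × ℝ) :
    design (Fin.snoc (α := fun _ => Vec d × ℝ) h p : History d (t + 1))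
      = design h + vecMulVec p.1.ofLp p.1.ofLp := by
  rw [design, gram_snoc, design, add_assoc]

theorem noiseSum_snoc (θ : Vec d) (h : History d t) (p : Vec d × ℝ) :
    noiseSum θ (Fin.snoc (α := fun _ => Vec d × ℝ) h p : History d (t + 1))
      = noiseSum θ h + (p.2 - inner ℝ θ p.1) • p.1.ofLp := by
  simp [noiseSum, Fin.sum_univ_castSucc]

theorem dotProduct_eq_inner (x y : Vec d) : x.ofLp ⬝ᵥ y.ofLp = inner ℝ x y := by
  rw [EuclideanSpace.inner_eq_star_dotProduct, star_trivial, dotProduct_comm]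

theorem dotProduct_self_eq_norm_sq (x : Vec d) : x.ofLp ⬝ᵥ x.ofLp = ‖x‖ ^ 2 := by
  rw [dotProduct_eq_inner, real_inner_self_eq_norm_sq]

theorem sq_dotProduct_le (x y : Fin d → ℝ) : (x ⬝ᵥ y) ^ 2 ≤ (x ⬝ᵥ x) * (y ⬝ᵥ y) := by
  simp only [dotProduct, ← pow_two]
  exact Finset.sum_mul_sq_le_sq_mul_sq _ _ _

theorem dotProduct_self_nonneg' (x : Fin d → ℝ) : 0 ≤ x ⬝ᵥ x := by
  simpa using dotProduct_star_self_nonneg x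

theorem inv_design_contract (h : History d t) (x : Fin d → ℝ) :
    x ⬝ᵥ (design h)⁻¹ *ᵥ x ≤ x ⬝ᵥ x := by
  set y := (design h)⁻¹ *ᵥ x with hy
  have h1 : x = design h *ᵥ y := (inv_mulVec_cancel (design_posDef h) x).symm
  have h2 : y ⬝ᵥ y ≤ x ⬝ᵥ y := by
    have := (gram_posSemidef h).dotProduct_mulVec_nonneg y
    rw [h1, design, add_mulVec, one_mulVec, add_dotProduct, dotProduct_comm (gram h *ᵥ y)]
    simpa using this
  have h3 := sq_dotProduct_le x y
  have h4 := dotProduct_self_nonneg' x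
  have h5 := dotProduct_self_nonneg' y
  by_contra hlt
  push Not at hlt
  nlinarith

theorem spread_nonneg (h : History d t) : 0 ≤ spread h :=
  (design_posDef h).inv.posSemidef.trace_nonneg

theorem spread_le (h : History d t) : spread h ≤ d := by
  have : ∀ i, (design h)⁻¹ i i ≤ 1 := fun i => by
    have := inv_design_contract h (Pi.single i 1)
    simpa using this
  calc spread h = ∑ i, (design h)⁻¹ i i := rfl
    _ ≤ ∑ _i : Fin d, (1:ℝ) := Finset.sum_le_sum fun i _ => this i
    _ = d := by simp

theorem one_le_det_design (h : History d t) : (1:ℝ) ≤ (design h).det := by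
  induction t with
  | zero => simp [design, gram]
  | succ t ih =>
    have hh : h = Fin.snoc (α := fun _ => Vec d × ℝ) (Fin.init h) (h (Fin.last t)) := by simp
    rw [hh, design_snoc, det_add_vecMulVec (design_posDef _)]
    have h1 := ih (Fin.init h)
    have h2 := inv_quad_nonneg (design_posDef (Fin.init h)) (h (Fin.last t)).1.ofLp
    nlinarith

theorem logDet_nonneg (h : History d t) : 0 ≤ logDet h := Real.log_nonneg (one_le_det_design h)

theorem trace_gram (h : History d t) : (gram h).trace = ∑ i, ‖(h i).1‖ ^ 2 := by
  simp [gram, trace_sum, trace_vecMulVec, dotProduct_self_eq_norm_sq]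

/-- The growth of the log-determinant is logarithmic in the number of rounds, as long as the
context vectors do not grow. -/
theorem logDet_le (hd : 1 ≤ d) (h : History d t) :
    logDet h ≤ d * Real.log (1 + ∑ i, ‖(h i).1‖ ^ 2) := by
  have : Nonempty (Fin d) := ⟨⟨0, hd⟩⟩
  have h1 := log_det_le (design_posDef h)
  rw [Fintype.card_fin] at h1
  have hd' : (1:ℝ) ≤ d := by exact_mod_cast hd
  refine h1.trans ?_
  have h0 : 0 ≤ ∑ i, ‖(h i).1‖ ^ 2 := by positivity
  have htr : (design h).trace = d + ∑ i, ‖(h i).1‖ ^ 2 := by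
    rw [design, trace_add, trace_gram]; simp
  gcongr
  · rw [htr]; positivity
  · rw [htr, add_div, div_self (by positivity)]
    gcongr
    exact div_le_self h0 hd'

theorem logDet_snoc (h : History d t) (p : Vec d × ℝ) :
    logDet (Fin.snoc (α := fun _ => Vec d × ℝ) h p : History d (t + 1))
      = logDet h + Real.log (1 + p.1.ofLp ⬝ᵥ (design h)⁻¹ *ᵥ p.1.ofLp) := by
  have h2 := inv_quad_nonneg (design_posDef h) p.1.ofLp
  rw [logDet, design_snoc, det_add_vecMulVec (design_posDef h), Real.log_mul]
  · rfl
  · linarith [one_le_det_design h]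
  · linarith

theorem gram_mulVec (h : History d t) (v : Vec d) :
    gram h *ᵥ v.ofLp = ∑ i, (inner ℝ v (h i).1 : ℝ) • (h i).1.ofLp := by
  rw [gram, sum_mulVec]
  refine Finset.sum_congr rfl fun i _ => ?_
  rw [vecMulVec_mulVec, op_smul_eq_smul, dotProduct_eq_inner, real_inner_comm]

/-- The error of the ridge estimate consists of the accumulated noise and of a bias caused by the
regularization. -/
theorem ridge_sub (θ : Vec d) (h : History d t) :
    (ridge h).ofLp - θ.ofLp = (design h)⁻¹ *ᵥ (noiseSum θ h - θ.ofLp) := by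
  have h1 : ∑ i, (h i).2 • (h i).1.ofLp = (noiseSum θ h - θ.ofLp) + design h *ᵥ θ.ofLp := by
    rw [design, add_mulVec, one_mulVec, gram_mulVec, noiseSum]
    simp only [sub_smul, Finset.sum_sub_distrib]
    abel
  rw [ridge, h1, ← design, mulVec_add, inv_mulVec_cancel' (design_posDef h)]
  simp

theorem quad_sub_le {A : Matrix (Fin d) (Fin d) ℝ} (hA : A.PosSemidef) (x y : Fin d → ℝ) :
    (x - y) ⬝ᵥ A *ᵥ (x - y) ≤ 2 * (x ⬝ᵥ A *ᵥ x) + 2 * (y ⬝ᵥ A *ᵥ y) := by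
  have h1 := hA.dotProduct_mulVec_nonneg (x + y)
  simp only [star_trivial, mulVec_add, add_dotProduct, dotProduct_add] at h1
  simp only [mulVec_sub, sub_dotProduct, dotProduct_sub]
  linarith

/-- The squared Euclidean error of the ridge estimate is at most `spread` times the noise energy,
which is of order `d` up to logarithms. -/
theorem norm_ridge_sub_sq_le (θ : Vec d) (h : History d t) :
    ‖θ - ridge h‖ ^ 2 ≤ 2 * spread h * (noiseEnergy θ h + ‖θ‖ ^ 2) := by
  rw [norm_sub_rev, ← dotProduct_self_eq_norm_sq, WithLp.ofLp_sub, ridge_sub]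
  refine (dotProduct_inv_mulVec_self_le (design_posDef h) _).trans ?_
  have h1 := quad_sub_le (design_posDef h).inv.posSemidef (noiseSum θ h) θ.ofLp
  have h2 := inv_design_contract h θ.ofLp
  rw [dotProduct_self_eq_norm_sq] at h2
  have := spread_nonneg h
  rw [mul_comm 2, mul_assoc]
  refine mul_le_mul_of_nonneg_left ?_ this
  unfold noiseEnergy
  linarith

/-- The error of the predicted reward of `x` is governed by the length of `x` in the norm of the
inverse design matrix: this is the confidence interval that LinUCB is built on. -/
theorem abs_inner_sub_ridge_le (θ x : Vec d) (h : History d t) :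
    |inner ℝ x (ridge h) - inner ℝ x θ|
      ≤ (Real.sqrt (noiseEnergy θ h) + ‖θ‖)
        * Real.sqrt (x.ofLp ⬝ᵥ (design h)⁻¹ *ᵥ x.ofLp) := by
  have hP := (design_posDef h).inv.posSemidef
  have key : ∀ u : Fin d → ℝ, |x.ofLp ⬝ᵥ (design h)⁻¹ *ᵥ u|
      ≤ Real.sqrt (u ⬝ᵥ (design h)⁻¹ *ᵥ u) * Real.sqrt (x.ofLp ⬝ᵥ (design h)⁻¹ *ᵥ x.ofLp) := by
    intro u
    rw [← Real.sqrt_mul (inv_quad_nonneg (design_posDef h) u)]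
    refine Real.abs_le_sqrt ?_
    rw [mul_comm]
    exact PosSemidef.sq_bilin_le hP _ _
  have h1 : inner ℝ x (ridge h) - inner ℝ x θ
      = x.ofLp ⬝ᵥ (design h)⁻¹ *ᵥ noiseSum θ h - x.ofLp ⬝ᵥ (design h)⁻¹ *ᵥ θ.ofLp := by
    rw [← dotProduct_sub, ← mulVec_sub, ← ridge_sub, dotProduct_sub, dotProduct_eq_inner,
      dotProduct_eq_inner]
  have h2 : Real.sqrt (θ.ofLp ⬝ᵥ (design h)⁻¹ *ᵥ θ.ofLp) ≤ ‖θ‖ := by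
    rw [← Real.sqrt_sq (norm_nonneg θ), ← dotProduct_self_eq_norm_sq]
    exact Real.sqrt_le_sqrt (inv_design_contract h _)
  rw [h1, add_mul]
  refine (abs_sub _ _).trans (add_le_add (key _) ((key _).trans ?_))
  gcongr

/-- A least squares estimate has residuals that are orthogonal to all linear functions of the
contexts. -/
theorem isMinOn_sqLoss_normal {h : History d t} {v : Vec d}
    (hv : IsMinOn (sqLoss h) Set.univ v) (w : Vec d) :
    ∑ i, (inner ℝ v (h i).1 - (h i).2) * inner ℝ w (h i).1 = 0 := by
  set b := ∑ i, (inner ℝ v (h i).1 - (h i).2) * inner ℝ w (h i).1 with hb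
  set c := ∑ i, (inner ℝ w (h i).1 : ℝ) ^ 2 with hc
  have h1 : ∀ r : ℝ, 0 ≤ c * (r * r) + (2 * b) * r + 0 := by
    intro r
    have h2 := hv (Set.mem_univ (v + r • w))
    simp only [Set.mem_ofPred_eq, sqLoss, inner_add_left, inner_smul_left] at h2
    have h3 : ∑ i, (inner ℝ v (h i).1 + r * inner ℝ w (h i).1 - (h i).2) ^ 2
        = ∑ i, (inner ℝ v (h i).1 - (h i).2) ^ 2 + (c * (r * r) + 2 * b * r) := by
      rw [hb, hc, Finset.sum_mul, Finset.mul_sum, Finset.sum_mul, ← Finset.sum_add_distrib,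
        ← Finset.sum_add_distrib]
      refine Finset.sum_congr rfl fun i _ => by ring
    simp only [conj_trivial] at h2
    linarith
  have := discrim_le_zero h1
  unfold discrim at this
  nlinarith [sq_nonneg b]

/-- The normal equations. -/
theorem gram_mulVec_of_isMinOn_sqLoss {h : History d t} {v : Vec d}
    (hv : IsMinOn (sqLoss h) Set.univ v) :
    gram h *ᵥ v.ofLp = ∑ i, (h i).2 • (h i).1.ofLp := by
  rw [gram_mulVec, ← sub_eq_zero, ← Finset.sum_sub_distrib]
  simp only [← sub_smul]
  set u : Fin d → ℝ := ∑ i, (inner ℝ v (h i).1 - (h i).2) • (h i).1.ofLp with hu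
  have h1 := isMinOn_sqLoss_normal hv (WithLp.toLp 2 u)
  have h2 : u ⬝ᵥ u = 0 := by
    rw [← h1]
    nth_rw 2 [hu]
    rw [dotProduct_sum]
    refine Finset.sum_congr rfl fun i _ => ?_
    rw [dotProduct_smul, smul_eq_mul, ← dotProduct_eq_inner (WithLp.toLp 2 u)]
  exact dotProduct_self_eq_zero.1 h2

/-- Once `spread` is small, the design matrix is dominated by its unregularized part, so that
every least squares estimate is as accurate as the ridge estimate. -/
theorem norm_isMinOn_sqLoss_sub_sq_le {h : History d t} {v : Vec d}
    (hv : IsMinOn (sqLoss h) Set.univ v) (hs : spread h ≤ 1 / 2) (θ : Vec d) :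
    ‖θ - v‖ ^ 2 ≤ 4 * spread h * noiseEnergy θ h := by
  set e : Fin d → ℝ := v.ofLp - θ.ofLp with he
  have h1 : gram h *ᵥ e = noiseSum θ h := by
    rw [he, mulVec_sub, gram_mulVec_of_isMinOn_sqLoss hv, gram_mulVec, ← Finset.sum_sub_distrib]
    simp only [← sub_smul, noiseSum]
  have h2 : design h *ᵥ e = noiseSum θ h + e := by
    rw [design, add_mulVec, one_mulVec, h1, add_comm]
  -- `e` solves the unregularized equation `gram h *ᵥ e = noiseSum θ h`
  have h3 : e - (design h)⁻¹ *ᵥ e = (design h)⁻¹ *ᵥ noiseSum θ h := by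
    have := inv_mulVec_cancel' (design_posDef h) e
    rw [h2, mulVec_add] at this
    rw [sub_eq_iff_eq_add]; exact this.symm
  have h4 := dotProduct_inv_mulVec_self_le (design_posDef h) (noiseSum θ h)
  have h5 := dotProduct_inv_mulVec_self_le (design_posDef h) e
  have h6 := inv_design_contract h e
  -- all eigenvalues of `(design h)⁻¹` are at most `spread h ≤ 1 / 2`
  have h7 : e ⬝ᵥ (design h)⁻¹ *ᵥ e ≤ 1 / 2 * (e ⬝ᵥ e) := by
    have h8 := sq_dotProduct_le e ((design h)⁻¹ *ᵥ e)
    have h9 := inv_quad_nonneg (design_posDef h) e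
    have h10 := dotProduct_self_nonneg' e
    have h11 : (design h)⁻¹ *ᵥ e ⬝ᵥ (design h)⁻¹ *ᵥ e ≤ 1 / 2 * (e ⬝ᵥ (design h)⁻¹ *ᵥ e) :=
      h5.trans (mul_le_mul_of_nonneg_right hs h9)
    by_contra hlt
    push Not at hlt
    nlinarith [mul_le_mul_of_nonneg_left h11 h10]
  rw [norm_sub_rev, ← dotProduct_self_eq_norm_sq, WithLp.ofLp_sub, ← he]
  have h8 : (e ⬝ᵥ e) ≤ 4 * ((design h)⁻¹ *ᵥ noiseSum θ h ⬝ᵥ (design h)⁻¹ *ᵥ noiseSum θ h) := by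
    rw [← h3]
    have := dotProduct_self_nonneg' (e - (2:ℝ) • (design h)⁻¹ *ᵥ e)
    have h12 := dotProduct_self_nonneg' ((design h)⁻¹ *ᵥ e)
    have hc := dotProduct_comm e ((design h)⁻¹ *ᵥ e)
    simp only [sub_dotProduct, dotProduct_sub, smul_dotProduct, dotProduct_smul, smul_eq_mul]
      at this ⊢
    have h13 := sq_dotProduct_le e ((design h)⁻¹ *ᵥ e)
    have h14 := dotProduct_self_nonneg' e
    nlinarith
  unfold noiseEnergy
  refine h8.trans ?_
  rw [mul_assoc]
  exact mul_le_mul_of_nonneg_left h4 (by norm_num)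

attribute [irreducible] noiseEnergy spread logDet design noiseSum

end Design

end LinBandit
end

section
namespace LinBandit
open Matrix
open scoped ENNReal NNReal

/-! ### Gaussian integrals and the perturbations -/

theorem lintegral_pi_prod {ι : Type*} [Fintype ι] {X : ι → Type*} [∀ i, MeasurableSpace (X i)]
    (μ : ∀ i, Measure (X i)) [∀ i, IsProbabilityMeasure (μ i)] {f : ∀ i, X i → ℝ≥0∞}
    (hf : ∀ i, Measurable (f i)) :
    ∫⁻ x, ∏ i, f i (x i) ∂Measure.pi μ = ∏ i, ∫⁻ x, f i x ∂μ i := by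
  have h := iIndepFun_pi (μ := μ) (X := f) (fun i => (hf i).aemeasurable)
  rw [lintegral_prod_eq_prod_lintegral_of_indepFun Finset.univ (fun i (x : ∀ i, X i) => f i (x i)) h
    (fun i => (hf i).comp (measurable_pi_apply i))]
  refine Finset.prod_congr rfl fun i _ => ?_
  exact (measurePreserving_eval μ i).lintegral_comp (hf i)

theorem pi_withDensity {ι : Type*} [Fintype ι] {X : ι → Type*} [∀ i, MeasurableSpace (X i)]
    (μ : ∀ i, Measure (X i)) [∀ i, IsProbabilityMeasure (μ i)] {f : ∀ i, X i → ℝ≥0∞}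
    (hf : ∀ i, Measurable (f i)) [∀ i, SigmaFinite ((μ i).withDensity (f i))] :
    Measure.pi (fun i => (μ i).withDensity (f i))
      = (Measure.pi μ).withDensity fun x => ∏ i, f i (x i) := by
  refine Measure.pi_eq fun s hs => ?_
  rw [withDensity_apply _ (MeasurableSet.univ_pi hs), ← lintegral_indicator (MeasurableSet.univ_pi hs)]
  have : ((Set.univ.pi s).indicator fun x : ∀ i, X i => ∏ i, f i (x i))
      = fun x => ∏ i, (s i).indicator (f i) (x i) := by
    ext x
    by_cases hx : x ∈ Set.univ.pi s
    · rw [Set.indicator_of_mem hx]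
      exact Finset.prod_congr rfl fun i _ => by rw [Set.indicator_of_mem (hx i (Set.mem_univ i))]
    · rw [Set.indicator_of_notMem hx]
      simp only [Set.mem_pi, Set.mem_univ, true_imp_iff, not_forall] at hx
      obtain ⟨i, hi⟩ := hx
      exact (Finset.prod_eq_zero (Finset.mem_univ i) (Set.indicator_of_notMem hi _)).symm
  rw [this, lintegral_pi_prod μ fun i => (hf i).indicator (hs i)]
  exact Finset.prod_congr rfl fun i _ => by
    rw [lintegral_indicator (hs i), withDensity_apply _ (hs i)]

/-- Gaussian integral of the exponential of a quadratic polynomial, by completing the square. -/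
theorem lintegral_exp_quadratic_gaussianReal (α : ℝ) {β : ℝ} (hβ : 2 * β < 1) :
    ∫⁻ x, ENNReal.ofReal (Real.exp (α * x + β * x ^ 2)) ∂gaussianReal 0 1
      = ENNReal.ofReal (Real.exp (α ^ 2 / (2 * (1 - 2 * β))) / Real.sqrt (1 - 2 * β)) := by
  set w := 1 - 2 * β with hw
  have hw0 : 0 < w := by linarith
  set v : ℝ≥0 := ⟨w⁻¹, (inv_pos.2 hw0).le⟩ with hv
  have hvc : (v : ℝ) = w⁻¹ := rfl
  have hv0 : v ≠ 0 := by
    intro h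
    have : (v : ℝ) = 0 := by rw [h]; rfl
    rw [hvc] at this
    exact (inv_pos.2 hw0).ne' this
  rw [gaussianReal_of_var_ne_zero 0 one_ne_zero, lintegral_withDensity_eq_lintegral_mul _
    (measurable_gaussianPDF 0 1) (by fun_prop)]
  have : ∀ x, (gaussianPDF 0 1 * fun x => ENNReal.ofReal (Real.exp (α * x + β * x ^ 2))) x
      = ENNReal.ofReal (Real.exp (α ^ 2 / (2 * w)) / Real.sqrt w) * gaussianPDF (α / w) v x := by
    intro x
    rw [Pi.mul_apply, gaussianPDF, gaussianPDF, ← ENNReal.ofReal_mul (gaussianPDFReal_nonneg _ _ _),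
      ← ENNReal.ofReal_mul (by positivity)]
    congr 1
    rw [gaussianPDFReal, gaussianPDFReal, hvc, NNReal.coe_one]
    have h1 : Real.sqrt (2 * Real.pi * w⁻¹) = Real.sqrt (2 * Real.pi) / Real.sqrt w := by
      rw [← div_eq_mul_inv, Real.sqrt_div (by positivity)]
    have hs : Real.sqrt w ≠ 0 := (Real.sqrt_pos.2 hw0).ne'
    have h2 : Real.exp (-(x - 0) ^ 2 / (2 * 1)) * Real.exp (α * x + β * x ^ 2)
        = Real.exp (α ^ 2 / (2 * w)) * Real.exp (-(x - α / w) ^ 2 / (2 * w⁻¹)) := by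
      rw [← Real.exp_add, ← Real.exp_add]
      congr 1
      have hβ' : β = (1 - w) / 2 := by rw [hw]; ring
      rw [hβ']
      field_simp
      ring
    rw [h1, mul_assoc, h2, mul_one]
    field_simp
  rw [lintegral_congr this, lintegral_const_mul _ (measurable_gaussianPDF _ _),
    lintegral_gaussianPDF_eq_one _ hv0, mul_one]

theorem lintegral_exp_mul_gaussianReal (m : ℝ) (v : ℝ≥0) (t : ℝ) :
    ∫⁻ x, ENNReal.ofReal (Real.exp (t * x)) ∂gaussianReal m v
      = ENNReal.ofReal (Real.exp (m * t + v * t ^ 2 / 2)) := by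
  have h := congrFun (mgf_id_gaussianReal (μ := m) (v := v)) t
  rw [mgf] at h
  rw [← h, ofReal_integral_eq_lintegral_ofReal]
  · rfl
  · exact integrable_exp_mul_gaussianReal t
  · exact Filter.Eventually.of_forall fun x => (Real.exp_pos _).le

/-- A Chernoff bound. -/
theorem gaussianReal_tail {v : ℝ≥0} {a : ℝ} (ha : 0 ≤ a) {s : ℝ} (hs : 0 < s) (hv : (v : ℝ) ≤ s) :
    gaussianReal 0 v {x | a ≤ x} ≤ ENNReal.ofReal (Real.exp (-(a ^ 2 / (2 * s)))) := by
  have h := mul_meas_ge_le_lintegral₀ (μ := gaussianReal 0 v)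
    -- `a / s` is the optimal slope for variance `s`
    (f := fun x => ENNReal.ofReal (Real.exp (a / s * x))) (by fun_prop)
    (ENNReal.ofReal (Real.exp (a / s * a)))
  rw [lintegral_exp_mul_gaussianReal] at h
  have h2 : {x | a ≤ x} ⊆ {x | ENNReal.ofReal (Real.exp (a / s * a))
      ≤ ENNReal.ofReal (Real.exp (a / s * x))} := by
    intro x hx
    refine ENNReal.ofReal_le_ofReal (Real.exp_le_exp.2 ?_)
    exact mul_le_mul_of_nonneg_left hx (by positivity)
  have h3 := (mul_le_mul_right (measure_mono h2) (ENNReal.ofReal (Real.exp (a / s * a)))).trans h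
  rw [mul_comm, ← ENNReal.le_div_iff_mul_le (by simp [Real.exp_pos]) (by simp),
    ← ENNReal.ofReal_div_of_pos (Real.exp_pos _), ← Real.exp_sub] at h3
  refine h3.trans (ENNReal.ofReal_le_ofReal (Real.exp_le_exp.2 ?_))
  have : (v:ℝ) * (a / s) ^ 2 / 2 ≤ s * (a / s) ^ 2 / 2 := by gcongr
  have h4 : s * (a / s) ^ 2 / 2 - a / s * a = -(a ^ 2 / (2 * s)) := by field_simp; ring
  linarith

/-- The bound for the density of a Gaussian by the inverse of its standard deviation. -/
theorem gaussianReal_smallBall {m : ℝ} {v : ℝ≥0} (hv : v ≠ 0) (c r : ℝ) :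
    gaussianReal m v {x | |x - c| ≤ r} ≤ ENNReal.ofReal (r / Real.sqrt v) := by
  have hv' : 0 < (v:ℝ) := by positivity
  have hset : {x : ℝ | |x - c| ≤ r} = Set.Icc (c - r) (c + r) := by
    ext x; simp only [Set.mem_ofPred_eq, abs_le, Set.mem_Icc]
    constructor <;> rintro ⟨h1, h2⟩ <;> constructor <;> linarith
  rw [gaussianReal_apply _ hv, hset]
  calc ∫⁻ x in Set.Icc (c - r) (c + r), gaussianPDF m v x
      ≤ ∫⁻ x in Set.Icc (c - r) (c + r), ENNReal.ofReal ((2 * Real.sqrt v)⁻¹) := by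
        refine lintegral_mono fun x => ENNReal.ofReal_le_ofReal ?_
        rw [gaussianPDFReal]
        have h1 : Real.exp (-(x - m) ^ 2 / (2 * v)) ≤ 1 := by
          rw [Real.exp_le_one_iff, neg_div]
          have : 0 ≤ (x - m) ^ 2 / (2 * v) := by positivity
          linarith
        have h2 : 2 * Real.sqrt v ≤ Real.sqrt (2 * Real.pi * v) := by
          rw [Real.sqrt_mul (by positivity)]
          gcongr
          refine Real.le_sqrt_of_sq_le ?_
          linarith [Real.pi_gt_three]
        calc _ ≤ (Real.sqrt (2 * Real.pi * v))⁻¹ * 1 := by gcongr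
          _ ≤ _ := by rw [mul_one]; gcongr
    _ = ENNReal.ofReal (r / Real.sqrt v) := by
        rw [setLIntegral_const, Real.volume_Icc, ← ENNReal.ofReal_mul (by positivity)]
        congr 1
        have : 0 < Real.sqrt v := Real.sqrt_pos.2 hv'
        field_simp
        ring

/-- The marginals of a multivariate Gaussian in the direction of a vector. -/
theorem map_inner_multivariateGaussian {d : ℕ} (m : Vec d) {S : Matrix (Fin d) (Fin d) ℝ}
    (hS : S.PosSemidef) (w : Vec d) :
    (multivariateGaussian m S).map (fun x => inner ℝ w x)
      = gaussianReal (inner ℝ w m) (w.ofLp ⬝ᵥ S *ᵥ w.ofLp).toNNReal := by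
  have h := IsGaussian.map_eq_gaussianReal (μ := multivariateGaussian m S) (innerSL ℝ w)
  have h1 : (multivariateGaussian m S)[innerSL ℝ w] = inner ℝ w m := by
    rw [ContinuousLinearMap.integral_comp_id_comm IsGaussian.integrable_id,
      integral_id_multivariateGaussian]
    rfl
  have h2 : Var[innerSL ℝ w; multivariateGaussian m S] = w.ofLp ⬝ᵥ S *ᵥ w.ofLp := by
    rw [← covarianceBilin_multivariateGaussian (μ := m) hS w w, covarianceBilin_self]
    · rfl
    · exact IsGaussian.memLp_two_id
  rw [h1, h2] at h
  exact h

theorem perturbationLaw_eq (d : ℕ) (rho : ℝ) :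
    perturbationLaw d rho = multivariateGaussian 0 ((rho ^ 2) • (1 : Matrix (Fin d) (Fin d) ℝ)) := by
  have hS : ((rho ^ 2) • (1 : Matrix (Fin d) (Fin d) ℝ)).PosSemidef :=
    PosSemidef.one.smul (sq_nonneg rho)
  apply Measure.ext_of_charFun (E := EuclideanSpace ℝ (Fin d))
  ext t
  rw [charFun_multivariateGaussian hS, perturbationLaw, charFun_pi]
  simp_rw [charFun_gaussianReal, ← Complex.exp_sum]
  congr 1
  simp [smul_mulVec, dotProduct_self_eq_norm_sq, EuclideanSpace.real_norm_sq_eq, Finset.mul_sum,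
    Finset.sum_div, sq_nonneg]

theorem map_inner_perturbationLaw (d : ℕ) (rho : ℝ) (w : Vec d) :
    (perturbationLaw d rho).map (fun x => inner ℝ w x)
      = gaussianReal 0 (rho ^ 2 * ‖w‖ ^ 2).toNNReal := by
  have hS : ((rho ^ 2) • (1 : Matrix (Fin d) (Fin d) ℝ)).PosSemidef :=
    PosSemidef.one.smul (sq_nonneg rho)
  rw [perturbationLaw_eq, map_inner_multivariateGaussian 0 hS, inner_zero_right]
  simp [smul_mulVec, dotProduct_self_eq_norm_sq]

/-- Anti-concentration of the perturbations: this is what makes small gaps between the rewards of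
two actions unlikely. -/
theorem perturbationLaw_smallBall {d : ℕ} {rho : ℝ} (hρ : 0 < rho) {w : Vec d} (hw : w ≠ 0)
    (c r : ℝ) : perturbationLaw d rho {e | |inner ℝ w e - c| ≤ r}
      ≤ ENNReal.ofReal (r / (rho * ‖w‖)) := by
  have hw' : 0 < ‖w‖ := norm_pos_iff.2 hw
  have hm : MeasurableSet {x : ℝ | |x - c| ≤ r} := measurableSet_le (by fun_prop) (by fun_prop)
  have h : perturbationLaw d rho {e | |inner ℝ w e - c| ≤ r}
      = (perturbationLaw d rho).map (fun x => inner ℝ w x) {x | |x - c| ≤ r} := by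
    rw [Measure.map_apply (by fun_prop) hm]; rfl
  have h0 : 0 < rho ^ 2 * ‖w‖ ^ 2 := by positivity
  have h1 := gaussianReal_smallBall (m := 0) (v := (rho ^ 2 * ‖w‖ ^ 2).toNNReal)
    (by simpa using h0) c r
  rw [h, map_inner_perturbationLaw]
  refine h1.trans_eq ?_
  rw [Real.coe_toNNReal _ h0.le, ← mul_pow, Real.sqrt_sq (by positivity)]

theorem perturbationLaw_tail {d : ℕ} {rho : ℝ} (w : Vec d) {a s : ℝ} (ha : 0 ≤ a) (hs : 0 < s)
    (hw : rho ^ 2 * ‖w‖ ^ 2 ≤ s) :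
    perturbationLaw d rho {e | a ≤ inner ℝ w e} ≤ ENNReal.ofReal (Real.exp (-(a ^ 2 / (2 * s)))) := by
  have h : perturbationLaw d rho {e | a ≤ inner ℝ w e}
      = (perturbationLaw d rho).map (fun x => inner ℝ w x) {x | a ≤ x} := by
    rw [Measure.map_apply (by fun_prop) (measurableSet_le (by fun_prop) (by fun_prop))]; rfl
  rw [h, map_inner_perturbationLaw]
  exact gaussianReal_tail ha hs (by rwa [Real.coe_toNNReal _ (by positivity)])

theorem lintegral_exp_inner_perturbationLaw {d : ℕ} {rho : ℝ} (w : Vec d) :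
    ∫⁻ e, ENNReal.ofReal (Real.exp (inner ℝ w e)) ∂perturbationLaw d rho
      = ENNReal.ofReal (Real.exp (rho ^ 2 * ‖w‖ ^ 2 / 2)) := by
  have h := lintegral_exp_mul_gaussianReal 0 (rho ^ 2 * ‖w‖ ^ 2).toNNReal 1
  rw [← map_inner_perturbationLaw d rho w, lintegral_map (by fun_prop) (by fun_prop)] at h
  simpa [Real.coe_toNNReal _ (show 0 ≤ rho ^ 2 * ‖w‖ ^ 2 by positivity)] using h

/-- A bounded shift of the perturbation changes probabilities by at most a constant factor, on
events where the perturbation has a bounded component in the direction of the shift. -/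
theorem perturbationLaw_le_shift {d : ℕ} {rho : ℝ} (hρ : 0 < rho) (g : Vec d) (hg : ‖g‖ ≤ rho)
    {A : Set (Vec d)} (hA : MeasurableSet A) (hAg : ∀ e ∈ A, inner ℝ g e ≤ rho ^ 2) :
    perturbationLaw d rho A ≤ 5 * perturbationLaw d rho {e | e - g ∈ A} := by
  set v : ℝ≥0 := (rho ^ 2).toNNReal with hv
  have hvc : (v : ℝ) = rho ^ 2 := Real.coe_toNNReal _ (sq_nonneg _)
  have hv0 : v ≠ 0 := by rw [hv]; simpa using hρ.ne'
  set f : Fin d → ℝ → ℝ≥0∞ := fun i x =>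
    ENNReal.ofReal (Real.exp (-(g i * x) / rho ^ 2 - (g i) ^ 2 / (2 * rho ^ 2))) with hf
  have hfm : ∀ i, Measurable (f i) := fun i => by fun_prop
  have hone : ∀ i, (gaussianReal 0 v).withDensity (f i) = (gaussianReal 0 v).map (· + -(g i)) := by
    intro i
    rw [gaussianReal_map_add_const, gaussianReal_of_var_ne_zero _ hv0,
      gaussianReal_of_var_ne_zero _ hv0, ← withDensity_mul _ (measurable_gaussianPDF _ _) (hfm i)]
    congr 1
    ext x
    rw [Pi.mul_apply, gaussianPDF, gaussianPDF, hf, ← ENNReal.ofReal_mul (gaussianPDFReal_nonneg _ _ _)]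
    congr 1
    rw [gaussianPDFReal, gaussianPDFReal, mul_assoc, ← Real.exp_add, hvc]
    congr 2
    field_simp
    ring
  have : ∀ i, SigmaFinite ((gaussianReal 0 v).withDensity (f i)) := fun i => by
    rw [hone i]
    have : IsProbabilityMeasure ((gaussianReal 0 v).map (· + -(g i))) :=
      Measure.isProbabilityMeasure_map (by fun_prop)
    infer_instance
  set P := Measure.pi fun _ : Fin d => gaussianReal 0 v with hP
  have h1 := pi_withDensity (fun _ : Fin d => gaussianReal 0 v) hfm
  have h2 : Measure.pi (fun i => (gaussianReal 0 v).withDensity (f i))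
      = P.map (fun x i => x i + -(g i)) := by
    simp_rw [hone]
    have : ∀ i, SigmaFinite ((gaussianReal 0 v).map (· + -(g i))) := fun i => by
      have : IsProbabilityMeasure ((gaussianReal 0 v).map (· + -(g i))) :=
        Measure.isProbabilityMeasure_map (by fun_prop)
      infer_instance
    exact (Measure.pi_map_pi (μ := fun _ : Fin d => gaussianReal 0 v)
      (f := fun i x => x + -(g i)) (fun i => by fun_prop)).symm
  set B : Set (Fin d → ℝ) := WithLp.toLp 2 ⁻¹' A with hB
  have hBm : MeasurableSet B := (by fun_prop : Measurable (WithLp.toLp (V := Fin d → ℝ) 2)) hA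
  have hAm : MeasurableSet {e | e - g ∈ A} := (by fun_prop : Measurable fun e : Vec d => e - g) hA
  have e1 : perturbationLaw d rho A = P B := by
    rw [perturbationLaw, Measure.map_apply (by fun_prop) hA]
  have e2 : perturbationLaw d rho {e | e - g ∈ A} = P.map (fun x i => x i + -(g i)) B := by
    rw [perturbationLaw, Measure.map_apply (by fun_prop) hAm, Measure.map_apply (by fun_prop) hBm]
    congr 1
  rw [e1, e2, ← h2, h1, withDensity_apply _ hBm, ← lintegral_const_mul _ (by fun_prop)]
  calc P B = ∫⁻ _ in B, 1 ∂P := by simp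
    _ ≤ _ := by
      refine setLIntegral_mono (by fun_prop) fun x hx => ?_
      have hx' := hAg _ hx
      have hgsq : ∑ i, g i ^ 2 ≤ rho ^ 2 := by
        rw [← EuclideanSpace.real_norm_sq_eq]; gcongr
      have hin : ∑ i, g i * x i ≤ rho ^ 2 := by
        rw [EuclideanSpace.inner_eq_star_dotProduct, star_trivial, dotProduct_comm] at hx'
        exact hx'
      rw [hf, ← ENNReal.ofReal_prod_of_nonneg fun _ _ => (Real.exp_pos _).le, ← Real.exp_sum]
      have h5 : (1:ℝ) ≤ 5 * Real.exp (∑ i, (-(g i * x i) / rho ^ 2 - g i ^ 2 / (2 * rho ^ 2))) := by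
        have hb : -(3/2 : ℝ) ≤ ∑ i, (-(g i * x i) / rho ^ 2 - g i ^ 2 / (2 * rho ^ 2)) := by
          rw [Finset.sum_sub_distrib, ← Finset.sum_div, ← Finset.sum_div, Finset.sum_neg_distrib]
          have a1 : (∑ i, g i * x i) / rho ^ 2 ≤ 1 := (div_le_one (by positivity)).2 hin
          have a2 : (∑ i, g i ^ 2) / (2 * rho ^ 2) ≤ 1 / 2 := by
            rw [div_le_div_iff₀ (by positivity) (by positivity)]; linarith
          rw [neg_div]; linarith
        have h6 : Real.exp (3/2) ≤ 5 := by
          have : Real.exp (3/2) ^ 2 ≤ 5 ^ 2 := by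
            rw [← Real.exp_nat_mul]
            norm_num
            have h7 : Real.exp 3 = Real.exp 1 ^ 3 := by rw [← Real.exp_nat_mul]; norm_num
            rw [h7]
            have := Real.exp_one_lt_d9
            have h0 := Real.exp_pos 1
            calc Real.exp 1 ^ 3 ≤ 2.7182818286 ^ 3 := by gcongr
              _ ≤ 25 := by norm_num
          exact (pow_le_pow_iff_left₀ (Real.exp_pos _).le (by norm_num) two_ne_zero).1 this
        calc (1:ℝ) = Real.exp (3/2) * Real.exp (-(3/2)) := by rw [← Real.exp_add]; simp
          _ ≤ _ := by gcongr
      calc (1:ℝ≥0∞) = ENNReal.ofReal 1 := by simp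
        _ ≤ ENNReal.ofReal (5 * Real.exp (∑ i, (-(g i * x i) / rho ^ 2 - g i ^ 2 / (2 * rho ^ 2)))) :=
          ENNReal.ofReal_le_ofReal h5
        _ = _ := by rw [ENNReal.ofReal_mul (by norm_num)]; simp

end LinBandit
end

section
namespace LinBandit
open Matrix
open scoped ENNReal NNReal MatrixOrder

/-! ### The prior distribution of the latent vector -/

theorem dotProduct_mulVec_le_of_eigenvalues_le_one {d : ℕ} {S : Matrix (Fin d) (Fin d) ℝ}
    (hS : S.IsHermitian) (h : ∀ i, hS.eigenvalues i ≤ 1) (w : Fin d → ℝ) :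
    w ⬝ᵥ S *ᵥ w ≤ w ⬝ᵥ w := by
  set U : Matrix (Fin d) (Fin d) ℝ := hS.eigenvectorUnitary.1 with hU
  have hspec : S = U * diagonal hS.eigenvalues * Uᵀ := by
    have := hS.spectral_theorem
    rw [Unitary.conjStarAlgAut_apply] at this
    simpa [star_eq_conjTranspose, Function.comp_def] using this
  have hUU : U * Uᵀ = 1 := by
    have := (Matrix.mem_unitaryGroup_iff (A := U)).1 hS.eigenvectorUnitary.2
    simpa [star_eq_conjTranspose] using this
  set y := Uᵀ *ᵥ w with hy
  have h1 : w ⬝ᵥ S *ᵥ w = y ⬝ᵥ diagonal hS.eigenvalues *ᵥ y := by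
    conv_lhs => rw [hspec]
    rw [← mulVec_mulVec, ← mulVec_mulVec, dotProduct_mulVec, ← mulVec_transpose]
  have h2 : w ⬝ᵥ w = y ⬝ᵥ y := by
    rw [hy, dotProduct_mulVec, ← mulVec_transpose, transpose_transpose, mulVec_mulVec, hUU,
      one_mulVec]
  rw [h1, h2]
  simp only [dotProduct, mulVec_diagonal]
  refine Finset.sum_le_sum fun i _ => ?_
  nlinarith [h i, mul_self_nonneg (y i)]

section Prior
variable {d K : ℕ} (I : ProblemInstance d K)

/-- The prior distribution of the latent vector. -/
noncomputable abbrev prior : Measure (Vec d) := multivariateGaussian I.mean I.cov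

/-- The eigenvalues of the prior covariance are at most one. -/
def EigLeOne : Prop := ∀ i, I.cov_posDef.isHermitian.eigenvalues i ≤ 1

variable {I}

theorem prior_map_centered (w : Vec d) :
    (prior I).map (fun θ => inner ℝ w (θ - I.mean))
      = gaussianReal 0 (w.ofLp ⬝ᵥ I.cov *ᵥ w.ofLp).toNNReal := by
  have h := map_inner_multivariateGaussian I.mean I.cov_posDef.posSemidef w
  have h2 := gaussianReal_map_sub_const (μ := inner ℝ w I.mean)
    (v := (w.ofLp ⬝ᵥ I.cov *ᵥ w.ofLp).toNNReal) (inner ℝ w I.mean)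
  rw [← h, Measure.map_map (by fun_prop) (by fun_prop), sub_self] at h2
  rw [← h2]
  congr 1
  ext θ
  simp [inner_sub_right]

theorem prior_var_le (hI : EigLeOne I) (w : Vec d) :
    ((w.ofLp ⬝ᵥ I.cov *ᵥ w.ofLp).toNNReal : ℝ) ≤ ‖w‖ ^ 2 := by
  rw [← dotProduct_self_eq_norm_sq, Real.coe_toNNReal']
  refine max_le (dotProduct_mulVec_le_of_eigenvalues_le_one _ hI _) (dotProduct_self_nonneg' _)

/-- The prior is sub-Gaussian around its mean. -/
theorem lintegral_exp_inner_prior_le (hI : EigLeOne I) (w : Vec d) :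
    ∫⁻ θ, ENNReal.ofReal (Real.exp (inner ℝ w (θ - I.mean))) ∂prior I
      ≤ ENNReal.ofReal (Real.exp (‖w‖ ^ 2 / 2)) := by
  have h := lintegral_exp_mul_gaussianReal 0 (w.ofLp ⬝ᵥ I.cov *ᵥ w.ofLp).toNNReal 1
  rw [← prior_map_centered w, lintegral_map (by fun_prop) (by fun_prop)] at h
  simp only [one_mul] at h
  rw [h]
  refine ENNReal.ofReal_le_ofReal (Real.exp_le_exp.2 ?_)
  have := prior_var_le hI w
  linarith

theorem prior_tail_le (hI : EigLeOne I) {w : Vec d} (hw : ‖w‖ ≤ 1) {a : ℝ} (ha : 0 ≤ a) :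
    prior I {θ | a ≤ inner ℝ w (θ - I.mean)} ≤ ENNReal.ofReal (Real.exp (-(a ^ 2 / 2))) := by
  have h : prior I {θ | a ≤ inner ℝ w (θ - I.mean)}
      = (prior I).map (fun θ => inner ℝ w (θ - I.mean)) {x | a ≤ x} := by
    rw [Measure.map_apply (by fun_prop) (measurableSet_le (by fun_prop) (by fun_prop))]; rfl
  rw [h, prior_map_centered]
  refine (gaussianReal_tail ha one_pos ((prior_var_le hI w).trans ?_)).trans_eq (by simp)
  exact pow_le_one₀ (norm_nonneg _) hw

/-- The prior is the image of a standard Gaussian under the square root of the covariance matrix,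
which is a contraction. -/
theorem norm_toEuclideanCLM_sqrt_le (hI : EigLeOne I) (z : Vec d) :
    ‖toEuclideanCLM (𝕜 := ℝ) (CFC.sqrt I.cov) z‖ ^ 2 ≤ ‖z‖ ^ 2 := by
  have hsa : IsSelfAdjoint (toEuclideanCLM (𝕜 := ℝ) (CFC.sqrt I.cov)) :=
    (CFC.sqrt_nonneg I.cov).isSelfAdjoint.map _
  have hnn : (0 : Matrix (Fin d) (Fin d) ℝ) ≤ I.cov := I.cov_posDef.posSemidef.nonneg
  rw [← real_inner_self_eq_norm_sq]
  nth_rw 1 [← hsa.adjoint_eq]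
  rw [ContinuousLinearMap.adjoint_inner_left, ← ContinuousLinearMap.comp_apply,
    ← ContinuousLinearMap.mul_def, ← map_mul, CFC.sqrt_mul_sqrt_self _ hnn, inner_toEuclideanCLM,
    ← dotProduct_self_eq_norm_sq]
  exact dotProduct_mulVec_le_of_eigenvalues_le_one _ hI _

/-- The exponential moments of the squared distance to the mean are at most those of a chi-squared
distribution with `d` degrees of freedom. -/
theorem lintegral_exp_sq_prior_le (hI : EigLeOne I) {s : ℝ} (hs0 : 0 ≤ s) (hs : 2 * s < 1) :
    ∫⁻ θ, ENNReal.ofReal (Real.exp (s * ‖θ - I.mean‖ ^ 2)) ∂prior I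
      ≤ ENNReal.ofReal ((1 / Real.sqrt (1 - 2 * s)) ^ d) := by
  -- the prior is the image of independent standard Gaussians under a contraction `L`
  obtain ⟨L, hL, hLn⟩ : ∃ L : Vec d →L[ℝ] Vec d, prior I
      = (Measure.pi fun _ : Fin d => gaussianReal 0 1).map (fun x => I.mean + L (WithLp.toLp 2 x))
      ∧ ∀ z, ‖L z‖ ^ 2 ≤ ‖z‖ ^ 2 := by
    refine ⟨toEuclideanCLM (𝕜 := ℝ) (CFC.sqrt I.cov), ?_, norm_toEuclideanCLM_sqrt_le hI⟩
    rw [prior, multivariateGaussian, ← map_pi_eq_stdGaussian,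
      Measure.map_map (by fun_prop) (by fun_prop)]
    rfl
  rw [hL, lintegral_map (by fun_prop) (by fun_prop)]
  have hb : ∀ x : Fin d → ℝ,
      ENNReal.ofReal (Real.exp (s * ‖I.mean + L (WithLp.toLp 2 x) - I.mean‖ ^ 2))
      ≤ ∏ i, ENNReal.ofReal (Real.exp (0 * x i + s * x i ^ 2)) := by
    intro x
    rw [← ENNReal.ofReal_prod_of_nonneg fun _ _ => (Real.exp_pos _).le, ← Real.exp_sum]
    refine ENNReal.ofReal_le_ofReal (Real.exp_le_exp.2 ?_)
    rw [add_sub_cancel_left]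
    refine (mul_le_mul_of_nonneg_left (hLn _) hs0).trans_eq ?_
    rw [EuclideanSpace.real_norm_sq_eq, Finset.mul_sum]
    simp
  calc _ ≤ ∫⁻ x : Fin d → ℝ, ∏ i, ENNReal.ofReal (Real.exp (0 * x i + s * x i ^ 2))
          ∂(Measure.pi fun _ => gaussianReal 0 1) := lintegral_mono hb
    _ = _ := by
        rw [lintegral_pi_prod (fun _ : Fin d => gaussianReal 0 1)
          (f := fun _ x => ENNReal.ofReal (Real.exp (0 * x + s * x ^ 2))) (fun _ => by fun_prop)]
        simp_rw [lintegral_exp_quadratic_gaussianReal 0 hs]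
        rw [Finset.prod_const, ← ENNReal.ofReal_pow (by positivity)]
        simp

theorem lintegral_exp_sq_sub_dim_le (hI : EigLeOne I) :
    ∫⁻ θ, ENNReal.ofReal (Real.exp (‖θ - I.mean‖ ^ 2 / 4 - d)) ∂prior I ≤ 1 := by
  have h := lintegral_exp_sq_prior_le hI (s := 1 / 4) (by norm_num) (by norm_num)
  have h1 : ∀ θ : Vec d, ENNReal.ofReal (Real.exp (‖θ - I.mean‖ ^ 2 / 4 - d))
      = ENNReal.ofReal (Real.exp (-d)) * ENNReal.ofReal (Real.exp (1 / 4 * ‖θ - I.mean‖ ^ 2)) := by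
    intro θ
    rw [← ENNReal.ofReal_mul (Real.exp_pos _).le, ← Real.exp_add]
    ring_nf
  simp_rw [h1]
  rw [lintegral_const_mul _ (by fun_prop)]
  calc _ ≤ ENNReal.ofReal (Real.exp (-d)) * ENNReal.ofReal ((1 / Real.sqrt (1 - 2 * (1/4))) ^ d) := by
        gcongr
    _ = ENNReal.ofReal ((Real.exp (-1) * (1 / Real.sqrt (1 - 2 * (1/4)))) ^ d) := by
        rw [← ENNReal.ofReal_mul (Real.exp_pos _).le, mul_pow, ← Real.exp_nat_mul]
        simp
    _ ≤ ENNReal.ofReal 1 := by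
        refine ENNReal.ofReal_le_ofReal (pow_le_one₀ (by positivity) ?_)
        have h2 : (1/2 : ℝ) ≤ Real.sqrt (1 - 2 * (1/4)) := Real.le_sqrt_of_sq_le (by norm_num)
        have h3 : Real.exp (-1) ≤ 1 / 2 := by
          rw [Real.exp_neg, inv_le_comm₀ (Real.exp_pos _) (by norm_num)]
          have := Real.add_one_le_exp (1:ℝ)
          norm_num at this ⊢; linarith
        calc _ ≤ 1 / 2 * (1 / (1/2 : ℝ)) := by gcongr
          _ = 1 := by norm_num
    _ = 1 := by simp

/-- The Chernoff bound with exponent `3 / 8` gives `(2 * T ^ (-3 / 4)) ^ d`. -/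
theorem prior_norm_sq_tail (hI : EigLeOne I) (hd : 1 ≤ d) {T : ℝ} (hT : 1 ≤ T) :
    prior I {θ | 2 * d * Real.log T ≤ ‖θ - I.mean‖ ^ 2} ≤ ENNReal.ofReal (2 * T ^ (-(3/4) : ℝ)) := by
  have hT0 : 0 < T := by linarith
  rcases le_or_gt 1 (2 * T ^ (-(3/4) : ℝ)) with h1 | h1
  · calc _ ≤ (1 : ℝ≥0∞) := prob_le_one
      _ = ENNReal.ofReal 1 := by simp
      _ ≤ _ := ENNReal.ofReal_le_ofReal h1
  have h := mul_meas_ge_le_lintegral₀ (μ := prior I)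
    (f := fun θ => ENNReal.ofReal (Real.exp (3 / 8 * ‖θ - I.mean‖ ^ 2))) (by fun_prop)
    (ENNReal.ofReal (Real.exp (3 / 4 * d * Real.log T)))
  have h2 : {θ : Vec d | 2 * d * Real.log T ≤ ‖θ - I.mean‖ ^ 2} ⊆
      {θ | ENNReal.ofReal (Real.exp (3 / 4 * d * Real.log T))
        ≤ ENNReal.ofReal (Real.exp (3 / 8 * ‖θ - I.mean‖ ^ 2))} := by
    intro θ hθ
    refine ENNReal.ofReal_le_ofReal (Real.exp_le_exp.2 ?_)
    have : 2 * d * Real.log T ≤ ‖θ - I.mean‖ ^ 2 := hθ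
    linarith
  have h3 := (mul_le_mul_right (measure_mono h2) _).trans
    (h.trans (lintegral_exp_sq_prior_le hI (by norm_num) (by norm_num)))
  rw [mul_comm, ← ENNReal.le_div_iff_mul_le (by simp [Real.exp_pos]) (by simp),
    ← ENNReal.ofReal_div_of_pos (Real.exp_pos _)] at h3
  refine h3.trans (ENNReal.ofReal_le_ofReal ?_)
  have h4 : Real.sqrt (1 - 2 * (3/8)) = 1 / 2 := by
    rw [show (1 - 2 * (3/8) : ℝ) = (1/2) ^ 2 by norm_num]; exact Real.sqrt_sq (by norm_num)
  have h5 : (1 / Real.sqrt (1 - 2 * (3/8))) ^ d / Real.exp (3 / 4 * d * Real.log T)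
      = (2 * T ^ (-(3/4) : ℝ)) ^ d := by
    rw [h4, mul_pow, Real.rpow_def_of_pos hT0, ← Real.exp_nat_mul, div_eq_mul_inv, ← Real.exp_neg]
    norm_num
    ring
  rw [h5]
  exact pow_le_of_le_one (by positivity) h1.le (by omega)

/-- The direction of the prior mean (with value `0` if the mean vanishes). -/
noncomputable def meanDir (I : ProblemInstance d K) : Vec d := (‖I.mean‖)⁻¹ • I.mean

theorem norm_meanDir_le : ‖meanDir I‖ ≤ 1 := by
  rw [meanDir, norm_smul, norm_inv, norm_norm]
  exact inv_mul_le_one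

theorem inner_meanDir_mean : inner ℝ (meanDir I) I.mean = ‖I.mean‖ := by
  rw [meanDir, real_inner_smul_left, real_inner_self_eq_norm_sq]
  by_cases h : ‖I.mean‖ = 0
  · simp [h]
  · field_simp

theorem inner_meanDir (θ : Vec d) :
    inner ℝ (meanDir I) θ = ‖I.mean‖ - inner ℝ (-meanDir I) (θ - I.mean) := by
  rw [inner_neg_left, inner_sub_right, inner_meanDir_mean]; ring

theorem exp_neg_half_sq_sqrt_log {T : ℝ} (hT : 1 ≤ T) :
    Real.exp (-(Real.sqrt (3 * Real.log T) ^ 2 / 2)) = T ^ (-(3/2) : ℝ) := by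
  have := Real.log_nonneg hT
  rw [Real.sq_sqrt (by positivity), Real.rpow_def_of_pos (by linarith)]
  ring_nf

/-- With high probability the component of the latent vector in the direction of the prior mean
is almost as large as the prior mean. -/
theorem prior_inner_meanDir_lt (hI : EigLeOne I) {T : ℝ} (hT : 1 ≤ T) :
    prior I {θ | inner ℝ (meanDir I) θ ≤ ‖I.mean‖ - Real.sqrt (3 * Real.log T)}
      ≤ ENNReal.ofReal (T ^ (-(3/2) : ℝ)) := by
  rw [← exp_neg_half_sq_sqrt_log hT]
  refine le_trans (measure_mono ?_) (prior_tail_le hI (w := -meanDir I)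
    (by rw [norm_neg]; exact norm_meanDir_le) (Real.sqrt_nonneg _))
  intro θ hθ
  have : inner ℝ (meanDir I) θ ≤ ‖I.mean‖ - Real.sqrt (3 * Real.log T) := hθ
  rw [inner_meanDir] at this
  show Real.sqrt (3 * Real.log T) ≤ inner ℝ (-meanDir I) (θ - I.mean)
  linarith

/-- The component of the latent vector in the direction of the prior mean is rarely negative, also
when weighted with its size. -/
theorem lintegral_neg_inner_meanDir_le (hI : EigLeOne I) {T : ℝ} (hT : 1 ≤ T)
    (hm : 1 + Real.sqrt (3 * Real.log T) ≤ ‖I.mean‖) :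
    ∫⁻ θ, ENNReal.ofReal (-inner ℝ (meanDir I) θ) ∂prior I ≤ ENNReal.ofReal (T ^ (-(3/2) : ℝ)) := by
  have hs := Real.sqrt_nonneg (3 * Real.log T)
  set m := ‖I.mean‖ with hmdef
  have h1 := lintegral_exp_inner_prior_le hI (m • (-meanDir I))
  -- `x ≤ m * x ≤ exp (m * x)` for `x ≥ 0`, where `m ≥ 1` is the optimal slope
  have h2 : ∀ θ : Vec d, ENNReal.ofReal (-inner ℝ (meanDir I) θ)
      ≤ ENNReal.ofReal (Real.exp (-m ^ 2))
        * ENNReal.ofReal (Real.exp (inner ℝ (m • (-meanDir I)) (θ - I.mean))) := by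
    intro θ
    rw [← ENNReal.ofReal_mul (Real.exp_pos _).le, ← Real.exp_add, inner_meanDir,
      real_inner_smul_left]
    set y : ℝ := inner ℝ (-meanDir I) (θ - I.mean)
    rcases le_or_gt (-(‖I.mean‖ - y)) 0 with h0 | h0
    · rw [ENNReal.ofReal_of_nonpos h0]; exact zero_le
    refine ENNReal.ofReal_le_ofReal ?_
    rw [← hmdef] at h0 ⊢
    have h3 : -(m - y) ≤ m * (-(m - y)) := by nlinarith
    have h4 := Real.add_one_le_exp (m * (-(m - y)))
    have h5 : m * (-(m - y)) = -m ^ 2 + m * y := by ring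
    rw [h5] at h4 h3
    linarith
  calc _ ≤ ENNReal.ofReal (Real.exp (-m ^ 2))
        * ENNReal.ofReal (Real.exp (‖m • (-meanDir I)‖ ^ 2 / 2)) := by
        refine (lintegral_mono h2).trans ?_
        rw [lintegral_const_mul _ (by fun_prop)]
        gcongr
    _ ≤ _ := by
        rw [← ENNReal.ofReal_mul (Real.exp_pos _).le, ← Real.exp_add, ← exp_neg_half_sq_sqrt_log hT]
        refine ENNReal.ofReal_le_ofReal (Real.exp_le_exp.2 ?_)
        rw [norm_smul, norm_neg, mul_pow, Real.norm_eq_abs, sq_abs]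
        have h6 : ‖meanDir I‖ ^ 2 ≤ 1 := pow_le_one₀ (norm_nonneg _) norm_meanDir_le
        have h7 : m ^ 2 * ‖meanDir I‖ ^ 2 ≤ m ^ 2 := by nlinarith [sq_nonneg m]
        have h8 : Real.sqrt (3 * Real.log T) ^ 2 ≤ m ^ 2 := by gcongr; linarith
        linarith

/-- Elementary inequality behind the bounds for expectations on events of small probability: a variable with
exponential moment at most one contributes at most `p * log p⁻¹ + p` on an event of
probability `p`. -/
theorem le_log_inv_add_mul_exp {p : ℝ} (hp : 0 < p) (u : ℝ) :
    u ≤ Real.log p⁻¹ + p * Real.exp u := by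
  have h := Real.add_one_le_exp (u + Real.log p)
  rw [Real.exp_add, Real.exp_log hp] at h
  rw [Real.log_inv]
  linarith

/-- The last term has expectation at most `4 * p`, by `lintegral_exp_sq_sub_dim_le`. -/
theorem norm_sq_le_log_inv_add {p : ℝ} (hp : 0 < p) (θ : Vec d) :
    ‖θ - I.mean‖ ^ 2 ≤ 4 * (d + Real.log p⁻¹) + 4 * p * Real.exp (‖θ - I.mean‖ ^ 2 / 4 - d) := by
  have := le_log_inv_add_mul_exp hp (‖θ - I.mean‖ ^ 2 / 4 - d)
  linarith

end Prior

end LinBandit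
end

section
namespace LinBandit
open Matrix
open scoped ENNReal NNReal

/-! ### Resampling one coordinate of a product measure -/

theorem measurable_update_prod {ι : Type*} [DecidableEq ι] {X : ι → Type*}
    [∀ i, MeasurableSpace (X i)] (i : ι) :
    Measurable fun p : (∀ i, X i) × X i => Function.update p.1 i p.2 := by
  refine measurable_pi_iff.2 fun j => ?_
  by_cases h : j = i
  · subst h; simpa using measurable_snd
  · simp only [Function.update_of_ne h]; fun_prop

/-- Replacing one coordinate by an independent copy does not change the distribution. -/
theorem measurePreserving_update_infinitePi {ι : Type*} [DecidableEq ι] {X : ι → Type*}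
    [∀ i, MeasurableSpace (X i)] (μ : ∀ i, Measure (X i)) [∀ i, IsProbabilityMeasure (μ i)] (i : ι) :
    MeasurePreserving (fun p : (∀ i, X i) × X i => Function.update p.1 i p.2)
      ((Measure.infinitePi μ).prod (μ i)) (Measure.infinitePi μ) := by
  refine ⟨measurable_update_prod i, Measure.eq_infinitePi _ fun s t ht => ?_⟩
  rw [Measure.map_apply (measurable_update_prod i)
    (MeasurableSet.pi s.countable_toSet fun i _ => ht i)]
  by_cases hi : i ∈ s
  · have : (fun p : (∀ i, X i) × X i => Function.update p.1 i p.2) ⁻¹' Set.pi s t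
        = (Set.pi (s.erase i : Finset ι) t) ×ˢ t i := by
      ext ⟨x, y⟩
      simp only [Set.mem_preimage, Set.mem_pi, Finset.mem_coe, Set.mem_prod, Finset.mem_erase]
      constructor
      · intro h
        refine ⟨fun j hj => by simpa [hj.1] using h j hj.2, by simpa using h i hi⟩
      · rintro ⟨h1, h2⟩ j hj
        by_cases hji : j = i
        · subst hji; simpa using h2
        · simpa [hji] using h1 j ⟨hji, hj⟩
    rw [this, Measure.prod_prod, Measure.infinitePi_pi _ (fun i _ => ht i), mul_comm,
      Finset.mul_prod_erase s (fun i => μ i (t i)) hi]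
  · have : (fun p : (∀ i, X i) × X i => Function.update p.1 i p.2) ⁻¹' Set.pi s t
        = (Set.pi s t) ×ˢ Set.univ := by
      ext ⟨x, y⟩
      simp only [Set.mem_preimage, Set.mem_pi, Finset.mem_coe, Set.mem_prod, Set.mem_univ, and_true]
      refine forall₂_congr fun j hj => ?_
      have hji : j ≠ i := fun h => hi (h ▸ hj)
      simp [hji]
    rw [this, Measure.prod_prod, Measure.infinitePi_pi _ (fun i _ => ht i), measure_univ, mul_one]

theorem measurePreserving_update_pi {ι : Type*} [Fintype ι] [DecidableEq ι] {X : ι → Type*}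
    [∀ i, MeasurableSpace (X i)] (μ : ∀ i, Measure (X i)) [∀ i, IsProbabilityMeasure (μ i)] (i : ι) :
    MeasurePreserving (fun p : (∀ i, X i) × X i => Function.update p.1 i p.2)
      ((Measure.pi μ).prod (μ i)) (Measure.pi μ) := by
  rw [← Measure.infinitePi_eq_pi]
  exact measurePreserving_update_infinitePi μ i

theorem measurePreserving_resample_snd {A B X : Type*} [MeasurableSpace A] [MeasurableSpace B]
    [MeasurableSpace X] {μ : Measure A} {ν : Measure B} {ξ : Measure X} [SFinite μ] [SFinite ν]
    [SFinite ξ] {g : B × X → B} (hg : MeasurePreserving g (ν.prod ξ) ν) :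
    MeasurePreserving (fun p : (A × B) × X => (p.1.1, g (p.1.2, p.2))) ((μ.prod ν).prod ξ)
      (μ.prod ν) :=
  ((MeasurePreserving.id μ).prod hg).comp (measurePreserving_prodAssoc μ ν ξ)

theorem measurePreserving_resample_fst {A B X : Type*} [MeasurableSpace A] [MeasurableSpace B]
    [MeasurableSpace X] {μ : Measure A} {ν : Measure B} {ξ : Measure X} [SFinite μ] [SFinite ν]
    [SFinite ξ] {g : B × X → B} (hg : MeasurePreserving g (ν.prod ξ) ν) :
    MeasurePreserving (fun p : (B × A) × X => (g (p.1.1, p.2), p.1.2)) ((ν.prod μ).prod ξ)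
      (ν.prod μ) :=
  (Measure.measurePreserving_swap.comp (measurePreserving_resample_snd (μ := μ) hg)).comp
    (Measure.measurePreserving_swap.prod (MeasurePreserving.id ξ))

variable {d K : ℕ}

/-! ### The contexts of one round -/

/-- The perturbed contexts determined by the draw of one round. -/
def ctxOf (z : RoundDraw d K) : Contexts d K :=
  fun a => Sum.map (fun v => v + z.2.1 a) id (z.1 a)

theorem contexts_eq (ω : Sample d K) (t : ℕ) : contexts ω t = ctxOf (ω.2 t) := rfl

/-- The context vector of action `a` determined by the draw of one round (with value `0` for an
unavailable action). -/
def vecOf (z : RoundDraw d K) (a : Fin K) : Vec d := ctxVec (ctxOf z) a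

theorem measurable_sumMap_add :
    Measurable fun p : (Vec d ⊕ Unit) × Vec d => (Sum.map (fun v => v + p.2) id p.1 : Vec d ⊕ Unit) := by
  have h : (fun p : (Vec d ⊕ Unit) × Vec d => (Sum.map (fun v => v + p.2) id p.1 : Vec d ⊕ Unit))
      = (Sum.map (fun q : Vec d × Vec d => q.1 + q.2) (fun q : Unit × Vec d => q.1))
        ∘ MeasurableEquiv.sumProdDistrib (Vec d) Unit (Vec d) := by
    ext ⟨x | x, e⟩ <;> rfl
  rw [h]
  exact (Measurable.sumMap (by fun_prop) measurable_fst).comp (MeasurableEquiv.measurable _)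

@[fun_prop]
theorem measurable_ctxOf : Measurable (ctxOf : RoundDraw d K → Contexts d K) := by
  refine measurable_pi_iff.2 fun a => ?_
  exact measurable_sumMap_add.comp
    (f := fun z : RoundDraw d K => (z.1 a, z.2.1 a)) (by fun_prop)

@[fun_prop]
theorem measurable_ctxVec (a : Fin K) : Measurable fun c : Contexts d K => ctxVec c a :=
  (Measurable.sumElim measurable_id measurable_const).comp (measurable_pi_apply a)

@[fun_prop]
theorem measurable_vecOf (a : Fin K) : Measurable fun z : RoundDraw d K => vecOf z a :=
  (measurable_ctxVec a).comp measurable_ctxOf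

@[fun_prop]
theorem measurable_uncurry_ctxVec {α : Type*} [MeasurableSpace α] {f : α → Contexts d K}
    {g : α → Fin K} (hf : Measurable f) (hg : Measurable g) :
    Measurable fun x => ctxVec (f x) (g x) := by
  have h : Measurable fun p : Contexts d K × Fin K => ctxVec p.1 p.2 :=
    measurable_from_prod_countable_left fun a => measurable_ctxVec a
  exact h.comp (hf.prodMk hg)

/-- The action `a` is available. -/
def Avail (c : Contexts d K) (a : Fin K) : Prop := ∃ x, c a = Sum.inl x

theorem measurableSet_avail (a : Fin K) : MeasurableSet {c : Contexts d K | Avail c a} := by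
  have : {c : Contexts d K | Avail c a} = (fun c => c a) ⁻¹' Set.range Sum.inl := by
    ext c; simp [Avail, eq_comm]
  rw [this]
  exact measurable_pi_apply a measurableSet_range_inl

theorem Avail.eq {c : Contexts d K} {a : Fin K} (h : Avail c a) : c a = Sum.inl (ctxVec c a) := by
  obtain ⟨x, hx⟩ := h
  rw [ctxVec, hx]; rfl

theorem rewardSet_eq (θ : Vec d) (c : Contexts d K) :
    {v : ℝ | ∃ a x, c a = Sum.inl x ∧ v = inner ℝ θ x}
      = (fun a => inner ℝ θ (ctxVec c a)) '' {a | Avail c a} := by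
  ext v
  constructor
  · rintro ⟨a, x, h, rfl⟩
    refine ⟨a, ⟨x, h⟩, ?_⟩
    simp [ctxVec, h]
  · rintro ⟨a, h, rfl⟩
    exact ⟨a, _, h.eq, rfl⟩

theorem le_bestReward {θ : Vec d} {c : Contexts d K} {a : Fin K} (h : Avail c a) :
    inner ℝ θ (ctxVec c a) ≤ bestReward θ c := by
  rw [bestReward, rewardSet_eq]
  exact le_csSup ((Set.toFinite _).image _).bddAbove ⟨a, h, rfl⟩

theorem exists_bestReward {θ : Vec d} {c : Contexts d K} {a : Fin K} (h : Avail c a) :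
    ∃ b, Avail c b ∧ bestReward θ c = inner ℝ θ (ctxVec c b) := by
  have hne : ((fun a => (inner ℝ θ (ctxVec c a) : ℝ)) '' {a | Avail c a}).Nonempty := ⟨_, a, h, rfl⟩
  obtain ⟨b, hb, hbe⟩ := hne.csSup_mem ((Set.toFinite {a | Avail c a}).image _)
  refine ⟨b, hb, ?_⟩
  rw [bestReward, rewardSet_eq]
  exact hbe.symm

theorem bestReward_le {θ : Vec d} {c : Contexts d K} {B : ℝ} {a : Fin K} (ha : Avail c a)
    (h : ∀ b, Avail c b → inner ℝ θ (ctxVec c b) ≤ B) : bestReward θ c ≤ B := by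
  obtain ⟨b, hb, he⟩ := exists_bestReward (θ := θ) ha
  rw [he]; exact h b hb

open Classical in
/-- The maximum as a supremum over all actions, which shows that it is measurable. -/
theorem bestReward_eq_iSup (θ : Vec d) (c : Contexts d K) :
    bestReward θ c
      = (⨆ a : Fin K, if Avail c a then ((inner ℝ θ (ctxVec c a) : ℝ) : EReal) else ⊥).toReal := by
  by_cases h : ∃ a, Avail c a
  · obtain ⟨a, ha⟩ := h
    obtain ⟨b, hb, he⟩ := exists_bestReward (θ := θ) ha
    have : (⨆ a : Fin K, if Avail c a then ((inner ℝ θ (ctxVec c a) : ℝ) : EReal) else ⊥)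
        = ((bestReward θ c : ℝ) : EReal) := by
      refine le_antisymm (iSup_le fun a' => ?_) ?_
      · split_ifs with h'
        · exact_mod_cast le_bestReward h'
        · exact bot_le
      · refine le_iSup_of_le b ?_
        rw [if_pos hb, he]
    rw [this, EReal.toReal_coe]
  · push Not at h
    have h1 : (⨆ a : Fin K, if Avail c a then ((inner ℝ θ (ctxVec c a) : ℝ) : EReal) else ⊥) = ⊥ := by
      simp [h]
    rw [h1, bestReward, rewardSet_eq]
    simp [h]

@[fun_prop]
theorem measurable_bestReward {α : Type*} [MeasurableSpace α] {f : α → Vec d}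
    {g : α → Contexts d K} (hf : Measurable f) (hg : Measurable g) :
    Measurable fun x => bestReward (f x) (g x) := by
  classical
  simp_rw [bestReward_eq_iSup]
  refine measurable_ereal_toReal.comp (Measurable.iSup fun a => ?_)
  refine Measurable.ite (hg (measurableSet_avail a)) ?_ measurable_const
  exact measurable_coe_real_ereal.comp (hf.inner (by fun_prop))

/-! ### Distribution of the perturbed contexts of one round -/

/-- Replace the perturbation of action `a`. -/
def setEps (a : Fin K) (p : RoundDraw d K × Vec d) : RoundDraw d K :=
  (p.1.1, Function.update p.1.2.1 a p.2, p.1.2.2)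

/-- Replace the reward noise of action `a`. -/
def setNoise (a : Fin K) (p : RoundDraw d K × ℝ) : RoundDraw d K :=
  (p.1.1, p.1.2.1, Function.update p.1.2.2 a p.2)

variable (I : ProblemInstance d K)

theorem measurePreserving_setEps (a : Fin K) :
    MeasurePreserving (setEps a) ((roundLaw I).prod (perturbationLaw d I.rho)) (roundLaw I) :=
  measurePreserving_resample_snd (measurePreserving_resample_fst
    (measurePreserving_update_pi (fun _ : Fin K => perturbationLaw d I.rho) a))

theorem measurePreserving_setNoise (a : Fin K) :
    MeasurePreserving (setNoise a) ((roundLaw I).prod (gaussianReal 0 1)) (roundLaw I) :=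
  measurePreserving_resample_snd (measurePreserving_resample_snd
    (measurePreserving_update_pi (fun _ : Fin K => gaussianReal 0 1) a))

theorem measurePreserving_eps (a : Fin K) :
    MeasurePreserving (fun z : RoundDraw d K => z.2.1 a) (roundLaw I) (perturbationLaw d I.rho) :=
  (measurePreserving_eval (fun _ : Fin K => perturbationLaw d I.rho) a).comp
    (measurePreserving_fst.comp measurePreserving_snd)

/-- Almost sure properties of the mean contexts hold almost surely for the draw of a round. -/
theorem ae_mean (P : Contexts d K → Prop) (h : ∀ᵐ m ∂I.meanDist, P m) :
    ∀ᵐ z ∂roundLaw I, P z.1 :=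
  (measurePreserving_fst (μ := I.meanDist)).quasiMeasurePreserving.ae h

theorem avail_ctxOf {z : RoundDraw d K} {a : Fin K} : Avail (ctxOf z) a ↔ ∃ v, z.1 a = Sum.inl v := by
  unfold Avail ctxOf
  cases h : z.1 a <;> simp

/-- The mean context vector of an action (with value `0` for an unavailable one). -/
def meanVec (z : RoundDraw d K) (a : Fin K) : Vec d := Sum.elim id (fun _ => 0) (z.1 a)

theorem vecOf_of_avail {z : RoundDraw d K} {a : Fin K} (h : Avail (ctxOf z) a) :
    vecOf z a = meanVec z a + z.2.1 a := by
  obtain ⟨v, hv⟩ := avail_ctxOf.1 h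
  simp [vecOf, ctxVec, ctxOf, meanVec, hv]

theorem vecOf_of_not_avail {z : RoundDraw d K} {a : Fin K} (h : ¬ Avail (ctxOf z) a) :
    vecOf z a = 0 := by
  have h' := h
  rw [avail_ctxOf] at h'
  unfold vecOf ctxVec ctxOf
  cases hz : z.1 a with
  | inl v => exact absurd ⟨v, hz⟩ h'
  | inr u => simp [Sum.map]

theorem ae_exists_avail : ∀ᵐ z ∂roundLaw I, ∃ a, Avail (ctxOf z) a := by
  filter_upwards [ae_mean I (fun m => ∃ a v, m a = Sum.inl v) I.exists_available] with z hz
  obtain ⟨a, v, h⟩ := hz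
  exact ⟨a, avail_ctxOf.2 ⟨v, h⟩⟩

theorem ae_norm_meanVec_le : ∀ᵐ z ∂roundLaw I, ∀ a, ‖meanVec z a‖ ≤ 1 := by
  filter_upwards [ae_mean I (fun m => ∀ a v, m a = Sum.inl v → ‖v‖ ≤ 1) I.norm_le_one] with z hz a
  unfold meanVec
  cases h : z.1 a with
  | inl v => simpa using hz a v h
  | inr u => simp

/-- Since almost surely some action is available, there is an action. -/
theorem one_le_K (I : ProblemInstance d K) : 1 ≤ K := by
  obtain ⟨z, a, _⟩ := (ae_exists_avail I).exists
  have := a.isLt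
  omega

/-- In dimension `0` the bound `1 / √d` for the perturbation size is the junk value `0`, so that
`rho` could not be positive. -/
theorem one_le_d (I : ProblemInstance d K) : 1 ≤ d := by
  rcases Nat.eq_zero_or_pos d with h | h
  · have h1 := I.rho_le
    have h2 := I.rho_pos
    subst h
    simp at h1
    linarith
  · exact h

theorem rho_sq_mul_le : (d : ℝ) * I.rho ^ 2 ≤ 1 := by
  have hd : (1:ℝ) ≤ d := by exact_mod_cast one_le_d I
  have h1 : I.rho ^ 2 ≤ (1 / Real.sqrt d) ^ 2 := by
    have := I.rho_pos
    have := I.rho_le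
    gcongr
  rw [div_pow, Real.sq_sqrt (by linarith), one_pow, le_div_iff₀ (by linarith)] at h1
  linarith

theorem rho_le_one : I.rho ≤ 1 := by
  have hd : (1:ℝ) ≤ d := by exact_mod_cast one_le_d I
  have := rho_sq_mul_le I
  have := I.rho_pos
  nlinarith

variable {I}

/-- It is unlikely that an available action `a` has almost the same expected reward as another
action `b`: given everything but the perturbation of `a`, the reward of `a` has a bounded density.
-/
theorem roundLaw_gap_le {θ : Vec d} (hθ : θ ≠ 0) {a b : Fin K} (hab : a ≠ b) (γ : ℝ) :
    roundLaw I {z | Avail (ctxOf z) a ∧ |inner ℝ θ (vecOf z a) - inner ℝ θ (vecOf z b)| ≤ γ}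
      ≤ ENNReal.ofReal (γ / (I.rho * ‖θ‖)) := by
  set B := {z : RoundDraw d K |
    Avail (ctxOf z) a ∧ |inner ℝ θ (vecOf z a) - inner ℝ θ (vecOf z b)| ≤ γ}
  have hB : MeasurableSet B := by
    exact MeasurableSet.inter (measurable_ctxOf (measurableSet_avail a))
      (measurableSet_le (f := fun z : RoundDraw d K =>
        |inner ℝ θ (vecOf z a) - inner ℝ θ (vecOf z b)|) (by fun_prop) (by fun_prop))
  rw [← (measurePreserving_setEps I a).measure_preimage hB.nullMeasurableSet,
    Measure.prod_apply ((measurePreserving_setEps I a).measurable hB)]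
  calc _ ≤ ∫⁻ _z, ENNReal.ofReal (γ / (I.rho * ‖θ‖)) ∂roundLaw I := by
        refine lintegral_mono fun z => ?_
        refine le_trans (measure_mono ?_) (perturbationLaw_smallBall I.rho_pos hθ
          (inner ℝ θ (vecOf z b) - inner ℝ θ (meanVec z a)) γ)
        intro e he
        obtain ⟨h1, h2⟩ : Avail (ctxOf (setEps a (z, e))) a ∧ _ := he
        rw [vecOf_of_avail h1] at h2
        have h3 : vecOf (setEps a (z, e)) b = vecOf z b := by
          simp [vecOf, ctxVec, ctxOf, setEps, hab.symm]
        have h4 : (setEps a (z, e)).2.1 a = e := by simp [setEps]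
        rw [h3, h4, inner_add_right] at h2
        show |inner ℝ θ e - _| ≤ γ
        have h5 : meanVec (setEps a (z, e)) a = meanVec z a := rfl
        rw [h5] at h2
        convert h2 using 2
        ring
    _ = _ := by simp

theorem ae_vecOf_ne_zero (I : ProblemInstance d K) (a : Fin K) :
    ∀ᵐ z ∂roundLaw I, Avail (ctxOf z) a → vecOf z a ≠ 0 := by
  have hw : (EuclideanSpace.single (⟨0, one_le_d I⟩ : Fin d) (1:ℝ) : Vec d) ≠ 0 := by
    simp
  set w : Vec d := EuclideanSpace.single (⟨0, one_le_d I⟩ : Fin d) (1:ℝ)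
  set B := {z : RoundDraw d K | Avail (ctxOf z) a ∧ vecOf z a = 0}
  have hB : MeasurableSet B := by
    refine MeasurableSet.inter (measurable_ctxOf (measurableSet_avail a))
      (measurable_vecOf a (measurableSet_singleton 0))
  have : roundLaw I B = 0 := by
    rw [← (measurePreserving_setEps I a).measure_preimage hB.nullMeasurableSet,
      Measure.prod_apply ((measurePreserving_setEps I a).measurable hB)]
    rw [← nonpos_iff_eq_zero]
    calc _ ≤ ∫⁻ _z, 0 ∂roundLaw I := by
          refine lintegral_mono fun z => ?_
          refine le_trans (measure_mono ?_) ((perturbationLaw_smallBall I.rho_pos hw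
            (- inner ℝ w (meanVec z a)) 0).trans_eq (by simp))
          intro e he
          obtain ⟨h1, h2⟩ : Avail (ctxOf (setEps a (z, e))) a ∧ _ := he
          rw [vecOf_of_avail h1] at h2
          have h4 : (setEps a (z, e)).2.1 a = e := by simp [setEps]
          have h5 : meanVec (setEps a (z, e)) a = meanVec z a := rfl
          rw [h4, h5] at h2
          have h6 : inner ℝ w (meanVec z a) + inner ℝ w e = 0 := by
            rw [← inner_add_right, h2, inner_zero_right]
          show |inner ℝ w e - _| ≤ 0
          rw [sub_neg_eq_add, add_comm, h6, abs_zero]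
      _ = _ := by simp
  rw [ae_iff]
  convert this using 2
  ext z; simp [B]

/-! ### Size of the contexts -/

variable (I)

/-- Sum of the exponentials of the absolute values of the normalized perturbations (up to a
factor `2`). Its logarithm dominates all of them. -/
noncomputable def expSum (z : RoundDraw d K) : ℝ :=
  ∑ a, ∑ i, (Real.exp (z.2.1 a i / I.rho) + Real.exp (-(z.2.1 a i / I.rho)))

/-- An upper bound for the norms of all context vectors of a round, whose moments are easy to
control. -/
noncomputable def radius (z : RoundDraw d K) : ℝ := 1 + Real.log (expSum I z)

@[fun_prop]
theorem measurable_expSum : Measurable (expSum I) := by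
  unfold expSum; fun_prop

@[fun_prop]
theorem measurable_radius : Measurable (radius I) := by
  unfold radius; fun_prop

theorem exp_abs_le_expSum (z : RoundDraw d K) (a : Fin K) (i : Fin d) :
    Real.exp |z.2.1 a i / I.rho| ≤ expSum I z := by
  have h1 : ∀ x : ℝ, Real.exp |x| ≤ Real.exp x + Real.exp (-x) := fun x => by
    have := Real.exp_pos x
    have := Real.exp_pos (-x)
    rcases abs_cases x with ⟨h, _⟩ | ⟨h, _⟩ <;> rw [h] <;> linarith
  refine (h1 _).trans ?_
  unfold expSum
  refine le_trans ?_ (Finset.single_le_sum (f := fun a => ∑ i, (Real.exp (z.2.1 a i / I.rho)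
    + Real.exp (-(z.2.1 a i / I.rho)))) (fun a _ => by positivity) (Finset.mem_univ a))
  exact Finset.single_le_sum (f := fun i => (Real.exp (z.2.1 a i / I.rho)
    + Real.exp (-(z.2.1 a i / I.rho)))) (fun a _ => by positivity) (Finset.mem_univ i)

theorem one_le_expSum (z : RoundDraw d K) : 1 ≤ expSum I z := by
  refine le_trans ?_ (exp_abs_le_expSum I z ⟨0, one_le_K I⟩ ⟨0, one_le_d I⟩)
  exact Real.one_le_exp (abs_nonneg _)

theorem one_le_radius (z : RoundDraw d K) : 1 ≤ radius I z := by
  have := Real.log_nonneg (one_le_expSum I z)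
  unfold radius; linarith

/-- The factor `√d` from the number of components is compensated by the bound on `rho`. -/
theorem norm_eps_le (z : RoundDraw d K) (a : Fin K) : ‖z.2.1 a‖ ≤ Real.log (expSum I z) := by
  have h0 := Real.log_nonneg (one_le_expSum I z)
  have h1 : ∀ i, (z.2.1 a i) ^ 2 ≤ I.rho ^ 2 * Real.log (expSum I z) ^ 2 := fun i => by
    have h2 : |z.2.1 a i / I.rho| ≤ Real.log (expSum I z) := by
      rw [Real.le_log_iff_exp_le (by linarith [one_le_expSum I z])]
      exact exp_abs_le_expSum I z a i
    rw [abs_div, abs_of_pos I.rho_pos, div_le_iff₀ I.rho_pos] at h2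
    rw [← sq_abs, ← mul_pow, mul_comm]
    gcongr
  refine abs_le_of_sq_le_sq' ?_ h0 |>.2
  rw [EuclideanSpace.real_norm_sq_eq]
  calc ∑ i, (z.2.1 a i) ^ 2 ≤ ∑ _i : Fin d, I.rho ^ 2 * Real.log (expSum I z) ^ 2 :=
        Finset.sum_le_sum fun i _ => h1 i
    _ = (d * I.rho ^ 2) * Real.log (expSum I z) ^ 2 := by simp; ring
    _ ≤ 1 * Real.log (expSum I z) ^ 2 := by
        gcongr; exact rho_sq_mul_le I
    _ = _ := one_mul _

theorem ae_norm_vecOf_le : ∀ᵐ z ∂roundLaw I, ∀ a, ‖vecOf z a‖ ≤ radius I z := by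
  filter_upwards [ae_norm_meanVec_le I] with z hz a
  by_cases h : Avail (ctxOf z) a
  · rw [vecOf_of_avail h]
    exact (norm_add_le _ _).trans (add_le_add (hz a) (norm_eps_le I z a))
  · rw [vecOf_of_not_avail h, norm_zero]
    linarith [one_le_radius I z]

theorem lintegral_expSum_le :
    ∫⁻ z, ENNReal.ofReal (expSum I z) ∂roundLaw I ≤ ENNReal.ofReal (2 * K * d * Real.exp (1 / 2)) := by
  have key : ∀ (a : Fin K) (i : Fin d) (s : ℝ), s ^ 2 = 1 →
      ∫⁻ z, ENNReal.ofReal (Real.exp (s * (z.2.1 a i / I.rho))) ∂roundLaw I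
        = ENNReal.ofReal (Real.exp (1 / 2)) := by
    intro a i s hs
    have h := lintegral_exp_inner_perturbationLaw (rho := I.rho)
      (EuclideanSpace.single i (s / I.rho) : Vec d)
    rw [← (measurePreserving_eps I a).lintegral_comp (by fun_prop)] at h
    have hρ := I.rho_pos.ne'
    simp only [EuclideanSpace.inner_single_left, conj_trivial, PiLp.norm_single, Real.norm_eq_abs, sq_abs,
      div_pow, hs] at h
    convert h using 5
    · ring
    · field_simp
  unfold expSum
  simp_rw [ENNReal.ofReal_sum_of_nonneg (fun a (_ : a ∈ Finset.univ) =>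
    Finset.sum_nonneg fun i _ => add_nonneg (Real.exp_pos _).le (Real.exp_pos _).le),
    ENNReal.ofReal_sum_of_nonneg (fun i (_ : i ∈ Finset.univ) =>
    add_nonneg (Real.exp_pos _).le (Real.exp_pos _).le),
    ENNReal.ofReal_add (Real.exp_pos _).le (Real.exp_pos _).le]
  rw [lintegral_finsetSum _ fun a _ => by fun_prop]
  have h1 : ∀ a : Fin K, ∫⁻ z, ∑ i : Fin d, (ENNReal.ofReal (Real.exp (z.2.1 a i / I.rho))
      + ENNReal.ofReal (Real.exp (-(z.2.1 a i / I.rho)))) ∂roundLaw I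
      = ∑ i : Fin d, ∫⁻ z, (ENNReal.ofReal (Real.exp (z.2.1 a i / I.rho))
      + ENNReal.ofReal (Real.exp (-(z.2.1 a i / I.rho)))) ∂roundLaw I :=
    fun a => lintegral_finsetSum _ fun i _ => by fun_prop
  simp_rw [h1]
  have h2 : ∀ a i, ∫⁻ z, (ENNReal.ofReal (Real.exp (z.2.1 a i / I.rho))
      + ENNReal.ofReal (Real.exp (-(z.2.1 a i / I.rho)))) ∂roundLaw I
      = ENNReal.ofReal (2 * Real.exp (1 / 2)) := fun a i => by
    rw [lintegral_add_left (by fun_prop)]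
    have h3 := key a i 1 (by norm_num)
    have h4 := key a i (-1) (by norm_num)
    simp only [one_mul, neg_mul] at h3 h4
    rw [h3, h4, ← ENNReal.ofReal_add (Real.exp_pos _).le (Real.exp_pos _).le, two_mul]
  simp_rw [h2]
  simp only [Finset.sum_const, Finset.card_univ, Fintype.card_fin, nsmul_eq_mul]
  rw [← ENNReal.ofReal_natCast, ← ENNReal.ofReal_natCast, ← ENNReal.ofReal_mul (by positivity),
    ← ENNReal.ofReal_mul (by positivity)]
  refine ENNReal.ofReal_le_ofReal (le_of_eq (by ring))

/-- A bound of Jensen type for the square of the logarithm: if `M` bounds the expectation of `Q`,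
then the expectation of `(log Q) ^ 2` is at most of the order of `(log M) ^ 2`. -/
theorem sq_log_le {M Q : ℝ} (hM : 1 ≤ M) (hQ : 1 ≤ Q) :
    Real.log Q ^ 2 ≤ 2 * Real.log M ^ 2 + 8 * (Q / M) := by
  have hM0 : 0 < M := by linarith
  have hQ0 : 0 < Q := by linarith
  rcases le_total Q M with h | h
  · have h1 := Real.log_le_log hQ0 h
    have h2 := Real.log_nonneg hQ
    have h3 : 0 ≤ Q / M := by positivity
    nlinarith
  · set u := Q / M with hu
    have hu1 : 1 ≤ u := (one_le_div hM0).2 h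
    have hlog : Real.log Q = Real.log M + Real.log u := by
      rw [hu, Real.log_div hQ0.ne' hM0.ne']; ring
    have h4 : Real.log u ≤ 2 * Real.sqrt u := by
      have h5 := Real.log_le_sub_one_of_pos (Real.sqrt_pos.2 (by linarith : 0 < u))
      rw [Real.log_sqrt (by linarith)] at h5
      linarith
    have h6 := Real.log_nonneg hu1
    have h7 : Real.log u ^ 2 ≤ 4 * u := by
      calc Real.log u ^ 2 ≤ (2 * Real.sqrt u) ^ 2 := by gcongr
        _ = 4 * u := by rw [mul_pow, Real.sq_sqrt (by linarith)]; norm_num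
    rw [hlog]
    nlinarith [sq_nonneg (Real.log M - Real.log u)]

theorem one_le_KD (I : ProblemInstance d K) : (1:ℝ) ≤ K * d := by
  have h1 : (1:ℝ) ≤ K := by exact_mod_cast one_le_K I
  have h2 : (1:ℝ) ≤ d := by exact_mod_cast one_le_d I
  nlinarith

/-- Only a logarithm of the number of perturbation components is lost. -/
theorem lintegral_radius_sq_le :
    ∫⁻ z, ENNReal.ofReal (radius I z ^ 2) ∂roundLaw I
      ≤ ENNReal.ofReal (34 * (1 + Real.log (K * d)) ^ 2) := by
  set M : ℝ := 2 * K * d * Real.exp (1 / 2) with hM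
  have hKD := one_le_KD I
  have he : (1:ℝ) ≤ Real.exp (1/2) := Real.one_le_exp (by norm_num)
  have hM1 : 1 ≤ M := by rw [hM, mul_assoc 2]; nlinarith
  have hM0 : 0 < M := by linarith
  have hlogM : Real.log M ≤ 2 * (1 + Real.log (K * d)) := by
    rw [hM, mul_assoc 2, Real.log_mul (by linarith) (by linarith), Real.log_mul (by norm_num) (by linarith),
      Real.log_exp]
    have := Real.log_two_lt_d9
    have := Real.log_nonneg hKD
    linarith
  have hlogM0 := Real.log_nonneg hM1
  have hpt : ∀ z, ENNReal.ofReal (radius I z ^ 2)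
      ≤ ENNReal.ofReal (2 + 4 * Real.log M ^ 2) + ENNReal.ofReal (16 / M) * ENNReal.ofReal (expSum I z) := by
    intro z
    have hQ := one_le_expSum I z
    rw [← ENNReal.ofReal_mul (by positivity), ← ENNReal.ofReal_add (by positivity) (by positivity)]
    refine ENNReal.ofReal_le_ofReal ?_
    have h1 := sq_log_le hM1 hQ
    have h2 : 16 / M * expSum I z = 16 * (expSum I z / M) := by ring
    unfold radius
    rw [h2]
    nlinarith [sq_nonneg (1 - Real.log (expSum I z))]
  calc _ ≤ ENNReal.ofReal (2 + 4 * Real.log M ^ 2)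
        + ENNReal.ofReal (16 / M) * ENNReal.ofReal M := by
        refine (lintegral_mono hpt).trans ?_
        rw [lintegral_add_left (by fun_prop), lintegral_const_mul _ (by fun_prop), lintegral_const,
          measure_univ, mul_one]
        gcongr
        exact lintegral_expSum_le I
    _ ≤ _ := by
        rw [← ENNReal.ofReal_mul (by positivity), ← ENNReal.ofReal_add (by positivity) (by positivity)]
        refine ENNReal.ofReal_le_ofReal ?_
        have h3 : 16 / M * M = 16 := by field_simp
        have h4 : Real.log M ^ 2 ≤ (2 * (1 + Real.log (K * d))) ^ 2 := by gcongr
        have h5 := Real.log_nonneg hKD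
        rw [h3]
        nlinarith

/-- All context vectors of a round have norm at most `1 + ρ √(2 d x)`, up to an event of small
probability. -/
theorem roundLaw_norm_gt_le {x : ℝ} (hx : 0 ≤ x) :
    roundLaw I {z | ∃ a, 1 + I.rho * Real.sqrt (2 * d * x) < ‖vecOf z a‖}
      ≤ ENNReal.ofReal (2 * K * d * Real.exp (-x)) := by
  have hρ := I.rho_pos
  have hd : (1:ℝ) ≤ d := by exact_mod_cast one_le_d I
  set E : Fin K → Fin d → ℝ → Set (RoundDraw d K) := fun a i s =>
    {z | I.rho * Real.sqrt (2 * x) ≤ s * z.2.1 a i} with hE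
  have key : ∀ a i (s : ℝ), s ^ 2 = 1 → roundLaw I (E a i s) ≤ ENNReal.ofReal (Real.exp (-x)) := by
    intro a i s hs
    have h := perturbationLaw_tail (rho := I.rho) (EuclideanSpace.single i s : Vec d)
      (a := I.rho * Real.sqrt (2 * x)) (s := I.rho ^ 2) (by positivity) (by positivity)
      (by simp [hs])
    have hm : MeasurableSet {e : Vec d | I.rho * Real.sqrt (2 * x)
        ≤ inner ℝ (EuclideanSpace.single i s : Vec d) e} :=
      measurableSet_le (by fun_prop) (by fun_prop)
    rw [← (measurePreserving_eps I a).measure_preimage hm.nullMeasurableSet] at h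
    have h1 : -((I.rho * Real.sqrt (2 * x)) ^ 2 / (2 * I.rho ^ 2)) = -x := by
      rw [mul_pow, Real.sq_sqrt (by positivity)]; field_simp
    rw [h1] at h
    convert h using 3
    simp [hE, EuclideanSpace.inner_single_left]
  have hsub : {z : RoundDraw d K | ∃ a, 1 + I.rho * Real.sqrt (2 * d * x) < ‖vecOf z a‖}
      ≤ᵐ[roundLaw I] ⋃ a, ⋃ i, (E a i 1 ∪ E a i (-1)) := by
    filter_upwards [ae_norm_meanVec_le I] with z hz hz2
    obtain ⟨a, ha⟩ : ∃ a, 1 + I.rho * Real.sqrt (2 * d * x) < ‖vecOf z a‖ := hz2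
    have hav : Avail (ctxOf z) a := by
      by_contra hna
      rw [vecOf_of_not_avail hna, norm_zero] at ha
      have : 0 ≤ I.rho * Real.sqrt (2 * d * x) := by positivity
      linarith
    rw [vecOf_of_avail hav] at ha
    -- the mean context has norm at most one, so the perturbation is long
    have h1 : I.rho * Real.sqrt (2 * d * x) < ‖z.2.1 a‖ := by
      have := norm_add_le (meanVec z a) (z.2.1 a)
      have := hz a
      linarith
    by_contra hcon
    -- if every component were below its own threshold, the perturbation would be short
    have h2 : ∀ i, (z.2.1 a i) ^ 2 ≤ I.rho ^ 2 * (2 * x) := by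
      intro i
      have h3 : |z.2.1 a i| ≤ I.rho * Real.sqrt (2 * x) := by
        by_contra hlt
        push Not at hlt
        refine hcon (Set.mem_iUnion.2 ⟨a, Set.mem_iUnion.2 ⟨i, ?_⟩⟩)
        rcases abs_cases (z.2.1 a i) with ⟨h, _⟩ | ⟨h, _⟩
        · left; simp only [hE, Set.mem_ofPred_eq]; linarith
        · right; simp only [hE, Set.mem_ofPred_eq]; linarith
      rw [← sq_abs]
      calc |z.2.1 a i| ^ 2 ≤ (I.rho * Real.sqrt (2 * x)) ^ 2 := by gcongr
        _ = _ := by rw [mul_pow, Real.sq_sqrt (by positivity)]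
    have h4 : ‖z.2.1 a‖ ^ 2 ≤ (I.rho * Real.sqrt (2 * d * x)) ^ 2 := by
      rw [EuclideanSpace.real_norm_sq_eq, mul_pow, Real.sq_sqrt (by positivity)]
      calc ∑ i, (z.2.1 a i) ^ 2 ≤ ∑ _i : Fin d, I.rho ^ 2 * (2 * x) :=
            Finset.sum_le_sum fun i _ => h2 i
        _ = _ := by simp; ring
    have h5 := abs_le_of_sq_le_sq' h4 (by positivity)
    linarith [h5.2]
  refine (measure_mono_ae hsub).trans ?_
  calc _ ≤ ∑ a, ∑ i, (roundLaw I (E a i 1) + roundLaw I (E a i (-1))) := by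
        refine (measure_iUnion_fintype_le _ _).trans (Finset.sum_le_sum fun a _ => ?_)
        refine (measure_iUnion_fintype_le _ _).trans (Finset.sum_le_sum fun i _ => ?_)
        exact measure_union_le _ _
    _ ≤ ∑ _a : Fin K, ∑ _i : Fin d, (ENNReal.ofReal (Real.exp (-x)) + ENNReal.ofReal (Real.exp (-x))) := by
        gcongr with a _ i _
        · exact key a i 1 (by norm_num)
        · exact key a i (-1) (by norm_num)
    _ ≤ _ := by
        simp only [Finset.sum_const, Finset.card_univ, Fintype.card_fin, nsmul_eq_mul]
        rw [← ENNReal.ofReal_add (by positivity) (by positivity), ← ENNReal.ofReal_natCast,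
          ← ENNReal.ofReal_natCast, ← ENNReal.ofReal_mul (by positivity),
          ← ENNReal.ofReal_mul (by positivity)]
        refine ENNReal.ofReal_le_ofReal (le_of_eq (by ring))

end LinBandit
end

section
namespace LinBandit
open Matrix
open scoped ENNReal NNReal

variable {d K : ℕ}

/-! ### Resampling one round, and the history -/

/-- Replace the draw of round `t`. -/
def setDraw (t : ℕ) (p : Sample d K × RoundDraw d K) : Sample d K :=
  (p.1.1, Function.update p.1.2 t p.2)

instance instIsProbabilityMeasureLaw (I : ProblemInstance d K) : IsProbabilityMeasure (law I) := by
  unfold law; infer_instance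

theorem measurePreserving_setDraw (I : ProblemInstance d K) (t : ℕ) :
    MeasurePreserving (setDraw t) ((law I).prod (roundLaw I)) (law I) :=
  measurePreserving_resample_snd (measurePreserving_update_infinitePi (fun _ : ℕ => roundLaw I) t)

@[fun_prop]
theorem measurable_setDraw (t : ℕ) :
    Measurable (setDraw t : Sample d K × RoundDraw d K → Sample d K) :=
  (measurable_fst.comp measurable_fst).prodMk
    ((measurable_update_prod t).comp ((measurable_snd.comp measurable_fst).prodMk measurable_snd))

theorem measurePreserving_draw (I : ProblemInstance d K) (t : ℕ) :
    MeasurePreserving (fun ω : Sample d K => ω.2 t) (law I) (roundLaw I) :=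
  (measurePreserving_eval_infinitePi (fun _ : ℕ => roundLaw I) t).comp measurePreserving_snd

theorem measurePreserving_latent (I : ProblemInstance d K) :
    MeasurePreserving (fun ω : Sample d K => ω.1) (law I) (prior I) :=
  measurePreserving_fst

/-- The draw of round `t` can be integrated out separately, since it is independent of the rest.
-/
theorem lintegral_setDraw (I : ProblemInstance d K) (t : ℕ) {F : Sample d K → ℝ≥0∞}
    (hF : Measurable F) :
    ∫⁻ ω, F ω ∂law I = ∫⁻ ω, ∫⁻ z, F (setDraw t (ω, z)) ∂roundLaw I ∂law I := by
  rw [← (measurePreserving_setDraw I t).lintegral_comp hF, lintegral_prod]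
  exact (hF.comp (measurable_setDraw t)).aemeasurable

theorem ae_setDraw (I : ProblemInstance d K) (t : ℕ) {P : Sample d K → Prop}
    (h : ∀ᵐ ω ∂law I, P ω) : ∀ᵐ ω ∂law I, ∀ᵐ z ∂roundLaw I, P (setDraw t (ω, z)) :=
  Measure.ae_ae_of_ae_prod ((measurePreserving_setDraw I t).quasiMeasurePreserving.ae h)

theorem ae_draw (I : ProblemInstance d K) (t : ℕ) {P : RoundDraw d K → Prop}
    (h : ∀ᵐ z ∂roundLaw I, P z) : ∀ᵐ ω ∂law I, P (ω.2 t) :=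
  (measurePreserving_draw I t).quasiMeasurePreserving.ae h

@[simp] theorem setDraw_latent (t : ℕ) (ω : Sample d K) (z : RoundDraw d K) :
    (setDraw t (ω, z)).1 = ω.1 := rfl

@[simp] theorem setDraw_same (t : ℕ) (ω : Sample d K) (z : RoundDraw d K) :
    (setDraw t (ω, z)).2 t = z := by simp [setDraw]

theorem setDraw_of_ne {s t : ℕ} (h : s ≠ t) (ω : Sample d K) (z : RoundDraw d K) :
    (setDraw t (ω, z)).2 s = ω.2 s := by simp [setDraw, h]

variable (π : Policy d K)

/-- The history before round `t` does not depend on the draw of round `t`. -/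
theorem history_setDraw {n t : ℕ} (h : n ≤ t) (ω : Sample d K) (z : RoundDraw d K) :
    history π (setDraw t (ω, z)) n = history π ω n := by
  induction n with
  | zero => rfl
  | succ n ih =>
    have hn : n ≠ t := by omega
    simp only [history, contexts_eq, ih (by omega), setDraw_of_ne hn, setDraw_latent]

theorem action_setDraw (t : ℕ) (ω : Sample d K) (z : RoundDraw d K) :
    action π (setDraw t (ω, z)) t = π.act t (history π ω t) (ctxOf z) := by
  simp only [action, contexts_eq, history_setDraw π le_rfl, setDraw_same]

theorem history_succ (ω : Sample d K) (t : ℕ) :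
    history π ω (t + 1) = Fin.snoc (α := fun _ => Vec d × ℝ) (history π ω t)
      (vecOf (ω.2 t) (action π ω t),
        inner ℝ ω.1 (vecOf (ω.2 t) (action π ω t)) + (ω.2 t).2.2 (action π ω t)) := rfl

theorem history_apply (ω : Sample d K) {t : ℕ} (i : Fin t) :
    history π ω t i = (vecOf (ω.2 i) (action π ω i),
      inner ℝ ω.1 (vecOf (ω.2 i) (action π ω i)) + (ω.2 i).2.2 (action π ω i)) := by
  induction t with
  | zero => exact i.elim0
  | succ t ih =>
    rw [history_succ]
    refine Fin.lastCases ?_ (fun j => ?_) i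
    · simp
    · rw [Fin.snoc_castSucc, ih]; simp

theorem measurable_eval_action {α β : Type*} [MeasurableSpace α] [MeasurableSpace β]
    {f : α → Fin K → β} {g : α → Fin K} (hf : Measurable f) (hg : Measurable g) :
    Measurable fun x => f x (g x) := by
  have h : Measurable fun p : (Fin K → β) × Fin K => p.1 p.2 :=
    measurable_from_prod_countable_left fun a => measurable_pi_apply a
  exact h.comp (hf.prodMk hg)

theorem measurable_snoc {α : Type*} [MeasurableSpace α] {t : ℕ} {f : α → History d t}
    {g : α → Vec d × ℝ} (hf : Measurable f) (hg : Measurable g) :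
    Measurable fun x => (Fin.snoc (α := fun _ => Vec d × ℝ) (f x) (g x) : History d (t + 1)) := by
  refine measurable_pi_iff.2 fun i => ?_
  refine Fin.lastCases ?_ (fun j => ?_) i
  · simpa using hg
  · simp only [Fin.snoc_castSucc]
    exact (measurable_pi_apply j).comp hf

/-- The action of a round depends on the history, and the history of the next round on the action:
both are measurable by a joint induction. -/
theorem measurable_history_action (t : ℕ) :
    Measurable (fun ω : Sample d K => history π ω t) ∧ Measurable fun ω => action π ω t := by
  have key : ∀ t, Measurable (fun ω : Sample d K => history π ω t) →
      Measurable fun ω => action π ω t := fun t h =>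
    (π.measurable_act t).comp (h.prodMk (measurable_ctxOf.comp
      ((measurable_pi_apply t).comp measurable_snd)))
  have h : Measurable (fun ω : Sample d K => history π ω t) := by
    induction t with
    | zero => exact measurable_const
    | succ t ih =>
      have ha := key t ih
      have hz : Measurable fun ω : Sample d K => ω.2 t := (measurable_pi_apply t).comp measurable_snd
      have hx : Measurable fun ω : Sample d K => vecOf (ω.2 t) (action π ω t) :=
        measurable_uncurry_ctxVec (measurable_ctxOf.comp hz) ha
      refine measurable_snoc ih (hx.prodMk ((measurable_fst.inner hx).add ?_))
      exact measurable_eval_action (measurable_snd.comp (measurable_snd.comp hz)) ha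
  exact ⟨h, key t h⟩

@[fun_prop]
theorem measurable_history (t : ℕ) : Measurable fun ω : Sample d K => history π ω t :=
  (measurable_history_action π t).1

@[fun_prop]
theorem measurable_action (t : ℕ) : Measurable fun ω : Sample d K => action π ω t :=
  (measurable_history_action π t).2

@[fun_prop]
theorem measurable_chosen (t : ℕ) :
    Measurable fun ω : Sample d K => vecOf (ω.2 t) (action π ω t) :=
  measurable_uncurry_ctxVec (by fun_prop) (by fun_prop)

/-! ### Measurability of functions of the history -/

theorem continuous_design (t : ℕ) : Continuous (design : History d t → Matrix (Fin d) (Fin d) ℝ) := by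
  unfold design gram
  refine continuous_const.add (continuous_finsetSum _ fun i _ => ?_)
  exact Continuous.matrix_vecMulVec (by fun_prop) (by fun_prop)

theorem continuous_inv_design (t : ℕ) :
    Continuous fun h : History d t => (design h)⁻¹ := by
  have : (fun h : History d t => (design h)⁻¹)
      = fun h => ((design h).det)⁻¹ • (design h).adjugate := by
    ext1 h; rw [Matrix.inv_def, Ring.inverse_eq_inv']
  rw [this]
  have hc := continuous_design (d := d) t
  exact (hc.matrix_det.inv₀ fun h => (design_posDef h).det_pos.ne').smul hc.matrix_adjugate

@[fun_prop]
theorem measurable_spread (t : ℕ) : Measurable (spread : History d t → ℝ) := by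
  unfold spread
  exact (continuous_inv_design t).matrix_trace.measurable

@[fun_prop]
theorem measurable_logDet (t : ℕ) : Measurable (logDet : History d t → ℝ) := by
  unfold logDet
  exact Real.measurable_log.comp (continuous_design t).matrix_det.measurable

theorem continuous_noiseSum (t : ℕ) :
    Continuous fun p : Vec d × History d t => noiseSum p.1 p.2 := by
  unfold noiseSum; fun_prop

@[fun_prop]
theorem measurable_noiseEnergy {α : Type*} [MeasurableSpace α] {t : ℕ} {f : α → Vec d}
    {g : α → History d t} (hf : Measurable f) (hg : Measurable g) :
    Measurable fun x => noiseEnergy (f x) (g x) := by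
  have h : Continuous fun p : Vec d × History d t => noiseEnergy p.1 p.2 := by
    unfold noiseEnergy
    have h1 := continuous_noiseSum (d := d) t
    exact h1.dotProduct (((continuous_inv_design t).comp continuous_snd).matrix_mulVec h1)
  exact h.measurable.comp (hf.prodMk hg)

@[fun_prop]
theorem measurable_ridge (t : ℕ) : Measurable (ridge : History d t → Vec d) := by
  have h : Continuous (ridge : History d t → Vec d) := by
    unfold ridge
    have h1 : Continuous fun h : History d t => ∑ i, (h i).2 • (h i).1.ofLp := by fun_prop
    have h2 : Continuous fun h : History d t => (1 + gram h)⁻¹ *ᵥ ∑ i, (h i).2 • (h i).1.ofLp := by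
      have := continuous_inv_design (d := d) t
      unfold design at this
      exact this.matrix_mulVec h1
    exact (PiLp.continuous_toLp 2 (fun _ : Fin d => ℝ)).comp h2
  exact h.measurable

/-! ### The self-normalized exponential martingale -/

/-- The noise of the chosen action is standard Gaussian given the contexts. -/
theorem lintegral_chosen_noise (I : ProblemInstance d K) {α : Contexts d K → Fin K}
    (hα : Measurable α) {g : Contexts d K × ℝ → ℝ≥0∞} (hg : Measurable g) :
    ∫⁻ z, g (ctxOf z, z.2.2 (α (ctxOf z))) ∂roundLaw I
      = ∫⁻ z, ∫⁻ x, g (ctxOf z, x) ∂gaussianReal 0 1 ∂roundLaw I := by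
  classical
  have hdec : ∀ (F : Fin K → RoundDraw d K → ℝ≥0∞), (∀ a, Measurable (F a)) →
      ∫⁻ z, F (α (ctxOf z)) z ∂roundLaw I
        = ∑ a, ∫⁻ z, (if α (ctxOf z) = a then F a z else 0) ∂roundLaw I := by
    intro F hF
    rw [← lintegral_finsetSum]
    · refine lintegral_congr fun z => ?_
      rw [Finset.sum_ite_eq]; simp
    · intro a _
      exact Measurable.ite ((hα.comp measurable_ctxOf) (measurableSet_singleton a)) (hF a)
        measurable_const
  have hgm : Measurable fun z : RoundDraw d K => ∫⁻ x, g (ctxOf z, x) ∂gaussianReal 0 1 := by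
    refine Measurable.lintegral_prod_right' (f := fun p : RoundDraw d K × ℝ => g (ctxOf p.1, p.2)) ?_
    fun_prop
  rw [hdec (fun a z => g (ctxOf z, z.2.2 a)) fun a => by fun_prop,
    hdec (fun _ z => ∫⁻ x, g (ctxOf z, x) ∂gaussianReal 0 1) fun a => hgm]
  refine Finset.sum_congr rfl fun a _ => ?_
  have hm : Measurable fun z : RoundDraw d K => if α (ctxOf z) = a then g (ctxOf z, z.2.2 a) else 0 :=
    Measurable.ite ((hα.comp measurable_ctxOf) (measurableSet_singleton a)) (by fun_prop)
        measurable_const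
  have hprod := lintegral_prod (μ := roundLaw I) (ν := gaussianReal 0 1) _
    (hm.comp (measurePreserving_setNoise I a).measurable).aemeasurable
  rw [← (measurePreserving_setNoise I a).lintegral_comp hm]
  refine hprod.trans ?_
  refine lintegral_congr fun z => ?_
  have h1 : ∀ x : ℝ, ctxOf (setNoise a (z, x)) = ctxOf z := fun x => rfl
  have h2 : ∀ x : ℝ, (setNoise a (z, x)).2.2 a = x := fun x => by simp [setNoise]
  simp only [Function.comp, h1, h2]
  split_ifs <;> simp

/-- Exponential of half the noise energy, normalized by the square root of the determinant. -/
noncomputable def expMart {t : ℕ} (θ : Vec d) (h : History d t) : ℝ :=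
  Real.exp (noiseEnergy θ h / 2 - logDet h / 2)

/-- The martingale property: the Gaussian integral over the noise of one observation gives back
the factor by which the determinant grows. -/
theorem lintegral_expMart_snoc {t : ℕ} (θ : Vec d) (h : History d t) (x : Vec d) :
    ∫⁻ η, ENNReal.ofReal (expMart θ (Fin.snoc (α := fun _ => Vec d × ℝ) h
      (x, inner ℝ θ x + η) : History d (t + 1))) ∂gaussianReal 0 1 = ENNReal.ofReal (expMart θ h) := by
  set w := x.ofLp ⬝ᵥ (design h)⁻¹ *ᵥ x.ofLp with hw
  set s := x.ofLp ⬝ᵥ (design h)⁻¹ *ᵥ noiseSum θ h with hs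
  have hw0 : 0 ≤ w := inv_quad_nonneg (design_posDef h) _
  have hw1 : 0 < 1 + w := by linarith
  have hβ : 2 * (w / (2 * (1 + w))) < 1 := by
    rw [← mul_div_assoc, mul_div_mul_left _ _ two_ne_zero, div_lt_one hw1]; linarith
  have h1 : ∀ η : ℝ, ENNReal.ofReal (expMart θ (Fin.snoc (α := fun _ => Vec d × ℝ) h
      (x, inner ℝ θ x + η) : History d (t + 1)))
      = ENNReal.ofReal (Real.exp (noiseEnergy θ h / 2 - logDet h / 2 - Real.log (1 + w) / 2
          - s ^ 2 / (2 * (1 + w))))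
        * ENNReal.ofReal (Real.exp (s / (1 + w) * η + w / (2 * (1 + w)) * η ^ 2)) := by
    intro η
    rw [← ENNReal.ofReal_mul (Real.exp_pos _).le, ← Real.exp_add, expMart, noiseEnergy, noiseSum_snoc,
      design_snoc, logDet_snoc]
    simp only [add_sub_cancel_left]
    -- the exponent is a quadratic polynomial in the noise
    rw [quad_inv_add_vecMulVec (design_posDef h), ← hw, ← hs]
    congr 2
    unfold noiseEnergy
    field_simp
    ring
  have h2 : 1 - 2 * (w / (2 * (1 + w))) = (1 + w)⁻¹ := by field_simp; ring
  simp_rw [h1]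
  rw [lintegral_const_mul _ (by fun_prop), lintegral_exp_quadratic_gaussianReal _ hβ, h2,
    ← ENNReal.ofReal_mul (Real.exp_pos _).le, expMart]
  congr 1
  rw [Real.sqrt_inv, div_inv_eq_mul, ← mul_assoc, ← Real.exp_add,
    Real.sqrt_eq_rpow, Real.rpow_def_of_pos hw1, ← Real.exp_add]
  congr 1
  field_simp
  ring

@[fun_prop]
theorem measurable_expMart {α : Type*} [MeasurableSpace α] {t : ℕ} {f : α → Vec d}
    {g : α → History d t} (hf : Measurable f) (hg : Measurable g) :
    Measurable fun x => expMart (f x) (g x) := by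
  unfold expMart; fun_prop

/-- For every policy, the self-normalized exponential of the accumulated noise has expectation at
most one. -/
theorem lintegral_expMart_le (I : ProblemInstance d K) (t : ℕ) :
    ∫⁻ ω, ENNReal.ofReal (expMart ω.1 (history π ω t)) ∂law I ≤ 1 := by
  induction t with
  | zero =>
    have : ∀ ω : Sample d K, expMart ω.1 (history π ω 0) = 1 := fun ω => by
      simp [expMart, noiseEnergy, logDet, noiseSum, design, gram]
    simp [this]
  | succ t ih =>
    have hm : Measurable fun ω : Sample d K =>
        ENNReal.ofReal (expMart ω.1 (history π ω (t + 1))) := by fun_prop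
    rw [lintegral_setDraw I t hm]
    refine le_trans (le_of_eq (lintegral_congr fun ω => ?_)) ih
    set h := history π ω t with hh
    have hα : Measurable fun c => π.act t h c := (π.measurable_act t).comp (measurable_const.prodMk measurable_id)
    have hx : Measurable fun p : Contexts d K × ℝ => ctxVec p.1 (π.act t h p.1) :=
      measurable_uncurry_ctxVec measurable_fst (hα.comp measurable_fst)
    have hsn := measurable_snoc (t := t) (measurable_const (a := h))
      (hx.prodMk ((measurable_const (a := ω.1)).inner hx |>.add measurable_snd))
    have hnoise := lintegral_chosen_noise I hα (g := fun p => ENNReal.ofReal (expMart ω.1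
      (Fin.snoc (α := fun _ => Vec d × ℝ) h (ctxVec p.1 (π.act t h p.1),
        inner ℝ ω.1 (ctxVec p.1 (π.act t h p.1)) + p.2) : History d (t + 1)))) (by fun_prop)
    refine Eq.trans (lintegral_congr fun z => ?_) (hnoise.trans ?_)
    · rw [history_succ, action_setDraw, history_setDraw π le_rfl, setDraw_same, setDraw_latent]
      rfl
    · simp_rw [lintegral_expMart_snoc]
      simp

end LinBandit
end

section
namespace LinBandit
open Matrix
open scoped ENNReal NNReal

variable {d K : ℕ}

/-! ### Diversity of the greedily chosen contexts -/

/-- The scale at which greedily chosen contexts are spread out in every direction. The logarithm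
of `K` comes from a union bound over the actions, see `roundLaw_diverse`. -/
noncomputable def divScale (I : ProblemInstance d K) : ℝ :=
  I.rho / (3 * Real.sqrt (8 * Real.log (100 * K)))

theorem log_100K_pos (I : ProblemInstance d K) : 1 ≤ Real.log (100 * K) := by
  have h1 : (1:ℝ) ≤ K := by exact_mod_cast one_le_K I
  rw [Real.le_log_iff_exp_le (by positivity)]
  have := Real.exp_one_lt_d9
  linarith

theorem divScale_pos (I : ProblemInstance d K) : 0 < divScale I := by
  have := log_100K_pos I
  have := I.rho_pos
  unfold divScale
  positivity

theorem vecOf_setEps_of_ne {b c : Fin K} (h : c ≠ b) (z : RoundDraw d K) (e : Vec d) :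
    vecOf (setEps b (z, e)) c = vecOf z c := by
  simp [vecOf, ctxVec, ctxOf, setEps, h]

theorem avail_setEps (b c : Fin K) (z : RoundDraw d K) (e : Vec d) :
    Avail (ctxOf (setEps b (z, e))) c ↔ Avail (ctxOf z) c := by
  rw [avail_ctxOf, avail_ctxOf]; rfl

theorem vecOf_setEps_same {b : Fin K} {z : RoundDraw d K} (h : Avail (ctxOf z) b) (e : Vec d) :
    vecOf (setEps b (z, e)) b = meanVec z b + e := by
  rw [vecOf_of_avail ((avail_setEps b b z e).2 h)]
  simp [setEps, meanVec]

theorem IsArgmax.avail {score : Vec d → ℝ} {c : Contexts d K} {a : Fin K} (h : IsArgmax score c a) :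
    Avail c a := h.imp fun _ hx => hx.1

theorem IsArgmax.le {score : Vec d → ℝ} {c : Contexts d K} {a b : Fin K} (h : IsArgmax score c a)
    (hb : Avail c b) : score (ctxVec c b) ≤ score (ctxVec c a) := by
  have ha := h.avail.eq
  obtain ⟨x, hx, hmax⟩ := h
  rw [hx] at ha
  have := hmax b _ hb.eq
  rwa [Sum.inl.inj ha] at this

/-- A direction in which a shift of the perturbation of an action increases both its greedy score
and the absolute value of its component along `w`. -/
theorem exists_shift {v w : Vec d} (hv : v ≠ 0) (hw : ‖w‖ = 1) {δ : ℝ} (hδ : 0 < δ) :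
    ∃ g : Vec d, ‖g‖ ≤ 2 * δ ∧ 0 < inner ℝ g v ∧ δ ≤ |inner ℝ g w| := by
  have hv' : 0 < ‖v‖ := norm_pos_iff.2 hv
  obtain ⟨σ, hσ, hσv⟩ : ∃ σ : ℝ, |σ| = 1 ∧ 0 ≤ σ * inner ℝ w v := by
    rcases le_total 0 (inner ℝ w v : ℝ) with h | h
    · exact ⟨1, by simp, by simpa using h⟩
    · exact ⟨-1, by simp, by simpa using h⟩
  have hσ2 : σ * σ = 1 := by rw [← abs_mul_abs_self, hσ, one_mul]
  refine ⟨δ • (σ • w + ‖v‖⁻¹ • v), ?_, ?_, ?_⟩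
  · rw [norm_smul, Real.norm_of_nonneg hδ.le, mul_comm]
    gcongr
    refine (norm_add_le _ _).trans ?_
    rw [norm_smul, norm_smul, hw, Real.norm_eq_abs, hσ, norm_inv, norm_norm, inv_mul_cancel₀ hv'.ne']
    norm_num
  · rw [real_inner_smul_left, inner_add_left, real_inner_smul_left, real_inner_smul_left,
      real_inner_self_eq_norm_sq]
    have : 0 < ‖v‖⁻¹ * ‖v‖ ^ 2 := by positivity
    have : 0 < σ * inner ℝ w v + ‖v‖⁻¹ * ‖v‖ ^ 2 := by linarith
    positivity
  · rw [← one_mul |_|, ← hσ, ← abs_mul]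
    refine le_trans ?_ (le_abs_self _)
    rw [real_inner_smul_left, inner_add_left, real_inner_smul_left, real_inner_smul_left,
      real_inner_self_eq_norm_sq, hw, real_inner_comm]
    have h1 : 0 ≤ ‖v‖⁻¹ * (σ * inner ℝ w v) := by positivity
    have h2 : σ * (δ * (σ * 1 ^ 2 + ‖v‖⁻¹ * inner ℝ w v))
        = δ * (σ * σ) + δ * (‖v‖⁻¹ * (σ * inner ℝ w v)) := by ring
    rw [h2, hσ2]
    nlinarith

/-- A greedily chosen context vector has a component of size at least `divScale I` in every
direction, with probability bounded below. The reason is that the conditional distribution of the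
perturbation of an action, given that this action is chosen, is a Gaussian restricted to a
half-space; shifting it further into the half-space costs only a constant factor. -/
theorem roundLaw_diverse (I : ProblemInstance d K) {v w : Vec d} (hv : v ≠ 0) (hw : ‖w‖ = 1)
    {α : Contexts d K → Fin K} (hα : Measurable α)
    (hmax : ∀ᵐ z ∂roundLaw I, IsArgmax (fun x => inner ℝ x v) (ctxOf z) (α (ctxOf z))) :
    ENNReal.ofReal (3 / 20)
      ≤ roundLaw I {z | divScale I ≤ |inner ℝ (vecOf z (α (ctxOf z))) w|} := by
  set s := divScale I with hs
  have hs0 : 0 < s := divScale_pos I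
  have hρ := I.rho_pos
  have hlog := log_100K_pos I
  have hsq : (0:ℝ) < Real.sqrt (8 * Real.log (100 * K)) := by positivity
  have hδ : 3 * s = I.rho / Real.sqrt (8 * Real.log (100 * K)) := by
    rw [hs, divScale]; field_simp
  have hδsq : (2 * (3 * s)) ^ 2 = I.rho ^ 2 / (2 * Real.log (100 * K)) := by
    rw [hδ, mul_pow, div_pow, Real.sq_sqrt (by positivity)]; field_simp; norm_num
  obtain ⟨g, hg1, hg2, hg3⟩ := exists_shift hv hw (δ := 3 * s) (by positivity)
  have hgsq : ‖g‖ ^ 2 ≤ I.rho ^ 2 / (2 * Real.log (100 * K)) := by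
    rw [← hδsq]; gcongr
  have hgρ : ‖g‖ ≤ I.rho := by
    refine abs_le_of_sq_le_sq' (hgsq.trans ?_) hρ.le |>.2
    refine div_le_self (by positivity) (by linarith)
  have hxm : Measurable fun z : RoundDraw d K => vecOf z (α (ctxOf z)) :=
    measurable_uncurry_ctxVec measurable_ctxOf (hα.comp measurable_ctxOf)
  have hαm : Measurable fun z : RoundDraw d K => α (ctxOf z) := hα.comp measurable_ctxOf
  -- `High b`: action `b` is chosen and has a large component along `w`; `Low b`: it is chosen and
  -- has a small one, while its perturbation is not extreme in the direction of the shift `g`;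
  -- `Tail b`: the perturbation is extreme
  set High : Fin K → Set (RoundDraw d K) := fun b =>
    {z | α (ctxOf z) = b ∧ s ≤ |inner ℝ (vecOf z b) w|} with hHigh
  set Low : Fin K → Set (RoundDraw d K) := fun b =>
    {z | α (ctxOf z) = b ∧ |inner ℝ (vecOf z b) w| < s ∧ inner ℝ g (z.2.1 b) ≤ I.rho ^ 2} with hLow
  set Tail : Fin K → Set (RoundDraw d K) := fun b => {z | I.rho ^ 2 ≤ inner ℝ g (z.2.1 b)} with hTail
  have hHm : ∀ b, MeasurableSet (High b) := fun b =>
    (hαm (measurableSet_singleton b)).inter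
      (measurableSet_le (g := fun z : RoundDraw d K => |(inner ℝ (vecOf z b) w : ℝ)|)
        measurable_const (by fun_prop))
  have hLm : ∀ b, MeasurableSet (Low b) := fun b =>
    (hαm (measurableSet_singleton b)).inter
      ((measurableSet_lt (f := fun z : RoundDraw d K => |(inner ℝ (vecOf z b) w : ℝ)|)
        (by fun_prop) measurable_const).inter
      (measurableSet_le (f := fun z : RoundDraw d K => (inner ℝ g (z.2.1 b) : ℝ))
        (by fun_prop) measurable_const))
  -- the length of the shift is chosen such that these events have total probability at most
  -- `1 / 100`
  have hTail_le : ∀ b, roundLaw I (Tail b) ≤ ENNReal.ofReal (1 / (100 * K)) := by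
    intro b
    have hm : MeasurableSet {e : Vec d | I.rho ^ 2 ≤ inner ℝ g e} :=
      measurableSet_le (by fun_prop) (by fun_prop)
    have h := perturbationLaw_tail (rho := I.rho) g (a := I.rho ^ 2)
      (s := I.rho ^ 2 * (I.rho ^ 2 / (2 * Real.log (100 * K)))) (by positivity) (by positivity)
      (by gcongr)
    rw [← (measurePreserving_eps I b).measure_preimage hm.nullMeasurableSet] at h
    refine h.trans (ENNReal.ofReal_le_ofReal (le_of_eq ?_))
    have h1 : (I.rho ^ 2) ^ 2 / (2 * (I.rho ^ 2 * (I.rho ^ 2 / (2 * Real.log (100 * K)))))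
        = Real.log (100 * K) := by field_simp
    have hK : (1:ℝ) ≤ K := by exact_mod_cast one_le_K I
    rw [h1, Real.exp_neg, Real.exp_log (by positivity), one_div]
  -- given the contexts of the other actions, the shift by `g` maps `Low b` into `High b`
  have hLow_le : ∀ b, roundLaw I (Low b) ≤ 5 * roundLaw I (High b) := by
    intro b
    have hMP := measurePreserving_setEps I b
    rw [← hMP.measure_preimage (hLm b).nullMeasurableSet,
      ← hMP.measure_preimage (hHm b).nullMeasurableSet,
      Measure.prod_apply (hMP.measurable (hLm b)), Measure.prod_apply (hMP.measurable (hHm b)),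
      ← lintegral_const_mul _ (measurable_measure_prodMk_left (hMP.measurable (hHm b)))]
    refine lintegral_mono_ae ?_
    filter_upwards [Measure.ae_ae_of_ae_prod (hMP.quasiMeasurePreserving.ae hmax)] with z hz
    by_cases hb : Avail (ctxOf z) b
    swap
    · have : Prod.mk z ⁻¹' (setEps b ⁻¹' Low b) ≤ᵐ[perturbationLaw d I.rho] (∅ : Set (Vec d)) := by
        filter_upwards [hz] with e he he2
        obtain ⟨h1, -⟩ : α (ctxOf (setEps b (z, e))) = b ∧ _ := he2
        rw [h1] at he
        exact absurd ((avail_setEps b b z e).1 he.avail) hb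
      exact (measure_mono_ae this).trans (by simp)
    -- the perturbations `e` of `b` that make it the best action and belong to `Low b`
    set A : Set (Vec d) := {e | (∀ c, c ≠ b → Avail (ctxOf z) c →
      inner ℝ (vecOf z c) v ≤ inner ℝ (meanVec z b + e) v) ∧ |inner ℝ (meanVec z b + e) w| < s
      ∧ inner ℝ g e ≤ I.rho ^ 2} with hA
    have hAm : MeasurableSet A := by
      refine MeasurableSet.inter ?_ ((measurableSet_lt
        (f := fun e : Vec d => |(inner ℝ (meanVec z b + e) w : ℝ)|) (by fun_prop)
        measurable_const).inter (measurableSet_le (f := fun e : Vec d => (inner ℝ g e : ℝ))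
        (by fun_prop) measurable_const))
      have : {e : Vec d | ∀ c, c ≠ b → Avail (ctxOf z) c →
          inner ℝ (vecOf z c) v ≤ inner ℝ (meanVec z b + e) v}
          = ⋂ c, ⋂ (_ : c ≠ b), ⋂ (_ : Avail (ctxOf z) c),
            {e : Vec d | (inner ℝ (vecOf z c) v : ℝ) ≤ inner ℝ (meanVec z b + e) v} := by
        ext e; simp
      refine MeasurableSet.congr ?_ this.symm
      exact MeasurableSet.iInter fun c => MeasurableSet.iInter fun _ => MeasurableSet.iInter fun _ =>
        measurableSet_le (by fun_prop) (by fun_prop)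
    calc perturbationLaw d I.rho (Prod.mk z ⁻¹' (setEps b ⁻¹' Low b))
        ≤ perturbationLaw d I.rho A := by
          refine measure_mono_ae ?_
          filter_upwards [hz] with e he he2
          obtain ⟨h1, h2, h3⟩ : α (ctxOf (setEps b (z, e))) = b ∧ _ ∧ _ := he2
          rw [h1] at he
          rw [vecOf_setEps_same hb] at h2
          refine ⟨fun c hc hav => ?_, h2, by simpa [setEps] using h3⟩
          have := he.le ((avail_setEps b c z e).2 hav)
          change inner ℝ (vecOf (setEps b (z, e)) c) v ≤ inner ℝ (vecOf (setEps b (z, e)) b) v at this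
          rwa [vecOf_setEps_same hb, vecOf_setEps_of_ne hc] at this
      _ ≤ 5 * perturbationLaw d I.rho {e | e - g ∈ A} :=
          perturbationLaw_le_shift hρ g hgρ hAm fun e he => he.2.2
      _ ≤ 5 * perturbationLaw d I.rho (Prod.mk z ⁻¹' (setEps b ⁻¹' High b)) := by
          gcongr 5 * ?_
          refine measure_mono_ae ?_
          filter_upwards [hz] with e he he2
          obtain ⟨h1, h2, -⟩ : (∀ c, c ≠ b → Avail (ctxOf z) c →
            inner ℝ (vecOf z c) v ≤ inner ℝ (meanVec z b + (e - g)) v)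
            ∧ |inner ℝ (meanVec z b + (e - g)) w| < s ∧ _ := he2
          -- the shift strictly increases the score of `b`, so that `b` is still chosen, now
          -- without ties
          have hch : α (ctxOf (setEps b (z, e))) = b := by
            by_contra hne
            have hav := he.avail
            have h3 := h1 _ hne ((avail_setEps b _ z e).1 hav)
            have h4 := he.le ((avail_setEps b b z e).2 hb)
            change inner ℝ (vecOf (setEps b (z, e)) b) v
              ≤ inner ℝ (vecOf (setEps b (z, e)) (α (ctxOf (setEps b (z, e))))) v at h4
            rw [vecOf_setEps_same hb, vecOf_setEps_of_ne hne] at h4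
            have h5 : inner ℝ (meanVec z b + e) v
                = inner ℝ (meanVec z b + (e - g)) v + inner ℝ g v := by
              rw [← inner_add_left]; congr 1; abel
            linarith
          refine ⟨hch, ?_⟩
          rw [vecOf_setEps_same hb]
          have h5 : inner ℝ (meanVec z b + e) w
              = inner ℝ (meanVec z b + (e - g)) w + inner ℝ g w := by
            rw [← inner_add_left]; congr 1; abel
          rw [h5]
          have h6 := abs_sub_abs_le_abs_sub (inner ℝ g w : ℝ) (-inner ℝ (meanVec z b + (e - g)) w)
          rw [abs_neg, sub_neg_eq_add, add_comm (inner ℝ g w : ℝ)] at h6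
          linarith
  set H := {z : RoundDraw d K | s ≤ |inner ℝ (vecOf z (α (ctxOf z))) w|} with hH
  have hHH : ∑ b, roundLaw I (High b) ≤ roundLaw I H := by
    rw [← measure_biUnion_finset₀]
    · refine measure_mono ?_
      intro z hz
      obtain ⟨b, hb⟩ := Set.mem_iUnion.1 hz
      obtain ⟨-, h1, h2⟩ := Set.mem_iUnion.1 hb
      show s ≤ _
      rwa [h1]
    · intro b _ c _ hbc
      refine Disjoint.aedisjoint (Set.disjoint_left.2 ?_)
      rintro z ⟨h1, -⟩ ⟨h2, -⟩
      exact hbc (h1.symm.trans h2)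
    · exact fun b _ => (hHm b).nullMeasurableSet
  have hcover : Hᶜ ⊆ ⋃ b, (Low b ∪ Tail b) := by
    intro z hz
    have hz' : |inner ℝ (vecOf z (α (ctxOf z))) w| < s := not_le.1 hz
    refine Set.mem_iUnion.2 ⟨α (ctxOf z), ?_⟩
    rcases le_total (inner ℝ g (z.2.1 (α (ctxOf z)))) (I.rho ^ 2) with h | h
    · exact Or.inl ⟨rfl, hz', h⟩
    · exact Or.inr h
  have hc : roundLaw I Hᶜ ≤ 5 * roundLaw I H + ENNReal.ofReal (1 / 100) := by
    calc roundLaw I Hᶜ ≤ ∑ b, (roundLaw I (Low b) + roundLaw I (Tail b)) := by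
          refine (measure_mono hcover).trans ((measure_iUnion_fintype_le _ _).trans ?_)
          exact Finset.sum_le_sum fun b _ => measure_union_le _ _
      _ ≤ ∑ b, (5 * roundLaw I (High b) + ENNReal.ofReal (1 / (100 * K))) := by
          gcongr with b
          · exact hLow_le b
          · exact hTail_le b
      _ ≤ _ := by
          rw [Finset.sum_add_distrib, ← Finset.mul_sum]
          gcongr
          have hK : (1:ℝ) ≤ K := by exact_mod_cast one_le_K I
          simp only [Finset.sum_const, Finset.card_univ, Fintype.card_fin, nsmul_eq_mul]
          rw [← ENNReal.ofReal_natCast, ← ENNReal.ofReal_mul (by positivity)]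
          refine ENNReal.ofReal_le_ofReal (le_of_eq (by field_simp))
  have hHmeas : MeasurableSet H := measurableSet_le measurable_const (by fun_prop)
  have h1 : roundLaw I H + roundLaw I Hᶜ = 1 := by
    rw [measure_add_measure_compl hHmeas, measure_univ]
  have hfin : roundLaw I H ≠ ∞ := measure_ne_top _ _
  have h2 : (1 : ℝ≥0∞) ≤ 6 * roundLaw I H + ENNReal.ofReal (1 / 100) := by
    calc (1 : ℝ≥0∞) = roundLaw I H + roundLaw I Hᶜ := h1.symm
      _ ≤ roundLaw I H + (5 * roundLaw I H + ENNReal.ofReal (1 / 100)) := by gcongr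
      _ = _ := by ring
  rw [← ENNReal.ofReal_toReal hfin] at h2 ⊢
  set r := (roundLaw I H).toReal
  have hr : 0 ≤ r := ENNReal.toReal_nonneg
  have h3 : ENNReal.ofReal 1 ≤ ENNReal.ofReal (6 * r + 1 / 100) := by
    rw [ENNReal.ofReal_add (by positivity) (by norm_num), ENNReal.ofReal_mul (by norm_num)]
    simpa using h2
  rw [ENNReal.ofReal_le_ofReal_iff (by positivity)] at h3
  exact ENNReal.ofReal_le_ofReal (by linarith)

/-- The rate, per round and dimension, at which greedy play accumulates information; see
`lintegral_spread_snoc_le`. The constant is not optimized. -/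
noncomputable def rate (I : ProblemInstance d K) : ℝ :=
  I.rho ^ 2 / (3000000 * (1 + Real.log (K * d)) ^ 3)

theorem one_le_lkd (I : ProblemInstance d K) : 1 ≤ 1 + Real.log (K * d) := by
  linarith [Real.log_nonneg (one_le_KD I)]

theorem rate_pos (I : ProblemInstance d K) : 0 < rate I := by
  have := I.rho_pos
  have := one_le_lkd I
  unfold rate; positivity

theorem rate_le (I : ProblemInstance d K) : rate I ≤ 1 / 4 := by
  have := I.rho_pos
  have h1 := rho_le_one I
  have := one_le_lkd I
  have h2 : 1 ≤ (1 + Real.log (K * d)) ^ 3 := one_le_pow₀ this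
  unfold rate
  rw [div_le_div_iff₀ (by positivity) (by norm_num)]
  nlinarith

/-- The rate is small enough for the bound in `lintegral_spread_snoc_le`, where `680 * (1 + log (K
* d)) ^ 2` is twenty times the bound for the second moment of the context lengths. -/
theorem rate_le_divScale_sq (I : ProblemInstance d K) :
    rate I ≤ divScale I ^ 2 / (10 * (1 + 680 * (1 + Real.log (K * d)) ^ 2)) := by
  have hρ := I.rho_pos
  have hl := one_le_lkd I
  have hK : (1:ℝ) ≤ K := by exact_mod_cast one_le_K I
  have hd : (1:ℝ) ≤ d := by exact_mod_cast one_le_d I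
  set l := 1 + Real.log (K * d) with hldef
  have hlog : Real.log (100 * K) ≤ 5 * l := by
    rw [Real.log_mul (by norm_num) (by linarith)]
    have h1 : Real.log 100 ≤ 5 := by
      rw [Real.log_le_iff_le_exp (by norm_num)]
      have h3 : Real.exp 5 = Real.exp 1 ^ 5 := by rw [← Real.exp_nat_mul]; norm_num
      rw [h3]
      have := Real.exp_one_gt_d9
      calc (100:ℝ) ≤ 2.7182818283 ^ 5 := by norm_num
        _ ≤ Real.exp 1 ^ 5 := by gcongr
    have h2 : Real.log K ≤ Real.log (K * d) := Real.log_le_log (by linarith) (by nlinarith)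
    have h3 := Real.log_nonneg (one_le_KD I)
    linarith
  have hlog1 := log_100K_pos I
  have h2 : divScale I ^ 2 = I.rho ^ 2 / (72 * Real.log (100 * K)) := by
    rw [divScale, div_pow, mul_pow, Real.sq_sqrt (by positivity)]; ring
  rw [h2, rate, div_div]
  refine div_le_div_of_nonneg_left (by positivity) (by positivity) ?_
  calc 72 * Real.log (100 * K) * (10 * (1 + 680 * l ^ 2))
      ≤ 72 * (5 * l) * (10 * (1 * l ^ 2 + 680 * l ^ 2)) := by
        gcongr
        rw [one_mul]
        exact one_le_pow₀ hl
    _ ≤ 3000000 * l ^ 3 := by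
        have : 0 ≤ l ^ 3 := by positivity
        nlinarith

theorem spread_snoc {t : ℕ} (h : History d t) (p : Vec d × ℝ) :
    spread (Fin.snoc (α := fun _ => Vec d × ℝ) h p : History d (t + 1))
      = spread h - (((design h)⁻¹ *ᵥ p.1.ofLp) ⬝ᵥ ((design h)⁻¹ *ᵥ p.1.ofLp))
        / (1 + p.1.ofLp ⬝ᵥ (design h)⁻¹ *ᵥ p.1.ofLp) := by
  unfold spread
  rw [design_snoc, trace_inv_add_vecMulVec (design_posDef h)]

/-- The expected decrease of `spread` in a greedy round: the chosen context has a component of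
size about `divScale I` along each column of the inverse design matrix. -/
theorem lintegral_spread_snoc_le (I : ProblemInstance d K) {v : Vec d} (hv : v ≠ 0)
    {α : Contexts d K → Fin K} (hα : Measurable α)
    (hmax : ∀ᵐ z ∂roundLaw I, IsArgmax (fun x => inner ℝ x v) (ctxOf z) (α (ctxOf z)))
    {t : ℕ} (h : History d t) (r : RoundDraw d K → ℝ) :
    ∫⁻ z, ENNReal.ofReal (spread (Fin.snoc (α := fun _ => Vec d × ℝ) h
        (vecOf z (α (ctxOf z)), r z) : History d (t + 1))) ∂roundLaw I
      ≤ ENNReal.ofReal (spread h - rate I / d * spread h ^ 2) := by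
  have hd : (1:ℝ) ≤ d := by exact_mod_cast one_le_d I
  have hV := design_posDef h
  set X : RoundDraw d K → Vec d := fun z => vecOf z (α (ctxOf z)) with hX
  have hXm : Measurable X := measurable_uncurry_ctxVec measurable_ctxOf (hα.comp measurable_ctxOf)
  set D : Vec d → ℝ := fun x => (((design h)⁻¹ *ᵥ x.ofLp) ⬝ᵥ ((design h)⁻¹ *ᵥ x.ofLp))
        / (1 + x.ofLp ⬝ᵥ (design h)⁻¹ *ᵥ x.ofLp) with hD
  have hDm : Measurable D := by
    have h1 : Continuous fun x : Vec d => (design h)⁻¹ *ᵥ x.ofLp := by fun_prop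
    refine (h1.dotProduct h1).measurable.div (measurable_const.add ?_)
    exact (Continuous.dotProduct (by fun_prop) h1).measurable
  have hD0 : ∀ x, 0 ≤ D x := fun x => div_nonneg (dotProduct_self_nonneg' _)
    (by linarith [inv_quad_nonneg hV x.ofLp])
  -- the columns of the inverse design matrix
  set u : Fin d → Vec d := fun i => WithLp.toLp 2 ((design h)⁻¹ *ᵥ Pi.single i 1) with hu
  set R2 : ℝ := 680 * (1 + Real.log (K * d)) ^ 2 with hR2
  have hl := one_le_lkd I
  have hs := divScale_pos I
  have hDlow : ∀ x : Vec d, D x = (∑ i, (inner ℝ x (u i)) ^ 2)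
      / (1 + x.ofLp ⬝ᵥ (design h)⁻¹ *ᵥ x.ofLp) := by
    intro x
    simp only [hD]
    congr 1
    simp only [dotProduct, ← pow_two]
    refine Finset.sum_congr rfl fun i _ => ?_
    congr 1
    have h1 := PosSemidef.dotProduct_mulVec_comm hV.inv.posSemidef (Pi.single i 1) x.ofLp
    rw [← dotProduct_eq_inner]
    simp only [hu]
    rw [← h1, single_one_dotProduct]
  -- on `G i`, which has probability at least `1 / 10`, the column `u i` contributes at least its
  -- squared length times `10 * rate I` to the decrease
  set G : Fin d → Set (RoundDraw d K) := fun i =>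
    {z | divScale I * ‖u i‖ ≤ |inner ℝ (X z) (u i)|} ∩ {z | radius I z ^ 2 ≤ R2} with hG
  have hGm : ∀ i, MeasurableSet (G i) := fun i =>
    (measurableSet_le (by fun_prop) (by fun_prop)).inter (measurableSet_le (by fun_prop) (by fun_prop))
  have hGlow : ∀ i, ENNReal.ofReal (1 / 10) ≤ roundLaw I (G i) := by
    intro i
    have h1 : ENNReal.ofReal (3 / 20)
        ≤ roundLaw I {z | divScale I * ‖u i‖ ≤ |inner ℝ (X z) (u i)|} := by
      rcases eq_or_ne (u i) 0 with h0 | h0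
      · have h5 : {z : RoundDraw d K | divScale I * ‖u i‖ ≤ |inner ℝ (X z) (u i)|} = Set.univ := by
          ext z; simp [h0]
        rw [h5, measure_univ, ← ENNReal.ofReal_one]
        exact ENNReal.ofReal_le_ofReal (by norm_num)
      · have hn : 0 < ‖u i‖ := norm_pos_iff.2 h0
        have h2 := roundLaw_diverse I hv (w := ‖u i‖⁻¹ • u i)
          (by rw [norm_smul, norm_inv, norm_norm, inv_mul_cancel₀ hn.ne']) hα hmax
        refine h2.trans (measure_mono fun z hz => ?_)
        have h3 : divScale I ≤ |inner ℝ (X z) (‖u i‖⁻¹ • u i)| := hz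
        rw [real_inner_smul_right, abs_mul, abs_of_pos (inv_pos.2 hn), inv_mul_eq_div,
          le_div_iff₀ hn] at h3
        exact h3
    have h2 : roundLaw I {z | R2 ≤ radius I z ^ 2} ≤ ENNReal.ofReal (1 / 20) := by
      have h3 := mul_meas_ge_le_lintegral₀ (μ := roundLaw I)
        (f := fun z => ENNReal.ofReal (radius I z ^ 2)) (by fun_prop) (ENNReal.ofReal R2)
      have h4 := h3.trans (lintegral_radius_sq_le I)
      have h5 : {z | R2 ≤ radius I z ^ 2} ⊆ {z | ENNReal.ofReal R2 ≤ ENNReal.ofReal (radius I z ^ 2)} :=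
        fun z hz => ENNReal.ofReal_le_ofReal hz
      have hR2pos : 0 < R2 := by positivity
      have h6 := (mul_le_mul_right (measure_mono (μ := roundLaw I) h5) (ENNReal.ofReal R2)).trans h4
      rw [mul_comm, ← ENNReal.le_div_iff_mul_le (by simp [hR2pos]) (by simp),
        ← ENNReal.ofReal_div_of_pos hR2pos] at h6
      refine h6.trans (ENNReal.ofReal_le_ofReal (le_of_eq ?_))
      rw [hR2]; field_simp; norm_num
    have h3 : {z | divScale I * ‖u i‖ ≤ |inner ℝ (X z) (u i)|} ⊆ G i ∪ {z | R2 ≤ radius I z ^ 2} := by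
      intro z hz
      rcases le_total (radius I z ^ 2) R2 with h4 | h4
      · exact Or.inl ⟨hz, h4⟩
      · exact Or.inr h4
    have h4 : ENNReal.ofReal (3 / 20) ≤ roundLaw I (G i) + ENNReal.ofReal (1 / 20) :=
      h1.trans ((measure_mono h3).trans ((measure_union_le _ _).trans (by gcongr)))
    rw [← tsub_le_iff_right, ← ENNReal.ofReal_sub _ (by norm_num)] at h4
    convert h4 using 2; norm_num
  have hpt : ∀ᵐ z ∂roundLaw I, ∑ i, (G i).indicator
      (fun _ => ENNReal.ofReal (10 * rate I * ‖u i‖ ^ 2)) z ≤ ENNReal.ofReal (D (X z)) := by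
    filter_upwards [ae_norm_vecOf_le I] with z hz
    have h1 : ∀ i, (G i).indicator (fun _ => ENNReal.ofReal (10 * rate I * ‖u i‖ ^ 2)) z
        ≤ ENNReal.ofReal ((inner ℝ (X z) (u i)) ^ 2
          / (1 + (X z).ofLp ⬝ᵥ (design h)⁻¹ *ᵥ (X z).ofLp)) := by
      intro i
      by_cases hzi : z ∈ G i
      · rw [Set.indicator_of_mem hzi]
        refine ENNReal.ofReal_le_ofReal ?_
        obtain ⟨h2, h3⟩ := hzi
        have h2' : divScale I * ‖u i‖ ≤ |inner ℝ (X z) (u i)| := h2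
        have h3' : radius I z ^ 2 ≤ R2 := h3
        have h4 : (X z).ofLp ⬝ᵥ (design h)⁻¹ *ᵥ (X z).ofLp ≤ R2 := by
          refine (inv_design_contract h _).trans ?_
          rw [dotProduct_self_eq_norm_sq]
          refine le_trans ?_ h3'
          gcongr
          exact hz _
        have h5 := inv_quad_nonneg hV (X z).ofLp
        have h6 := rate_le_divScale_sq I
        rw [← hR2] at h6
        calc 10 * rate I * ‖u i‖ ^ 2 ≤ 10 * (divScale I ^ 2 / (10 * (1 + R2))) * ‖u i‖ ^ 2 := by gcongr
          _ = (divScale I * ‖u i‖) ^ 2 / (1 + R2) := by field_simp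
          _ ≤ |inner ℝ (X z) (u i)| ^ 2 / (1 + R2) := by gcongr
          _ = (inner ℝ (X z) (u i)) ^ 2 / (1 + R2) := by rw [sq_abs]
          _ ≤ _ := by gcongr
      · rw [Set.indicator_of_notMem hzi]; exact zero_le
    refine (Finset.sum_le_sum fun i _ => h1 i).trans ?_
    rw [← ENNReal.ofReal_sum_of_nonneg fun i _ => div_nonneg (sq_nonneg _)
      (by linarith [inv_quad_nonneg hV (X z).ofLp]), ← Finset.sum_div, ← hDlow]
  have hint : ENNReal.ofReal (rate I / d * spread h ^ 2) ≤ ∫⁻ z, ENNReal.ofReal (D (X z)) ∂roundLaw I := by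
    calc ENNReal.ofReal (rate I / d * spread h ^ 2)
        ≤ ∑ i, ENNReal.ofReal (10 * rate I * ‖u i‖ ^ 2) * ENNReal.ofReal (1 / 10) := by
          have hr := rate_pos I
          simp_rw [← ENNReal.ofReal_mul (show 0 ≤ 10 * rate I * ‖u _‖ ^ 2 by positivity)]
          rw [← ENNReal.ofReal_sum_of_nonneg fun i _ => by positivity]
          refine ENNReal.ofReal_le_ofReal ?_
          have h1 := sq_trace_inv_le (A := design h)
          rw [Fintype.card_fin] at h1
          have h2 : ∀ i, ‖u i‖ ^ 2
              = ((design h)⁻¹ *ᵥ Pi.single i 1) ⬝ᵥ ((design h)⁻¹ *ᵥ Pi.single i 1) := fun i => by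
            rw [← dotProduct_self_eq_norm_sq]
          have h3 : ∑ i, 10 * rate I * ‖u i‖ ^ 2 * (1 / 10) = rate I * ∑ i, ‖u i‖ ^ 2 := by
            rw [Finset.mul_sum]; exact Finset.sum_congr rfl fun i _ => by ring
          rw [h3]
          simp_rw [h2]
          unfold spread
          rw [div_mul_eq_mul_div, mul_div_assoc]
          gcongr
          rw [div_le_iff₀ (by linarith), mul_comm]
          exact h1
      _ ≤ ∑ i, ∫⁻ z, (G i).indicator (fun _ => ENNReal.ofReal (10 * rate I * ‖u i‖ ^ 2)) z ∂roundLaw I := by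
          gcongr with i
          rw [lintegral_indicator_const (hGm i)]
          gcongr
          exact hGlow i
      _ = ∫⁻ z, ∑ i, (G i).indicator (fun _ => ENNReal.ofReal (10 * rate I * ‖u i‖ ^ 2)) z ∂roundLaw I :=
          (lintegral_finsetSum _ fun i _ => measurable_const.indicator (hGm i)).symm
      _ ≤ _ := lintegral_mono_ae hpt
  have hle : ∀ z, spread (Fin.snoc (α := fun _ => Vec d × ℝ) h (X z, r z) : History d (t + 1))
      = spread h - D (X z) := fun z => spread_snoc h _
  have hDle : ∀ z, D (X z) ≤ spread h := fun z => by
    have := spread_nonneg (Fin.snoc (α := fun _ => Vec d × ℝ) h (X z, r z) : History d (t + 1))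
    rw [hle] at this; linarith
  calc _ = ∫⁻ z, (ENNReal.ofReal (spread h) - ENNReal.ofReal (D (X z))) ∂roundLaw I := by
        refine lintegral_congr fun z => ?_
        rw [hle, ENNReal.ofReal_sub _ (hD0 _)]
    _ = ∫⁻ _z, ENNReal.ofReal (spread h) ∂roundLaw I - ∫⁻ z, ENNReal.ofReal (D (X z)) ∂roundLaw I := by
        rw [lintegral_sub (by fun_prop)]
        · refine ne_top_of_le_ne_top ?_ (lintegral_mono fun z => ENNReal.ofReal_le_ofReal (hDle z))
          simp
        · exact Filter.Eventually.of_forall fun z => ENNReal.ofReal_le_ofReal (hDle z)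
    _ ≤ ENNReal.ofReal (spread h) - ENNReal.ofReal (rate I / d * spread h ^ 2) := by
        rw [lintegral_const, measure_univ, mul_one]
        gcongr
    _ = _ := by
        rw [ENNReal.ofReal_sub]
        have := rate_pos I
        positivity

end LinBandit
end

section
namespace LinBandit
open scoped ENNReal NNReal

variable {d K T : ℕ}

/-! ### Tools for bounding the regret of a round -/

/-- The logarithmic factor of the regret bounds, as it appears in the theorem. -/
noncomputable def logFactor (d K T : ℕ) : ℝ := 1 + Real.log (T * K * d)

theorem logFactor_eq (I : ProblemInstance d K) (hT : 1 ≤ T) :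
    logFactor d K T = 1 + (Real.log T + (Real.log K + Real.log d)) := by
  have h1 : (0:ℝ) < K := by exact_mod_cast one_le_K I
  have h2 : (0:ℝ) < d := by exact_mod_cast one_le_d I
  have h3 : (0:ℝ) < T := by exact_mod_cast hT
  rw [logFactor, Real.log_mul (by positivity) h2.ne', Real.log_mul h3.ne' h1.ne', add_assoc]

theorem log_le_logFactor (I : ProblemInstance d K) (hT : 1 ≤ T) :
    0 ≤ Real.log T ∧ 0 ≤ Real.log K ∧ 0 ≤ Real.log d ∧
      Real.log T + Real.log K + Real.log d + 1 = logFactor d K T :=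
  ⟨Real.log_natCast_nonneg _, Real.log_natCast_nonneg _, Real.log_natCast_nonneg _, by
    rw [logFactor_eq I hT]; ring⟩

theorem one_le_logFactor (I : ProblemInstance d K) (hT : 1 ≤ T) : 1 ≤ logFactor d K T := by
  obtain ⟨h1, h2, h3, h4⟩ := log_le_logFactor I hT
  linarith

theorem log_KD_le_logFactor (I : ProblemInstance d K) (hT : 1 ≤ T) :
    1 + Real.log (K * d) ≤ logFactor d K T := by
  obtain ⟨h1, h2, h3, h4⟩ := log_le_logFactor I hT
  have h5 : (0:ℝ) < K := by exact_mod_cast one_le_K I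
  have h6 : (0:ℝ) < d := by exact_mod_cast one_le_d I
  rw [Real.log_mul h5.ne' h6.ne']
  linarith

/-- The regret incurred in round `t`. -/
noncomputable def roundRegret (π : Policy d K) (t : ℕ) (ω : Sample d K) : ℝ :=
  bestReward ω.1 (ctxOf (ω.2 t)) - inner ℝ ω.1 (vecOf (ω.2 t) (action π ω t))

theorem regret_eq_sum (π : Policy d K) (T : ℕ) (ω : Sample d K) :
    regret π T ω = ∑ t ∈ Finset.range T, roundRegret π t ω := rfl

@[fun_prop]
theorem measurable_roundRegret (π : Policy d K) (t : ℕ) : Measurable (roundRegret π t) := by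
  have h1 : Measurable fun ω : Sample d K => bestReward ω.1 (ctxOf (ω.2 t)) :=
    measurable_bestReward measurable_fst
      (measurable_ctxOf.comp ((measurable_pi_apply t).comp measurable_snd))
  have h2 : Measurable fun ω : Sample d K => (inner ℝ ω.1 (vecOf (ω.2 t) (action π ω t)) : ℝ) := by
    fun_prop
  exact h1.sub h2

/-- Every action of `π` in the first `T` rounds is available. -/
def ChoosesAvailable (I : ProblemInstance d K) (T : ℕ) (π : Policy d K) : Prop :=
  ∀ t < T, ∀ᵐ ω ∂law I, Avail (ctxOf (ω.2 t)) (action π ω t)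

theorem roundRegret_nonneg {π : Policy d K} {t : ℕ} {ω : Sample d K}
    (h : Avail (ctxOf (ω.2 t)) (action π ω t)) : 0 ≤ roundRegret π t ω :=
  sub_nonneg.2 (le_bestReward h)

theorem roundRegret_le {π : Policy d K} {t : ℕ} {ω : Sample d K} {M : ℝ}
    (h : Avail (ctxOf (ω.2 t)) (action π ω t))
    (hM : ∀ a, |(inner ℝ ω.1 (vecOf (ω.2 t) a) : ℝ)| ≤ M) : roundRegret π t ω ≤ 2 * M := by
  have h1 : bestReward ω.1 (ctxOf (ω.2 t)) ≤ M :=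
    bestReward_le h fun b _ => (le_abs_self _).trans (hM b)
  have h2 := (abs_le.1 (hM (action π ω t))).1
  unfold roundRegret
  linarith

variable {I : ProblemInstance d K}

theorem lintegral_radius_le (hT : 1 ≤ T) :
    ∫⁻ z, ENNReal.ofReal (radius I z) ∂roundLaw I
      ≤ ENNReal.ofReal (34 * logFactor d K T ^ 2) := by
  calc _ ≤ ∫⁻ z, ENNReal.ofReal (radius I z ^ 2) ∂roundLaw I := by
        refine lintegral_mono fun z => ENNReal.ofReal_le_ofReal ?_
        have := one_le_radius I z
        nlinarith
    _ ≤ _ := lintegral_radius_sq_le I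
    _ ≤ _ := by
        have := one_le_lkd I
        have := log_KD_le_logFactor I hT
        gcongr

theorem measurePreserving_latent_draw (I : ProblemInstance d K) (t : ℕ) :
    MeasurePreserving (fun ω : Sample d K => (ω.1, ω.2 t)) (law I) ((prior I).prod (roundLaw I)) :=
  (MeasurePreserving.id _).prod (measurePreserving_eval_infinitePi (fun _ : ℕ => roundLaw I) t)

theorem lintegral_latent_draw (I : ProblemInstance d K) (t : ℕ)
    {F : Vec d × RoundDraw d K → ℝ≥0∞} (hF : Measurable F) :
    ∫⁻ ω, F (ω.1, ω.2 t) ∂law I = ∫⁻ θ, ∫⁻ z, F (θ, z) ∂roundLaw I ∂prior I := by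
  rw [(measurePreserving_latent_draw I t).lintegral_comp hF, lintegral_prod _ hF.aemeasurable]

theorem lintegral_latent_draw' (I : ProblemInstance d K) (t : ℕ)
    {F : Vec d × RoundDraw d K → ℝ≥0∞} (hF : Measurable F) :
    ∫⁻ ω, F (ω.1, ω.2 t) ∂law I = ∫⁻ z, ∫⁻ θ, F (θ, z) ∂prior I ∂roundLaw I := by
  rw [(measurePreserving_latent_draw I t).lintegral_comp hF, lintegral_prod_symm _ hF.aemeasurable]

/-- A bound on the expected regret of a single round that holds for every policy. The rewards of
the `K` actions are jointly sub-Gaussian given the contexts, so their maximum costs `log K` only,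
and no factor `d`. -/
theorem lintegral_roundRegret_le (hI : EigLeOne I) (hm : 1 ≤ ‖I.mean‖) (hT : 1 ≤ T)
    {π : Policy d K} (hav : ChoosesAvailable I T π) {t : ℕ} (ht : t < T) :
    ∫⁻ ω, ENNReal.ofReal (roundRegret π t ω) ∂law I
      ≤ ENNReal.ofReal (408 * logFactor d K T ^ 3 * ‖I.mean‖) := by
  have hK : (1:ℝ) ≤ K := by exact_mod_cast one_le_K I
  have hl := one_le_logFactor I hT
  obtain ⟨hl1, hl2, hl3, hl4⟩ := log_le_logFactor I hT
  -- normalized context vectors: `‖w z a‖ ≤ 1` almost surely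
  set w : RoundDraw d K → Fin K → Vec d := fun z a => (radius I z)⁻¹ • vecOf z a with hw
  have hwm : ∀ a, Measurable fun z => w z a := fun a => by simp only [hw]; fun_prop
  set E : Vec d × RoundDraw d K → ℝ := fun p => ∑ a, (Real.exp (inner ℝ (w p.2 a) (p.1 - I.mean))
    + Real.exp (inner ℝ (-w p.2 a) (p.1 - I.mean))) with hE
  have hE0 : ∀ p, 0 ≤ E p := fun p => Finset.sum_nonneg fun a _ => by positivity
  have hEm : Measurable E := by
    refine Finset.measurable_fun_sum _ fun a _ => ?_
    have := hwm a
    fun_prop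
  set F : Vec d × RoundDraw d K → ℝ≥0∞ := fun p => ENNReal.ofReal (2 * radius I p.2)
    * (ENNReal.ofReal (‖I.mean‖ + Real.log K) + ENNReal.ofReal (K:ℝ)⁻¹ * ENNReal.ofReal (E p)) with hF
  have hFm : Measurable F := by fun_prop
  have hpt : ∀ᵐ ω ∂law I, ENNReal.ofReal (roundRegret π t ω) ≤ F (ω.1, ω.2 t) := by
    filter_upwards [hav t ht, ae_draw I t (ae_norm_vecOf_le I)] with ω hω hr
    set z := ω.2 t
    have hr1 := one_le_radius I z
    have hr0 : 0 < radius I z := by linarith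
    simp only [hF]
    rw [← ENNReal.ofReal_mul (by positivity), ← ENNReal.ofReal_add (by positivity)
      (mul_nonneg (by positivity) (hE0 _)), ← ENNReal.ofReal_mul (by positivity)]
    refine ENNReal.ofReal_le_ofReal ?_
    rw [mul_assoc]
    refine roundRegret_le hω fun a => ?_
    have h1 : (inner ℝ ω.1 (vecOf z a) : ℝ)
        = radius I z * (inner ℝ (w z a) I.mean + inner ℝ (w z a) (ω.1 - I.mean)) := by
      rw [← inner_add_right, add_sub_cancel, hw]
      simp only
      rw [real_inner_smul_left, real_inner_comm]
      field_simp
    have hw1 : ‖w z a‖ ≤ 1 := by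
      simp only [hw]
      rw [norm_smul, norm_inv, Real.norm_of_nonneg hr0.le, inv_mul_le_iff₀ hr0, mul_one]
      exact hr a
    rw [h1, abs_mul, abs_of_pos hr0]
    refine mul_le_mul_of_nonneg_left ?_ hr0.le
    have h2 : |(inner ℝ (w z a) I.mean : ℝ)| ≤ ‖I.mean‖ :=
      (abs_real_inner_le_norm _ _).trans (mul_le_of_le_one_left (norm_nonneg _) hw1)
    have h3 : |(inner ℝ (w z a) (ω.1 - I.mean) : ℝ)|
        ≤ Real.log K + (K:ℝ)⁻¹ * E (ω.1, z) := by
      -- with `p = 1 / K`, the sum over the `K` actions costs `log K`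
      have h4 := le_log_inv_add_mul_exp (p := (K:ℝ)⁻¹) (by positivity)
        |(inner ℝ (w z a) (ω.1 - I.mean) : ℝ)|
      rw [inv_inv] at h4
      refine h4.trans ?_
      gcongr
      refine le_trans ?_ (Finset.single_le_sum (f := fun a =>
        (Real.exp (inner ℝ (w z a) (ω.1 - I.mean)) + Real.exp (inner ℝ (-w z a) (ω.1 - I.mean))))
        (fun a _ => by positivity) (Finset.mem_univ a))
      simp only [inner_neg_left]
      have := Real.exp_pos (inner ℝ (w z a) (ω.1 - I.mean))
      have := Real.exp_pos (-inner ℝ (w z a) (ω.1 - I.mean))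
      rcases abs_cases (inner ℝ (w z a) (ω.1 - I.mean) : ℝ) with ⟨h, _⟩ | ⟨h, _⟩ <;>
        rw [h] <;> linarith
    calc _ ≤ |(inner ℝ (w z a) I.mean : ℝ)| + |(inner ℝ (w z a) (ω.1 - I.mean) : ℝ)| :=
          abs_add_le _ _
      _ ≤ _ := by linarith
  have hexp : ∀ᵐ z ∂roundLaw I, ∫⁻ θ, ENNReal.ofReal (E (θ, z)) ∂prior I
      ≤ ENNReal.ofReal (4 * K) := by
    filter_upwards [ae_norm_vecOf_le I] with z hr
    have hr1 := one_le_radius I z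
    have hr0 : 0 < radius I z := by linarith
    have hbd : ∀ v : Vec d, ‖v‖ ≤ 1 → ∫⁻ θ, ENNReal.ofReal (Real.exp (inner ℝ v (θ - I.mean))) ∂prior I
        ≤ ENNReal.ofReal 2 := by
      intro v hv
      refine (lintegral_exp_inner_prior_le hI v).trans (ENNReal.ofReal_le_ofReal ?_)
      have h1 : ‖v‖ ^ 2 / 2 ≤ 1 / 2 := by nlinarith [norm_nonneg v]
      calc Real.exp (‖v‖ ^ 2 / 2) ≤ Real.exp (1 / 2) := Real.exp_le_exp.2 h1
        _ ≤ Real.sqrt 4 := by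
            refine Real.le_sqrt_of_sq_le ?_
            rw [← Real.exp_nat_mul]
            norm_num
            linarith [Real.exp_one_lt_d9]
        _ = 2 := by rw [show (4:ℝ) = 2 ^ 2 by norm_num, Real.sqrt_sq (by norm_num)]
    have hw1 : ∀ a, ‖w z a‖ ≤ 1 := fun a => by
      simp only [hw]
      rw [norm_smul, norm_inv, Real.norm_of_nonneg hr0.le, inv_mul_le_iff₀ hr0, mul_one]
      exact hr a
    have h1 : ∀ θ, ENNReal.ofReal (E (θ, z))
        = ∑ a, (ENNReal.ofReal (Real.exp (inner ℝ (w z a) (θ - I.mean)))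
          + ENNReal.ofReal (Real.exp (inner ℝ (-w z a) (θ - I.mean)))) := fun θ => by
      simp only [hE]
      rw [ENNReal.ofReal_sum_of_nonneg fun a _ => by positivity]
      exact Finset.sum_congr rfl fun a _ => ENNReal.ofReal_add (by positivity) (by positivity)
    simp_rw [h1]
    rw [lintegral_finsetSum _ fun a _ => by fun_prop]
    calc _ ≤ ∑ a : Fin K, (ENNReal.ofReal 2 + ENNReal.ofReal 2) := by
          refine Finset.sum_le_sum fun a _ => ?_
          rw [lintegral_add_left (by fun_prop)]
          exact add_le_add (hbd _ (hw1 a)) (hbd _ (by rw [norm_neg]; exact hw1 a))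
      _ = _ := by
          rw [Finset.sum_const, Finset.card_univ, Fintype.card_fin, ← ENNReal.ofReal_add (by norm_num)
            (by norm_num), nsmul_eq_mul, ← ENNReal.ofReal_natCast, ← ENNReal.ofReal_mul (by positivity)]
          congr 1; ring
  calc _ ≤ ∫⁻ ω, F (ω.1, ω.2 t) ∂law I := lintegral_mono_ae hpt
    _ = ∫⁻ z, ∫⁻ θ, F (θ, z) ∂prior I ∂roundLaw I := lintegral_latent_draw' I t hFm
    _ ≤ ∫⁻ z, ENNReal.ofReal (radius I z) * ENNReal.ofReal (2 * (‖I.mean‖ + Real.log K + 4)) ∂roundLaw I := by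
        refine lintegral_mono_ae ?_
        filter_upwards [hexp] with z hz
        have hr1 := one_le_radius I z
        simp only [hF]
        rw [lintegral_const_mul _ (by fun_prop), lintegral_add_left (by fun_prop),
          lintegral_const_mul _ (by fun_prop), lintegral_const, measure_univ, mul_one]
        calc _ ≤ ENNReal.ofReal (2 * radius I z) * (ENNReal.ofReal (‖I.mean‖ + Real.log K)
              + ENNReal.ofReal (K:ℝ)⁻¹ * ENNReal.ofReal (4 * K)) := by gcongr
          _ = _ := by
              rw [← ENNReal.ofReal_mul (by positivity), ← ENNReal.ofReal_add (by positivity)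
                (by positivity), ← ENNReal.ofReal_mul (by positivity),
                ← ENNReal.ofReal_mul (by positivity)]
              congr 1
              field_simp
    _ ≤ ENNReal.ofReal (34 * logFactor d K T ^ 2)
          * ENNReal.ofReal (2 * (‖I.mean‖ + Real.log K + 4)) := by
        rw [lintegral_mul_const _ (by fun_prop)]
        gcongr
        exact lintegral_radius_le hT
    _ ≤ _ := by
        rw [← ENNReal.ofReal_mul (by positivity)]
        refine ENNReal.ofReal_le_ofReal ?_
        have h1 : ‖I.mean‖ + Real.log K + 4 ≤ 6 * (logFactor d K T * ‖I.mean‖) := by nlinarith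
        calc _ ≤ 34 * logFactor d K T ^ 2 * (2 * (6 * (logFactor d K T * ‖I.mean‖))) := by gcongr
          _ = _ := by ring

/-- The norm of the latent vector has so light tails that its integral over an event is bounded by
the probability of the event, up to a factor and a small error. -/
theorem lintegral_norm_indicator_le (hI : EigLeOne I) (hm : 1 ≤ ‖I.mean‖) (hT : 1 ≤ T)
    {B : Set (Sample d K)} (hB : MeasurableSet B) :
    ∫⁻ ω, B.indicator (fun ω => ENNReal.ofReal ‖ω.1‖) ω ∂law I
      ≤ ENNReal.ofReal (10 * (‖I.mean‖ * d * logFactor d K T)) * (law I B + ENNReal.ofReal (1 / T)) := by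
  have hd : (1:ℝ) ≤ d := by exact_mod_cast one_le_d I
  have hT' : (1:ℝ) ≤ T := by exact_mod_cast hT
  have hl := one_le_logFactor I hT
  obtain ⟨hl1, hl2, hl3, hl4⟩ := log_le_logFactor I hT
  have hc : 1 ≤ ‖I.mean‖ * d * logFactor d K T := by
    have : 1 ≤ ‖I.mean‖ * d := by nlinarith
    nlinarith
  set c := ‖I.mean‖ * d * logFactor d K T with hcdef
  have hpt : ∀ ω, B.indicator (fun ω : Sample d K => ENNReal.ofReal ‖ω.1‖) ω
      ≤ B.indicator (fun _ => ENNReal.ofReal (10 * c)) ω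
        + ENNReal.ofReal (4 * (1 / T))
          * ENNReal.ofReal (Real.exp (‖ω.1 - I.mean‖ ^ 2 / 4 - d)) := by
    intro ω
    by_cases h : ω ∈ B
    · rw [Set.indicator_of_mem h, Set.indicator_of_mem h, ← ENNReal.ofReal_mul (by positivity),
        ← ENNReal.ofReal_add (by positivity) (by positivity)]
      refine ENNReal.ofReal_le_ofReal ?_
      have h1 := norm_sq_le_log_inv_add (I := I) (p := 1 / T) (by positivity) ω.1
      have h2 : ‖ω.1‖ ≤ ‖ω.1 - I.mean‖ + ‖I.mean‖ := by
        simpa using norm_add_le (ω.1 - I.mean) I.mean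
      -- a linear term is at most one plus its square
      have h3 : ‖ω.1 - I.mean‖ ≤ 1 + ‖ω.1 - I.mean‖ ^ 2 := by nlinarith [sq_nonneg (‖ω.1 - I.mean‖ - 1)]
      rw [one_div, inv_inv] at h1
      have h4 : (d:ℝ) ≤ c := by
        calc (d:ℝ) = 1 * d * 1 := by ring
          _ ≤ c := by rw [hcdef]; gcongr
      have h5 : ‖I.mean‖ ≤ c := by
        calc ‖I.mean‖ = ‖I.mean‖ * 1 * 1 := by ring
          _ ≤ c := by rw [hcdef]; gcongr
      have h6 : logFactor d K T ≤ c := by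
        calc logFactor d K T = 1 * 1 * logFactor d K T := by ring
          _ ≤ c := by rw [hcdef]; gcongr
      rw [one_div]
      linarith
    · rw [Set.indicator_of_notMem h]; exact zero_le
  calc _ ≤ _ := lintegral_mono hpt
    _ = ENNReal.ofReal (10 * c) * law I B + ENNReal.ofReal (4 * (1 / T))
          * ∫⁻ ω : Sample d K, ENNReal.ofReal (Real.exp (‖ω.1 - I.mean‖ ^ 2 / 4 - d)) ∂law I := by
        rw [lintegral_add_left (measurable_const.indicator hB), lintegral_indicator_const hB,
          lintegral_const_mul _ (by fun_prop)]
    _ ≤ ENNReal.ofReal (10 * c) * law I B + ENNReal.ofReal (10 * c) * ENNReal.ofReal (1 / T) := by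
        refine add_le_add le_rfl ?_
        rw [(measurePreserving_latent I).lintegral_comp
          (f := fun θ => ENNReal.ofReal (Real.exp (‖θ - I.mean‖ ^ 2 / 4 - d))) (by fun_prop)]
        refine (mul_le_of_le_one_right zero_le (lintegral_exp_sq_sub_dim_le hI)).trans ?_
        rw [← ENNReal.ofReal_mul (by positivity)]
        refine ENNReal.ofReal_le_ofReal ?_
        gcongr
        linarith
    _ = _ := by rw [mul_add]

/-- A lower bound for the norm of the latent vector that holds with high probability. -/
noncomputable def normFloor (I : ProblemInstance d K) (T : ℕ) : ℝ := ‖I.mean‖ / (3 * logFactor d K T)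

theorem one_add_sqrt_le (I : ProblemInstance d K) (hT : 1 ≤ T) :
    1 + Real.sqrt (3 * Real.log T) ≤ 3 * logFactor d K T := by
  obtain ⟨hl1, hl2, hl3, hl4⟩ := log_le_logFactor I hT
  have h : Real.sqrt (3 * Real.log T) ≤ 1 + 3 * Real.log T := by
    rw [Real.sqrt_le_left (by positivity)]
    nlinarith
  linarith

theorem normFloor_pos (hm : 1 ≤ ‖I.mean‖) (hT : 1 ≤ T) : 0 < normFloor I T := by
  have := one_le_logFactor I hT
  unfold normFloor; positivity

theorem normFloor_le (hT : 1 ≤ T) (hm : 1 + Real.sqrt (3 * Real.log T) ≤ ‖I.mean‖) :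
    normFloor I T ≤ ‖I.mean‖ - Real.sqrt (3 * Real.log T) := by
  have h1 := one_add_sqrt_le I hT
  have h2 := Real.sqrt_nonneg (3 * Real.log T)
  have h3 : normFloor I T ≤ ‖I.mean‖ / (1 + Real.sqrt (3 * Real.log T)) := by
    unfold normFloor; gcongr
  refine h3.trans ?_
  rw [div_le_iff₀ (by positivity)]
  nlinarith

/-- The assumption on the length of the prior mean enters here. -/
theorem law_norm_lt_normFloor_le (hI : EigLeOne I) (hT : 1 ≤ T)
    (hm : 1 + Real.sqrt (3 * Real.log T) ≤ ‖I.mean‖) :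
    law I {ω | ‖ω.1‖ < normFloor I T} ≤ ENNReal.ofReal ((T:ℝ) ^ (-(3/2) : ℝ)) := by
  have hT' : (1:ℝ) ≤ T := by exact_mod_cast hT
  have h := (measurePreserving_latent I).measure_preimage
    (s := {θ : Vec d | ‖θ‖ < normFloor I T}) (measurableSet_lt (by fun_prop) (by fun_prop)).nullMeasurableSet
  refine (le_of_eq h).trans (le_trans (measure_mono ?_) (prior_inner_meanDir_lt hI hT'))
  intro θ hθ
  have h1 : (inner ℝ (meanDir I) θ : ℝ) ≤ ‖θ‖ := (real_inner_le_norm _ _).trans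
    (mul_le_of_le_one_left (norm_nonneg _) norm_meanDir_le)
  have h2 := normFloor_le hT hm
  have h3 : ‖θ‖ < normFloor I T := hθ
  show (inner ℝ (meanDir I) θ : ℝ) ≤ _
  linarith

end LinBandit
end

section
namespace LinBandit
open scoped ENNReal NNReal

variable {d K T : ℕ} {I : ProblemInstance d K}

/-! ### Splitting the regret by the size of the gap -/

/-- The trivial bound for the regret on an event `B` that does not depend on the draw of round
`t`: the contexts of round `t` are independent of `B` and of the latent vector. -/
theorem lintegral_indicator_norm_mul_radius_le (hI : EigLeOne I) (hm : 1 ≤ ‖I.mean‖) (hT : 1 ≤ T)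
    {t : ℕ} {B : Set (Sample d K)} (hB : MeasurableSet B)
    (hinv : ∀ ω z, setDraw t (ω, z) ∈ B ↔ ω ∈ B) :
    ∫⁻ ω, B.indicator (fun ω => ENNReal.ofReal ‖ω.1‖) ω * ENNReal.ofReal (2 * radius I (ω.2 t)) ∂law I
      ≤ ENNReal.ofReal (680 * (‖I.mean‖ * d * logFactor d K T ^ 3))
        * (law I B + ENNReal.ofReal (1 / T)) := by
  have hind : Measurable (B.indicator fun ω : Sample d K => ENNReal.ofReal ‖ω.1‖) :=
    Measurable.indicator (by fun_prop) hB
  have hl := one_le_logFactor I hT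
  have hrad : Measurable fun ω : Sample d K => ENNReal.ofReal (2 * radius I (ω.2 t)) := by fun_prop
  rw [lintegral_setDraw I t (F := fun ω => B.indicator (fun ω => ENNReal.ofReal ‖ω.1‖) ω
    * ENNReal.ofReal (2 * radius I (ω.2 t))) (hind.mul hrad)]
  calc _ = ∫⁻ ω, B.indicator (fun ω => ENNReal.ofReal ‖ω.1‖) ω
          * ∫⁻ z, ENNReal.ofReal (2 * radius I z) ∂roundLaw I ∂law I := by
        refine lintegral_congr fun ω => ?_
        rw [← lintegral_const_mul _ (by fun_prop)]
        refine lintegral_congr fun z => ?_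
        simp only [setDraw_same]
        congr 1
        by_cases h : ω ∈ B
        · rw [Set.indicator_of_mem h, Set.indicator_of_mem ((hinv ω z).2 h)]; rfl
        · rw [Set.indicator_of_notMem h, Set.indicator_of_notMem (fun h' => h ((hinv ω z).1 h'))]
    _ = (∫⁻ ω, B.indicator (fun ω => ENNReal.ofReal ‖ω.1‖) ω ∂law I)
          * ∫⁻ z, ENNReal.ofReal (2 * radius I z) ∂roundLaw I := lintegral_mul_const _ hind
    _ ≤ (ENNReal.ofReal (10 * (‖I.mean‖ * d * logFactor d K T)) * (law I B + ENNReal.ofReal (1 / T)))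
          * (ENNReal.ofReal 2 * ENNReal.ofReal (34 * logFactor d K T ^ 2)) := by
        gcongr
        · exact lintegral_norm_indicator_le hI hm hT hB
        · simp_rw [ENNReal.ofReal_mul (zero_le_two (α := ℝ))]
          rw [lintegral_const_mul _ (by fun_prop)]
          gcongr
          exact lintegral_radius_le hT
    _ = _ := by
        rw [mul_right_comm, ← ENNReal.ofReal_mul (by norm_num), ← ENNReal.ofReal_mul (by positivity)]
        congr 2; ring

/-- The trivial bound for the regret on an event `D` that depends on the draw of round `t` only.
-/
theorem lintegral_norm_mul_indicator_radius_le (hI : EigLeOne I) (hm : 1 ≤ ‖I.mean‖) (hT : 1 ≤ T)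
    {t : ℕ} {D : Set (RoundDraw d K)} (hD : MeasurableSet D)
    (hDp : roundLaw I D ≤ ENNReal.ofReal (1 / T ^ 2)) :
    ∫⁻ ω, ENNReal.ofReal ‖ω.1‖ * D.indicator (fun z => ENNReal.ofReal (2 * radius I z)) (ω.2 t) ∂law I
      ≤ ENNReal.ofReal (700 * (‖I.mean‖ * d * logFactor d K T ^ 3)) * ENNReal.ofReal (1 / T) := by
  have hl := one_le_logFactor I hT
  have hT' : (1:ℝ) ≤ T := by exact_mod_cast hT
  have hind : Measurable (D.indicator fun z => ENNReal.ofReal (2 * radius I z)) :=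
    Measurable.indicator (by fun_prop) hD
  have h1 : ∫⁻ θ, ENNReal.ofReal ‖θ‖ ∂prior I
      ≤ ENNReal.ofReal (20 * (‖I.mean‖ * d * logFactor d K T)) := by
    have h := lintegral_norm_indicator_le hI hm hT (B := (Set.univ : Set (Sample d K)))
      MeasurableSet.univ
    simp only [Set.indicator_univ, measure_univ] at h
    rw [(measurePreserving_latent I).lintegral_comp (f := fun θ => ENNReal.ofReal ‖θ‖) (by fun_prop)] at h
    refine h.trans ?_
    rw [← ENNReal.ofReal_one, ← ENNReal.ofReal_add (by norm_num) (by positivity),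
      ← ENNReal.ofReal_mul (by positivity)]
    refine ENNReal.ofReal_le_ofReal ?_
    have h2 : 1 / (T:ℝ) ≤ 1 := by rw [div_le_one (by linarith)]; exact hT'
    calc _ ≤ 10 * (‖I.mean‖ * d * logFactor d K T) * (1 + 1) := by gcongr
      _ = _ := by ring
  have h2 : ∫⁻ z, D.indicator (fun z => ENNReal.ofReal (2 * radius I z)) z ∂roundLaw I
      ≤ ENNReal.ofReal (35 * logFactor d K T ^ 2 * (1 / T)) := by
    calc _ ≤ ∫⁻ z, (ENNReal.ofReal (1 / T) * ENNReal.ofReal (radius I z ^ 2)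
            + D.indicator (fun _ => ENNReal.ofReal T) z) ∂roundLaw I := by
          -- `2 r ≤ r ^ 2 / T + T`, where the second term is paid on `D` only
          refine lintegral_mono fun z => ?_
          by_cases h : z ∈ D
          · rw [Set.indicator_of_mem h, Set.indicator_of_mem h, ← ENNReal.ofReal_mul (by positivity),
              ← ENNReal.ofReal_add (by positivity) (by positivity)]
            refine ENNReal.ofReal_le_ofReal ?_
            have h3 : 0 ≤ (1 / T : ℝ) * (radius I z - T) ^ 2 := by positivity
            have h4 : (1 / T : ℝ) * (radius I z - T) ^ 2
                = 1 / T * radius I z ^ 2 + T - 2 * radius I z := by field_simp; ring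
            linarith
          · rw [Set.indicator_of_notMem h]; exact zero_le
      _ ≤ ENNReal.ofReal (1 / T) * ENNReal.ofReal (34 * logFactor d K T ^ 2)
            + ENNReal.ofReal T * ENNReal.ofReal (1 / T ^ 2) := by
          rw [lintegral_add_right _ (measurable_const.indicator hD), lintegral_indicator_const hD,
            lintegral_const_mul _ (by fun_prop)]
          gcongr
          refine (lintegral_radius_sq_le I).trans (ENNReal.ofReal_le_ofReal ?_)
          have := one_le_lkd I
          have := log_KD_le_logFactor I hT
          gcongr
      _ ≤ _ := by
          rw [← ENNReal.ofReal_mul (by positivity), ← ENNReal.ofReal_mul (by positivity),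
            ← ENNReal.ofReal_add (by positivity) (by positivity)]
          refine ENNReal.ofReal_le_ofReal ?_
          have h3 : (T:ℝ) * (1 / T ^ 2) = 1 * (1 / T) := by field_simp
          rw [h3]
          have h4 : 1 ≤ logFactor d K T ^ 2 := one_le_pow₀ hl
          have h5 : 0 ≤ 1 / (T:ℝ) := by positivity
          nlinarith
  rw [lintegral_latent_draw I t (F := fun p => ENNReal.ofReal ‖p.1‖
    * D.indicator (fun z => ENNReal.ofReal (2 * radius I z)) p.2)
    (by
      have h3 : Measurable fun p : Vec d × RoundDraw d K =>
          D.indicator (fun z => ENNReal.ofReal (2 * radius I z)) p.2 := hind.comp measurable_snd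
      exact Measurable.mul (by fun_prop) h3)]
  simp_rw [lintegral_const_mul _ hind]
  rw [lintegral_mul_const _ (by fun_prop)]
  refine (mul_le_mul' h1 h2).trans (le_of_eq ?_)
  rw [← ENNReal.ofReal_mul (by positivity), ← ENNReal.ofReal_mul (by positivity)]
  congr 1; ring

/-- The event that two actions `a ≠ b` of a round, `a` available, have almost the same expected
reward, although the latent vector is not small. -/
def gapSet (I : ProblemInstance d K) (T : ℕ) (γ : ℝ) (a b : Fin K) : Set (Vec d × RoundDraw d K) :=
  {p | a ≠ b ∧ normFloor I T ≤ ‖p.1‖ ∧ Avail (ctxOf p.2) a ∧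
    |(inner ℝ p.1 (vecOf p.2 a) : ℝ) - inner ℝ p.1 (vecOf p.2 b)| ≤ γ}

theorem measurableSet_gapSet (γ : ℝ) (a b : Fin K) : MeasurableSet (gapSet I T γ a b) := by
  unfold gapSet
  refine MeasurableSet.inter (MeasurableSet.const _) (MeasurableSet.inter ?_ (MeasurableSet.inter ?_ ?_))
  · exact measurableSet_le (f := fun _ : Vec d × RoundDraw d K => normFloor I T)
      (g := fun p => ‖p.1‖) (by fun_prop) (by fun_prop)
  · exact (measurable_ctxOf.comp measurable_snd) (measurableSet_avail a)
  · exact measurableSet_le (f := fun p : Vec d × RoundDraw d K =>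
      |(inner ℝ p.1 (vecOf p.2 a) : ℝ) - inner ℝ p.1 (vecOf p.2 b)|) (g := fun _ => γ)
      (by fun_prop) (by fun_prop)

/-- A gap of width `γ` has probability of order `γ`, and costs at most `γ` when it occurs. -/
theorem lintegral_gapSet_le (hm : 1 ≤ ‖I.mean‖) (hT : 1 ≤ T) {γ : ℝ} (hγ : 0 < γ) (t : ℕ) (a b : Fin K) :
    ∫⁻ ω, (gapSet I T γ a b).indicator (fun _ => ENNReal.ofReal γ) (ω.1, ω.2 t) ∂law I
      ≤ ENNReal.ofReal (3 * γ ^ 2 * logFactor d K T / (I.rho * ‖I.mean‖)) := by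
  have hl := one_le_logFactor I hT
  have hρ := I.rho_pos
  have hf := normFloor_pos hm hT
  rw [lintegral_latent_draw I t (measurable_const.indicator (measurableSet_gapSet γ a b))]
  have key : ∀ θ : Vec d, ∫⁻ z, (gapSet I T γ a b).indicator (fun _ => ENNReal.ofReal γ) (θ, z) ∂roundLaw I
      ≤ ENNReal.ofReal (3 * γ ^ 2 * logFactor d K T / (I.rho * ‖I.mean‖)) := by
    intro θ
    by_cases hab : a ≠ b ∧ normFloor I T ≤ ‖θ‖
    · have hθ : θ ≠ 0 := norm_pos_iff.1 (hf.trans_le hab.2)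
      have h1 : ∀ z, (gapSet I T γ a b).indicator (fun _ => ENNReal.ofReal γ) (θ, z)
          = (Prod.mk θ ⁻¹' gapSet I T γ a b).indicator (fun _ => ENNReal.ofReal γ) z := fun z => rfl
      simp_rw [h1]
      rw [lintegral_indicator_const (measurable_prodMk_left (measurableSet_gapSet γ a b))]
      calc _ ≤ ENNReal.ofReal γ * roundLaw I {z | Avail (ctxOf z) a ∧
              |(inner ℝ θ (vecOf z a) : ℝ) - inner ℝ θ (vecOf z b)| ≤ γ} := by
            gcongr
            exact fun z hz => hz.2.2
        _ ≤ ENNReal.ofReal γ * ENNReal.ofReal (γ / (I.rho * normFloor I T)) := by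
            gcongr
            refine (roundLaw_gap_le hθ hab.1 γ).trans (ENNReal.ofReal_le_ofReal ?_)
            gcongr
            exact hab.2
        _ = _ := by
            rw [← ENNReal.ofReal_mul hγ.le, normFloor]
            congr 1
            have : 0 < ‖I.mean‖ := by linarith
            field_simp
    · have h1 : ∀ z, (gapSet I T γ a b).indicator (fun _ => ENNReal.ofReal γ) (θ, z) = 0 := fun z =>
        Set.indicator_of_notMem (fun h => hab ⟨h.1, h.2.1⟩) _
      simp_rw [h1]
      simp
  calc _ ≤ ∫⁻ _, ENNReal.ofReal (3 * γ ^ 2 * logFactor d K T / (I.rho * ‖I.mean‖)) ∂prior I :=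
        lintegral_mono key
    _ = _ := by
        have : IsProbabilityMeasure (prior I) := by unfold prior; infer_instance
        simp

/-- Regret at most `γ` is charged to the unlikely event of a small gap; larger regret is at most
its square divided by `γ`, which is where the estimation error enters. The exceptional events are
`B`, determined by the latent vector and the other rounds, and `D`, determined by the round
itself. -/
theorem lintegral_roundRegret_le_split (hI : EigLeOne I) (hm : 1 ≤ ‖I.mean‖) (hT : 1 ≤ T)
    {π : Policy d K} (hav : ChoosesAvailable I T π) {t : ℕ} (ht : t < T)
    {B : Set (Sample d K)} (hB : MeasurableSet B) (hinv : ∀ ω z, setDraw t (ω, z) ∈ B ↔ ω ∈ B)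
    (hsub : ∀ ω : Sample d K, ‖ω.1‖ < normFloor I T → ω ∈ B)
    {D : Set (RoundDraw d K)} (hD : MeasurableSet D) (hDp : roundLaw I D ≤ ENNReal.ofReal (1 / T ^ 2))
    {γ : ℝ} (hγ : 0 < γ) :
    ∫⁻ ω, ENNReal.ofReal (roundRegret π t ω) ∂law I
      ≤ ENNReal.ofReal γ⁻¹ * (∫⁻ ω, {ω : Sample d K | ω ∉ B ∧ ω.2 t ∉ D}.indicator
          (fun ω => ENNReal.ofReal (roundRegret π t ω ^ 2)) ω ∂law I)
        + ENNReal.ofReal (1000 * (‖I.mean‖ * d * logFactor d K T ^ 3))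
          * (law I B + ENNReal.ofReal (2 / T))
        + ENNReal.ofReal (3 * K ^ 2 * γ ^ 2 * logFactor d K T / (I.rho * ‖I.mean‖)) := by
  have hρ := I.rho_pos
  have hl := one_le_logFactor I hT
  have hT' : (1:ℝ) ≤ T := by exact_mod_cast hT
  set G : Set (Sample d K) := {ω : Sample d K | ω ∉ B ∧ ω.2 t ∉ D} with hG
  have hGm : MeasurableSet G :=
    hB.compl.inter (((measurable_pi_apply t).comp measurable_snd) hD).compl
  -- the four ways to pay: squared regret, `B`, `D`, and a small gap
  set F1 : Sample d K → ℝ≥0∞ := fun ω => ENNReal.ofReal γ⁻¹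
    * G.indicator (fun ω => ENNReal.ofReal (roundRegret π t ω ^ 2)) ω with hF1
  set F2 : Sample d K → ℝ≥0∞ := fun ω => B.indicator (fun ω => ENNReal.ofReal ‖ω.1‖) ω
    * ENNReal.ofReal (2 * radius I (ω.2 t)) with hF2
  set F3 : Sample d K → ℝ≥0∞ := fun ω => ENNReal.ofReal ‖ω.1‖
    * D.indicator (fun z => ENNReal.ofReal (2 * radius I z)) (ω.2 t) with hF3
  set F4 : Sample d K → ℝ≥0∞ := fun ω => ∑ a, ∑ b,
    (gapSet I T γ a b).indicator (fun _ => ENNReal.ofReal γ) (ω.1, ω.2 t) with hF4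
  have hm1 : Measurable F1 := by
    refine Measurable.const_mul (Measurable.indicator ?_ hGm) _
    fun_prop
  have hm2 : Measurable F2 := by
    refine Measurable.mul (Measurable.indicator ?_ hB) ?_ <;> fun_prop
  have hm3 : Measurable F3 := by
    have h1 : Measurable (D.indicator fun z => ENNReal.ofReal (2 * radius I z)) :=
      Measurable.indicator (by fun_prop) hD
    exact Measurable.mul (by fun_prop) (h1.comp ((measurable_pi_apply t).comp measurable_snd))
  have hpt : ∀ᵐ ω ∂law I, ENNReal.ofReal (roundRegret π t ω) ≤ F1 ω + (F2 ω + (F3 ω + F4 ω)) := by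
    filter_upwards [hav t ht, ae_draw I t (ae_norm_vecOf_le I)] with ω hω hr
    have hr1 := one_le_radius I (ω.2 t)
    have htriv : ENNReal.ofReal (roundRegret π t ω)
        ≤ ENNReal.ofReal ‖ω.1‖ * ENNReal.ofReal (2 * radius I (ω.2 t)) := by
      rw [← ENNReal.ofReal_mul (norm_nonneg _)]
      refine ENNReal.ofReal_le_ofReal ?_
      have := roundRegret_le hω (M := ‖ω.1‖ * radius I (ω.2 t)) fun a =>
        (abs_real_inner_le_norm _ _).trans (by gcongr; exact hr a)
      linarith
    by_cases hBω : ω ∈ B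
    · refine htriv.trans (le_trans ?_ (le_add_left (le_add_right le_rfl)))
      simp only [hF2, Set.indicator_of_mem hBω]; exact le_rfl
    by_cases hDω : ω.2 t ∈ D
    · refine htriv.trans (le_trans ?_ (le_add_left (le_add_left (le_add_right le_rfl))))
      simp only [hF3, Set.indicator_of_mem hDω]; exact le_rfl
    have h0 := roundRegret_nonneg hω
    rcases lt_or_ge γ (roundRegret π t ω) with hlt | hle
    · refine le_trans ?_ (le_add_right le_rfl)
      simp only [hF1]
      rw [Set.indicator_of_mem (show ω ∈ G from ⟨hBω, hDω⟩), ← ENNReal.ofReal_mul (by positivity)]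
      refine ENNReal.ofReal_le_ofReal ?_
      rw [← div_eq_inv_mul, le_div_iff₀ hγ]
      nlinarith
    · obtain ⟨b, hb, hbe⟩ := exists_bestReward (θ := ω.1) hω
      rcases eq_or_ne b (action π ω t) with he | hne
      · have h1 : roundRegret π t ω = 0 := by
          unfold roundRegret; rw [hbe, he]; exact sub_self _
        rw [h1]; simp
      · refine le_trans ?_ (le_add_left (le_add_left (le_add_left le_rfl)))
        have hmem : (ω.1, ω.2 t) ∈ gapSet I T γ b (action π ω t) := by
          refine ⟨hne, not_lt.1 fun h => hBω (hsub ω h), hb, ?_⟩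
          have h1 : (inner ℝ ω.1 (vecOf (ω.2 t) b) : ℝ) - inner ℝ ω.1 (vecOf (ω.2 t) (action π ω t))
              = roundRegret π t ω := by unfold roundRegret; rw [hbe]; rfl
          show |_| ≤ γ
          rw [h1, abs_of_nonneg h0]; exact hle
        calc ENNReal.ofReal (roundRegret π t ω) ≤ ENNReal.ofReal γ := ENNReal.ofReal_le_ofReal hle
          _ = (gapSet I T γ b (action π ω t)).indicator (fun _ => ENNReal.ofReal γ) (ω.1, ω.2 t) :=
              by rw [Set.indicator_of_mem hmem]
          _ ≤ ∑ b', (gapSet I T γ b b').indicator (fun _ => ENNReal.ofReal γ) (ω.1, ω.2 t) :=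
              Finset.single_le_sum (f := fun b' =>
                (gapSet I T γ b b').indicator (fun _ => ENNReal.ofReal γ) (ω.1, ω.2 t))
                (fun _ _ => zero_le) (Finset.mem_univ _)
          _ ≤ F4 ω := Finset.single_le_sum (f := fun a => ∑ b',
                (gapSet I T γ a b').indicator (fun _ => ENNReal.ofReal γ) (ω.1, ω.2 t))
                (fun _ _ => zero_le) (Finset.mem_univ _)
  have h4 : ∫⁻ ω, F4 ω ∂law I
      ≤ ENNReal.ofReal (3 * K ^ 2 * γ ^ 2 * logFactor d K T / (I.rho * ‖I.mean‖)) := by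
    have hmeas : ∀ a b, Measurable fun ω : Sample d K =>
        (gapSet I T γ a b).indicator (fun _ => ENNReal.ofReal γ) (ω.1, ω.2 t) := fun a b =>
      (measurable_const.indicator (measurableSet_gapSet γ a b)).comp
        (f := fun ω : Sample d K => (ω.1, ω.2 t)) (by fun_prop)
    simp only [hF4]
    rw [lintegral_finsetSum _ fun a _ => Finset.measurable_fun_sum _ fun b _ => hmeas a b]
    simp_rw [lintegral_finsetSum _ fun b _ => hmeas _ b]
    calc _ ≤ ∑ _a : Fin K, ∑ _b : Fin K,
            ENNReal.ofReal (3 * γ ^ 2 * logFactor d K T / (I.rho * ‖I.mean‖)) :=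
          Finset.sum_le_sum fun a _ => Finset.sum_le_sum fun b _ => lintegral_gapSet_le hm hT hγ t a b
      _ = _ := by
          simp only [Finset.sum_const, Finset.card_univ, Fintype.card_fin, nsmul_eq_mul]
          rw [← ENNReal.ofReal_natCast, ← ENNReal.ofReal_mul (by positivity),
            ← ENNReal.ofReal_mul (by positivity)]
          congr 1; ring
  calc _ ≤ ∫⁻ ω, (F1 ω + (F2 ω + (F3 ω + F4 ω))) ∂law I := lintegral_mono_ae hpt
    _ = (∫⁻ ω, F1 ω ∂law I) + ((∫⁻ ω, F2 ω ∂law I) + ((∫⁻ ω, F3 ω ∂law I) + ∫⁻ ω, F4 ω ∂law I)) := by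
        rw [lintegral_add_left hm1, lintegral_add_left hm2, lintegral_add_left hm3]
    _ ≤ ENNReal.ofReal γ⁻¹ * (∫⁻ ω, G.indicator
          (fun ω => ENNReal.ofReal (roundRegret π t ω ^ 2)) ω ∂law I)
        + (ENNReal.ofReal (1000 * (‖I.mean‖ * d * logFactor d K T ^ 3)) * (law I B + ENNReal.ofReal (1 / T))
        + (ENNReal.ofReal (1000 * (‖I.mean‖ * d * logFactor d K T ^ 3)) * ENNReal.ofReal (1 / T)
        + ENNReal.ofReal (3 * K ^ 2 * γ ^ 2 * logFactor d K T / (I.rho * ‖I.mean‖)))) := by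
        refine add_le_add (le_of_eq ?_) (add_le_add ?_ (add_le_add ?_ h4))
        · simp only [hF1]
          rw [lintegral_const_mul]
          exact Measurable.indicator (by fun_prop) hGm
        · refine (lintegral_indicator_norm_mul_radius_le hI hm hT hB hinv).trans ?_
          gcongr
          norm_num
        · refine (lintegral_norm_mul_indicator_radius_le hI hm hT hD hDp).trans ?_
          gcongr
          norm_num
    _ = _ := by
        have h2 : ENNReal.ofReal (2 / T) = ENNReal.ofReal (1 / T) + ENNReal.ofReal (1 / T) := by
          rw [← ENNReal.ofReal_add (by positivity) (by positivity)]; congr 1; ring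
        rw [h2, ← add_assoc, ← add_assoc, ← add_assoc (law I B), mul_add, ← add_assoc, add_assoc]
        rw [mul_add, mul_add]
        ring

/-- A bound on the Bayesian regret from bounds on the probabilities of the exceptional events `B
t` and on the squared regret outside of them. The first `n` rounds are paid for by the trivial
bound. -/
theorem bayesRegretLE_of_sq (hI : EigLeOne I) (hm : 1 ≤ ‖I.mean‖) (hT : 1 ≤ T)
    {π : Policy d K} (hav : ChoosesAvailable I T π) (n : ℕ)
    (B : ℕ → Set (Sample d K)) (hB : ∀ t, n ≤ t → t < T → MeasurableSet (B t))
    (hinv : ∀ t, n ≤ t → t < T → ∀ ω z, setDraw t (ω, z) ∈ B t ↔ ω ∈ B t)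
    (hsub : ∀ t, n ≤ t → t < T → ∀ ω : Sample d K, ‖ω.1‖ < normFloor I T → ω ∈ B t)
    {D : Set (RoundDraw d K)} (hD : MeasurableSet D) (hDp : roundLaw I D ≤ ENNReal.ofReal (1 / T ^ 2))
    {p S : ℝ} (hp0 : 0 ≤ p) (hS0 : 0 ≤ S)
    (hp : ∑ t ∈ Finset.Ico n T, law I (B t) ≤ ENNReal.ofReal p)
    (hS : ∑ t ∈ Finset.Ico n T, ∫⁻ ω, {ω : Sample d K | ω ∉ B t ∧ ω.2 t ∉ D}.indicator
          (fun ω => ENNReal.ofReal (roundRegret π t ω ^ 2)) ω ∂law I ≤ ENNReal.ofReal S) :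
    BayesRegretLE I π T (408 * logFactor d K T ^ 3 * ‖I.mean‖ * n
      + 1000 * (‖I.mean‖ * d * logFactor d K T ^ 3) * (p + 2)
      + (K:ℝ) ^ (2 / 3 : ℝ) * (T:ℝ) ^ (1 / 3 : ℝ) * (S / ‖I.mean‖
        + 3 * logFactor d K T * ‖I.mean‖ / I.rho)) := by
  have hρ := I.rho_pos
  have hl := one_le_logFactor I hT
  have hT' : (0:ℝ) < T := by exact_mod_cast hT
  have hK : (0:ℝ) < K := by exact_mod_cast one_le_K I
  have hm0 : 0 < ‖I.mean‖ := by linarith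
  -- with this width, the squared regret divided by `γ` and the `K ^ 2 * T` small gaps both cost
  -- `K ^ (2 / 3) * T ^ (1 / 3)`
  set γ : ℝ := ‖I.mean‖ / ((K:ℝ) ^ (2 / 3 : ℝ) * (T:ℝ) ^ (1 / 3 : ℝ)) with hγdef
  have hγ : 0 < γ := by positivity
  set bd : ℝ := 408 * logFactor d K T ^ 3 * ‖I.mean‖ * n
      + 1000 * (‖I.mean‖ * d * logFactor d K T ^ 3) * (p + 2)
      + (K:ℝ) ^ (2 / 3 : ℝ) * (T:ℝ) ^ (1 / 3 : ℝ) * (S / ‖I.mean‖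
        + 3 * logFactor d K T * ‖I.mean‖ / I.rho) with hbd
  have hbd0 : 0 ≤ bd := by positivity
  have hnn : ∀ᵐ ω ∂law I, ∀ t ∈ Finset.range T, 0 ≤ roundRegret π t ω := by
    rw [Filter.eventually_all_finset]
    exact fun t ht => (hav t (Finset.mem_range.1 ht)).mono fun ω h => roundRegret_nonneg h
  have hnn' : 0 ≤ᵐ[law I] regret π T := hnn.mono fun ω h => Finset.sum_nonneg h
  have hmeas : Measurable (regret π T) := by
    have : regret π T = fun ω => ∑ t ∈ Finset.range T, roundRegret π t ω := rfl
    rw [this]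
    exact Finset.measurable_fun_sum _ fun t _ => measurable_roundRegret π t
  have key : ∫⁻ ω, ENNReal.ofReal (regret π T ω) ∂law I ≤ ENNReal.ofReal bd := by
    calc _ = ∑ t ∈ Finset.range T, ∫⁻ ω, ENNReal.ofReal (roundRegret π t ω) ∂law I := by
          rw [← lintegral_finsetSum _ fun t _ => by fun_prop]
          refine lintegral_congr_ae ?_
          filter_upwards [hnn] with ω hω
          rw [regret_eq_sum, ENNReal.ofReal_sum_of_nonneg hω]
      _ = (∑ t ∈ (Finset.range T).filter (· < n), ∫⁻ ω, ENNReal.ofReal (roundRegret π t ω) ∂law I)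
          + ∑ t ∈ Finset.Ico n T, ∫⁻ ω, ENNReal.ofReal (roundRegret π t ω) ∂law I := by
          rw [← Finset.sum_filter_add_sum_filter_not (Finset.range T) (· < n)]
          congr 2
          ext t; simp; omega
      _ ≤ (∑ t ∈ (Finset.range T).filter (· < n), ENNReal.ofReal (408 * logFactor d K T ^ 3 * ‖I.mean‖))
          + ∑ t ∈ Finset.Ico n T, (ENNReal.ofReal γ⁻¹ * (∫⁻ ω, {ω : Sample d K | ω ∉ B t ∧ ω.2 t ∉ D}.indicator
          (fun ω => ENNReal.ofReal (roundRegret π t ω ^ 2)) ω ∂law I)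
        + ENNReal.ofReal (1000 * (‖I.mean‖ * d * logFactor d K T ^ 3))
          * (law I (B t) + ENNReal.ofReal (2 / T))
        + ENNReal.ofReal (3 * K ^ 2 * γ ^ 2 * logFactor d K T / (I.rho * ‖I.mean‖))) := by
          refine add_le_add (Finset.sum_le_sum fun t ht => ?_) (Finset.sum_le_sum fun t ht => ?_)
          · exact lintegral_roundRegret_le hI hm hT hav
              (Finset.mem_range.1 (Finset.mem_filter.1 ht).1)
          · obtain ⟨h1, h2⟩ := Finset.mem_Ico.1 ht
            exact lintegral_roundRegret_le_split hI hm hT hav h2 (hB t h1 h2) (hinv t h1 h2)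
              (hsub t h1 h2) hD hDp hγ
      _ ≤ n * ENNReal.ofReal (408 * logFactor d K T ^ 3 * ‖I.mean‖)
          + (ENNReal.ofReal γ⁻¹ * ENNReal.ofReal S
          + ENNReal.ofReal (1000 * (‖I.mean‖ * d * logFactor d K T ^ 3))
            * (ENNReal.ofReal p + T * ENNReal.ofReal (2 / T))
          + T * ENNReal.ofReal (3 * K ^ 2 * γ ^ 2 * logFactor d K T / (I.rho * ‖I.mean‖))) := by
          have hc1 : ((Finset.range T).filter (· < n)).card ≤ n := by
            calc _ ≤ (Finset.range n).card := Finset.card_le_card fun t ht => by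
                  simp at ht ⊢; exact ht.2
              _ = n := Finset.card_range n
          have hc2 : (Finset.Ico n T).card ≤ T := by simp
          rw [Finset.sum_const, Finset.sum_add_distrib, Finset.sum_add_distrib, ← Finset.mul_sum,
            ← Finset.mul_sum, Finset.sum_add_distrib, Finset.sum_const, Finset.sum_const]
          simp only [nsmul_eq_mul]
          gcongr
      _ = ENNReal.ofReal bd := by
          rw [← ENNReal.ofReal_natCast n, ← ENNReal.ofReal_natCast T,
            ← ENNReal.ofReal_mul (by positivity), ← ENNReal.ofReal_mul (by positivity),
            ← ENNReal.ofReal_mul (by positivity), ← ENNReal.ofReal_mul (by positivity),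
            ← ENNReal.ofReal_add (by positivity) (by positivity),
            ← ENNReal.ofReal_mul (by positivity), ← ENNReal.ofReal_add (by positivity) (by positivity),
            ← ENNReal.ofReal_add (by positivity) (by positivity),
            ← ENNReal.ofReal_add (by positivity) (by positivity)]
          congr 1
          have hK3 : ((K:ℝ) ^ (2 / 3 : ℝ)) ^ 3 = (K:ℝ) ^ 2 := by
            rw [← Real.rpow_natCast, ← Real.rpow_mul hK.le, ← Real.rpow_natCast]; norm_num
          have hT3 : ((T:ℝ) ^ (1 / 3 : ℝ)) ^ 3 = T := by
            rw [← Real.rpow_natCast, ← Real.rpow_mul hT'.le]; norm_num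
          have e1 : (T:ℝ) * (2 / T) = 2 := by field_simp
          have e2 : (T:ℝ) * (3 * K ^ 2 * γ ^ 2 * logFactor d K T / (I.rho * ‖I.mean‖))
              = (K:ℝ) ^ (2 / 3 : ℝ) * (T:ℝ) ^ (1 / 3 : ℝ) * (3 * logFactor d K T * ‖I.mean‖ / I.rho) := by
            rw [← hK3, hγdef]
            nth_rw 1 [← hT3]
            have : 0 < (K:ℝ) ^ (2 / 3 : ℝ) := by positivity
            have : 0 < (T:ℝ) ^ (1 / 3 : ℝ) := by positivity
            field_simp
          have e3 : γ⁻¹ * S = (K:ℝ) ^ (2 / 3 : ℝ) * (T:ℝ) ^ (1 / 3 : ℝ) * (S / ‖I.mean‖) := by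
            rw [hγdef, inv_div]; ring
          rw [e1, e2, e3, hbd]
          ring
  have hint : Integrable (regret π T) (law I) := by
    refine ⟨hmeas.aestronglyMeasurable, ?_⟩
    rw [hasFiniteIntegral_iff_ofReal hnn']
    exact key.trans_lt ENNReal.ofReal_lt_top
  refine ⟨hint, ?_⟩
  rw [integral_eq_lintegral_of_nonneg_ae hnn' hmeas.aestronglyMeasurable]
  exact ENNReal.toReal_le_of_le_ofReal hbd0 key

end LinBandit
end

section
namespace LinBandit
open Matrix
open scoped ENNReal NNReal

variable {d K T : ℕ} {I : ProblemInstance d K}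

/-! ### LinUCB -/

/-- Used to rearrange the terms of the confidence width: the left-hand side is what the analysis
needs, the right-hand side is what the parameters of LinUCB provide. -/
theorem sqrt_add_sqrt_le {a b c e : ℝ} (ha : 0 ≤ a) (hb : 0 ≤ b) (hc : 0 ≤ c) (he : 0 ≤ e)
    (h1 : a + b ≤ c + e) (h2 : a * b ≤ c * e) :
    Real.sqrt a + Real.sqrt b ≤ Real.sqrt c + Real.sqrt e := by
  refine (sq_le_sq₀ (by positivity) (by positivity)).1 ?_
  have h3 : Real.sqrt a * Real.sqrt b ≤ Real.sqrt c * Real.sqrt e := by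
    rw [← Real.sqrt_mul ha, ← Real.sqrt_mul hc]
    exact Real.sqrt_le_sqrt h2
  have := Real.sq_sqrt ha
  have := Real.sq_sqrt hb
  have := Real.sq_sqrt hc
  have := Real.sq_sqrt he
  nlinarith

/-- The bound for the norms of the context vectors that LinUCB is run with. -/
noncomputable def ucbNorm (I : ProblemInstance d K) (T : ℕ) : ℝ :=
  1 + I.rho * Real.sqrt (2 * d * Real.log (2 * (T : ℝ) ^ 3 * K * d))

/-- The rounds with a context vector longer than `ucbNorm I T`. -/
def longDraws (I : ProblemInstance d K) (T : ℕ) : Set (RoundDraw d K) :=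
  {z | ∃ a, ucbNorm I T < ‖vecOf z a‖}

theorem measurableSet_longDraws : MeasurableSet (longDraws I T) := by
  have : longDraws I T = ⋃ a, {z | ucbNorm I T < ‖vecOf z a‖} := by ext z; simp [longDraws]
  rw [this]
  exact MeasurableSet.iUnion fun a => measurableSet_lt measurable_const (by fun_prop)

theorem one_le_ucbArg (I : ProblemInstance d K) (hT : 1 ≤ T) : 1 ≤ 2 * (T : ℝ) ^ 3 * K * d := by
  have hT' : (1:ℝ) ≤ T := by exact_mod_cast hT
  have h1 := one_le_KD I
  have h2 : (1:ℝ) ≤ (T:ℝ) ^ 3 := one_le_pow₀ hT'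
  nlinarith

theorem roundLaw_longDraws_le (hT : 1 ≤ T) :
    roundLaw I (longDraws I T) ≤ ENNReal.ofReal (1 / T ^ 3) := by
  have hT' : (1:ℝ) ≤ T := by exact_mod_cast hT
  have h1 := one_le_ucbArg I hT
  have hKD := one_le_KD I
  refine (roundLaw_norm_gt_le I (Real.log_nonneg h1)).trans (ENNReal.ofReal_le_ofReal (le_of_eq ?_))
  rw [Real.exp_neg, Real.exp_log (by linarith)]
  have : (K:ℝ) * d ≠ 0 := by linarith
  have h2 : (K:ℝ) ≠ 0 := left_ne_zero_of_mul this
  have h3 : (d:ℝ) ≠ 0 := right_ne_zero_of_mul this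
  field_simp

theorem ucbNorm_sq_le (hT : 1 ≤ T) :
    1 ≤ ucbNorm I T ∧ ucbNorm I T ^ 2 ≤ 14 * logFactor d K T := by
  have hl := one_le_logFactor I hT
  obtain ⟨hl1, hl2, hl3, hl4⟩ := log_le_logFactor I hT
  have hT' : (0:ℝ) < T := by exact_mod_cast hT
  have hK : (0:ℝ) < K := by exact_mod_cast one_le_K I
  have hd : (0:ℝ) < d := by exact_mod_cast one_le_d I
  have hρ := I.rho_pos
  have hlog : Real.log (2 * (T : ℝ) ^ 3 * K * d) ≤ 3 * logFactor d K T := by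
    rw [Real.log_mul (by positivity) (by positivity), Real.log_mul (by positivity) (by positivity),
      Real.log_mul (by positivity) (by positivity), Real.log_pow]
    have := Real.log_two_lt_d9
    push_cast
    linarith
  have hlog0 := Real.log_nonneg (one_le_ucbArg I hT)
  set q := I.rho * Real.sqrt (2 * d * Real.log (2 * (T : ℝ) ^ 3 * K * d)) with hq
  have hq0 : 0 ≤ q := by positivity
  have hq2 : q ^ 2 ≤ 6 * logFactor d K T := by
    rw [hq, mul_pow, Real.sq_sqrt (by positivity)]
    have := rho_sq_mul_le I
    calc I.rho ^ 2 * (2 * d * Real.log (2 * (T : ℝ) ^ 3 * K * d))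
        = (d * I.rho ^ 2) * (2 * Real.log (2 * (T : ℝ) ^ 3 * K * d)) := by ring
      _ ≤ 1 * (2 * (3 * logFactor d K T)) := by gcongr
      _ = _ := by ring
  have he : ucbNorm I T = 1 + q := rfl
  rw [he]
  constructor
  · linarith
  · nlinarith [sq_nonneg (q - 1)]

theorem log_ucb_le (hT : 1 ≤ T) {t : ℕ} (ht : t ≤ T) :
    0 ≤ Real.log (1 + t * ucbNorm I T ^ 2) ∧
      Real.log (1 + t * ucbNorm I T ^ 2) ≤ 5 * logFactor d K T := by
  have hl := one_le_logFactor I hT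
  obtain ⟨hl1, hl2, hl3, hl4⟩ := log_le_logFactor I hT
  obtain ⟨hL1, hL2⟩ := ucbNorm_sq_le (I := I) hT
  have hT' : (1:ℝ) ≤ T := by exact_mod_cast hT
  have ht' : (t:ℝ) ≤ T := by exact_mod_cast ht
  refine ⟨Real.log_nonneg (by nlinarith [sq_nonneg (ucbNorm I T), Nat.cast_nonneg (α := ℝ) t]), ?_⟩
  calc Real.log (1 + t * ucbNorm I T ^ 2) ≤ Real.log (15 * (T * logFactor d K T)) := by
        refine Real.log_le_log (by positivity) ?_
        have h1 : (t:ℝ) * ucbNorm I T ^ 2 ≤ T * (14 * logFactor d K T) := by gcongr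
        nlinarith
    _ = Real.log 15 + (Real.log T + Real.log (logFactor d K T)) := by
        rw [Real.log_mul (by norm_num) (by positivity), Real.log_mul (by positivity) (by positivity)]
    _ ≤ 3 + (Real.log T + (logFactor d K T - 1)) := by
        gcongr
        · rw [Real.log_le_iff_le_exp (by norm_num)]
          have h3 : Real.exp 3 = Real.exp 1 ^ 3 := by rw [← Real.exp_nat_mul]; norm_num
          rw [h3]
          calc (15:ℝ) ≤ 2.7182818283 ^ 3 := by norm_num
            _ ≤ Real.exp 1 ^ 3 := by gcongr; exact Real.exp_one_gt_d9.le
        · exact Real.log_le_sub_one_of_pos (by linarith)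
    _ ≤ _ := by linarith

/-- The width of the confidence intervals of LinUCB. -/
noncomputable def ucbWidth (I : ProblemInstance d K) (T t : ℕ) : ℝ :=
  width d T (‖I.mean‖ + Real.sqrt (3 * d * Real.log T)) (ucbNorm I T) 1 (t + 1)

theorem ucbWidth_eq (hT : 1 ≤ T) (t : ℕ) :
    ucbWidth I T t = ‖I.mean‖ + Real.sqrt (3 * d * Real.log T)
      + Real.sqrt (d * (Real.log T + Real.log (1 + (t + 1 : ℕ) * ucbNorm I T ^ 2))) := by
  have hT' : (0:ℝ) < T := by exact_mod_cast hT
  unfold ucbWidth width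
  rw [mul_one, ← Real.log_mul hT'.ne' (by positivity)]
  push_cast
  congr 4
  ring

theorem ucbWidth_sq_le (hm : 1 ≤ ‖I.mean‖) (hT : 1 ≤ T) {t : ℕ} (ht : t < T) :
    0 ≤ ucbWidth I T t ∧ ucbWidth I T t ^ 2 ≤ 60 * (‖I.mean‖ ^ 2 * d * logFactor d K T) := by
  have hl := one_le_logFactor I hT
  obtain ⟨hl1, hl2, hl3, hl4⟩ := log_le_logFactor I hT
  have hd : (1:ℝ) ≤ d := by exact_mod_cast one_le_d I
  obtain ⟨h1, h2⟩ := log_ucb_le (I := I) hT ht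
  rw [ucbWidth_eq hT]
  refine ⟨by positivity, ?_⟩
  have h3 := Real.sq_sqrt (show 0 ≤ 3 * d * Real.log T by positivity)
  have h4 := Real.sq_sqrt (show 0 ≤ d * (Real.log T + Real.log (1 + (t + 1 : ℕ) * ucbNorm I T ^ 2))
    by positivity)
  set x := Real.sqrt (3 * d * Real.log T)
  set y := Real.sqrt (d * (Real.log T + Real.log (1 + (t + 1 : ℕ) * ucbNorm I T ^ 2)))
  have h5 : x ^ 2 ≤ 3 * (d * logFactor d K T) := by
    rw [h3, mul_assoc]; gcongr; linarith
  have h6 : y ^ 2 ≤ 6 * (d * logFactor d K T) := by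
    rw [h4, mul_left_comm]; gcongr; linarith
  have h7 : (‖I.mean‖ + x + y) ^ 2 ≤ 3 * (‖I.mean‖ ^ 2 + x ^ 2 + y ^ 2) := by
    nlinarith [sq_nonneg (‖I.mean‖ - x), sq_nonneg (x - y), sq_nonneg (‖I.mean‖ - y)]
  have h8 : 1 ≤ d * logFactor d K T := by nlinarith
  have h9 : 1 ≤ ‖I.mean‖ ^ 2 := one_le_pow₀ hm
  have h10 : ‖I.mean‖ ^ 2 ≤ ‖I.mean‖ ^ 2 * (d * logFactor d K T) := by nlinarith
  have h11 : d * logFactor d K T ≤ ‖I.mean‖ ^ 2 * (d * logFactor d K T) := by nlinarith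
  rw [mul_assoc (‖I.mean‖ ^ 2)]
  linarith

/-- The event that the estimates of LinUCB at time `t` are not reliable: the latent vector is far
from its mean, the accumulated noise is large, a context of an earlier round was too long, or the
latent vector is too short for the anti-concentration of the gaps. -/
def ucbBad (I : ProblemInstance d K) (T : ℕ) (π : Policy d K) (t : ℕ) : Set (Sample d K) :=
  {ω | 2 * d * Real.log T ≤ ‖ω.1 - I.mean‖ ^ 2} ∪
  {ω | logDet (history π ω t) + 4 / 3 * Real.log T ≤ noiseEnergy ω.1 (history π ω t)} ∪
  {ω | ∃ s < t, ω.2 s ∈ longDraws I T} ∪ {ω | ‖ω.1‖ < normFloor I T}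

theorem measurableSet_ucbBad (π : Policy d K) (t : ℕ) : MeasurableSet (ucbBad I T π t) := by
  unfold ucbBad
  refine MeasurableSet.union (MeasurableSet.union (MeasurableSet.union ?_ ?_) ?_) ?_
  · exact measurableSet_le (by fun_prop) (by fun_prop)
  · exact measurableSet_le (f := fun ω : Sample d K => logDet (history π ω t) + 4 / 3 * Real.log T)
      (g := fun ω => noiseEnergy ω.1 (history π ω t)) (by fun_prop) (by fun_prop)
  · have : {ω : Sample d K | ∃ s < t, ω.2 s ∈ longDraws I T}
        = ⋃ s, ⋃ (_ : s < t), {ω | ω.2 s ∈ longDraws I T} := by ext ω; simp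
    rw [this]
    exact MeasurableSet.iUnion fun s => MeasurableSet.iUnion fun _ =>
      ((measurable_pi_apply s).comp measurable_snd) measurableSet_longDraws
  · exact measurableSet_lt (by fun_prop) (by fun_prop)

theorem setDraw_mem_ucbBad (π : Policy d K) (t : ℕ) (ω : Sample d K) (z : RoundDraw d K) :
    setDraw t (ω, z) ∈ ucbBad I T π t ↔ ω ∈ ucbBad I T π t := by
  have h : (∃ s < t, (setDraw t (ω, z)).2 s ∈ longDraws I T) ↔ ∃ s < t, ω.2 s ∈ longDraws I T := by
    refine exists_congr fun s => and_congr_right fun hs => ?_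
    rw [setDraw_of_ne hs.ne]
  simp only [ucbBad, Set.mem_union, Set.mem_ofPred_eq, setDraw_latent, history_setDraw π le_rfl, h]

/-- Self-normalized concentration of the accumulated noise. -/
theorem law_noiseEnergy_ge_le (hT : 1 ≤ T) (π : Policy d K) (t : ℕ) :
    law I {ω | logDet (history π ω t) + 4 / 3 * Real.log T ≤ noiseEnergy ω.1 (history π ω t)}
      ≤ ENNReal.ofReal ((T:ℝ) ^ (-(2 / 3) : ℝ)) := by
  have hT' : (0:ℝ) < T := by exact_mod_cast hT
  have hpos : 0 < (T:ℝ) ^ (2 / 3 : ℝ) := by positivity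
  calc _ ≤ law I {ω | ENNReal.ofReal ((T:ℝ) ^ (2 / 3 : ℝ))
            ≤ ENNReal.ofReal (expMart ω.1 (history π ω t))} := by
        refine measure_mono fun ω hω => ENNReal.ofReal_le_ofReal ?_
        have h : logDet (history π ω t) + 4 / 3 * Real.log T ≤ noiseEnergy ω.1 (history π ω t) := hω
        rw [Real.rpow_def_of_pos hT', expMart]
        exact Real.exp_le_exp.2 (by linarith)
    _ ≤ (∫⁻ ω, ENNReal.ofReal (expMart ω.1 (history π ω t)) ∂law I)
          / ENNReal.ofReal ((T:ℝ) ^ (2 / 3 : ℝ)) :=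
        meas_ge_le_lintegral_div (by fun_prop) (by simpa using hpos) ENNReal.ofReal_ne_top
    _ ≤ 1 / ENNReal.ofReal ((T:ℝ) ^ (2 / 3 : ℝ)) := by
        gcongr
        exact lintegral_expMart_le π I t
    _ = _ := by
        rw [Real.rpow_neg hT'.le, one_div, ENNReal.ofReal_inv_of_pos hpos]

theorem law_ucbBad_le (hI : EigLeOne I) (hT : 1 ≤ T)
    (hm : 1 + Real.sqrt (3 * Real.log T) ≤ ‖I.mean‖) (π : Policy d K) {t : ℕ} (ht : t < T) :
    law I (ucbBad I T π t) ≤ ENNReal.ofReal (5 * (T:ℝ) ^ (-(2 / 3) : ℝ)) := by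
  have hT' : (1:ℝ) ≤ T := by exact_mod_cast hT
  have ht' : (t:ℝ) ≤ T := by exact_mod_cast ht.le
  have h1 : law I {ω | 2 * d * Real.log T ≤ ‖ω.1 - I.mean‖ ^ 2}
      ≤ ENNReal.ofReal (2 * (T:ℝ) ^ (-(2 / 3) : ℝ)) := by
    have h := (measurePreserving_latent I).measure_preimage
      (s := {θ : Vec d | 2 * d * Real.log T ≤ ‖θ - I.mean‖ ^ 2})
      (measurableSet_le (by fun_prop) (by fun_prop)).nullMeasurableSet
    refine (le_of_eq h).trans ((prior_norm_sq_tail hI (one_le_d I) hT').trans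
      (ENNReal.ofReal_le_ofReal ?_))
    exact mul_le_mul_of_nonneg_left (Real.rpow_le_rpow_of_exponent_le hT' (by norm_num)) two_pos.le
  have h2 : law I {ω : Sample d K | ∃ s < t, ω.2 s ∈ longDraws I T}
      ≤ ENNReal.ofReal ((T:ℝ) ^ (-(2 / 3) : ℝ)) := by
    have : {ω : Sample d K | ∃ s < t, ω.2 s ∈ longDraws I T}
        = ⋃ s ∈ Finset.range t, {ω | ω.2 s ∈ longDraws I T} := by ext ω; simp
    rw [this]
    calc _ ≤ ∑ s ∈ Finset.range t, law I {ω | ω.2 s ∈ longDraws I T} := measure_biUnion_finset_le _ _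
      _ ≤ ∑ s ∈ Finset.range t, ENNReal.ofReal (1 / T ^ 3) := by
          refine Finset.sum_le_sum fun s _ => ?_
          exact (le_of_eq ((measurePreserving_draw I s).measure_preimage
            measurableSet_longDraws.nullMeasurableSet)).trans (roundLaw_longDraws_le hT)
      _ = ENNReal.ofReal (t * (1 / T ^ 3)) := by
          rw [Finset.sum_const, Finset.card_range, nsmul_eq_mul, ← ENNReal.ofReal_natCast,
            ← ENNReal.ofReal_mul (by positivity)]
      _ ≤ _ := by
          refine ENNReal.ofReal_le_ofReal ?_
          calc (t:ℝ) * (1 / T ^ 3) ≤ T * (1 / T ^ 3) := by gcongr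
            _ = (T:ℝ) ^ (-2 : ℝ) := by
                rw [Real.rpow_neg (by linarith), Real.rpow_two]; field_simp
            _ ≤ _ := Real.rpow_le_rpow_of_exponent_le hT' (by norm_num)
  have h3 : law I {ω : Sample d K | ‖ω.1‖ < normFloor I T} ≤ ENNReal.ofReal ((T:ℝ) ^ (-(2 / 3) : ℝ)) :=
    (law_norm_lt_normFloor_le hI hT hm).trans (ENNReal.ofReal_le_ofReal
      (Real.rpow_le_rpow_of_exponent_le hT' (by norm_num)))
  have h4 := law_noiseEnergy_ge_le (I := I) hT π t
  unfold ucbBad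
  calc _ ≤ ENNReal.ofReal (2 * (T:ℝ) ^ (-(2 / 3) : ℝ)) + ENNReal.ofReal ((T:ℝ) ^ (-(2 / 3) : ℝ))
          + ENNReal.ofReal ((T:ℝ) ^ (-(2 / 3) : ℝ)) + ENNReal.ofReal ((T:ℝ) ^ (-(2 / 3) : ℝ)) :=
        (measure_union_le _ _).trans (add_le_add ((measure_union_le _ _).trans
          (add_le_add ((measure_union_le _ _).trans (add_le_add h1 h4)) h2)) h3)
    _ = _ := by
        rw [← ENNReal.ofReal_add (by positivity) (by positivity),
          ← ENNReal.ofReal_add (by positivity) (by positivity),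
          ← ENNReal.ofReal_add (by positivity) (by positivity)]
        congr 1; ring

/-- The elliptic potential: `xᵀ V⁻¹ x` for the context vector chosen in round `t`. -/
noncomputable def potential (π : Policy d K) (t : ℕ) (ω : Sample d K) : ℝ :=
  (vecOf (ω.2 t) (action π ω t)).ofLp ⬝ᵥ (design (history π ω t))⁻¹ *ᵥ
    (vecOf (ω.2 t) (action π ω t)).ofLp

theorem potential_nonneg (π : Policy d K) (t : ℕ) (ω : Sample d K) : 0 ≤ potential π t ω :=
  inv_quad_nonneg (design_posDef _) _

theorem norm_history_le {π : Policy d K} {n : ℕ} {ω : Sample d K}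
    (h : ∀ s < n, ω.2 s ∉ longDraws I T) (i : Fin n) : ‖(history π ω n i).1‖ ≤ ucbNorm I T := by
  rw [history_apply]
  have := h i i.2
  simp only [longDraws, Set.mem_ofPred_eq, not_exists, not_lt] at this
  exact this _

theorem logDet_history_le (hd : 1 ≤ d) {π : Policy d K} {n : ℕ} {ω : Sample d K}
    (h : ∀ s < n, ω.2 s ∉ longDraws I T) :
    logDet (history π ω n) ≤ d * Real.log (1 + n * ucbNorm I T ^ 2) := by
  refine (logDet_le hd _).trans ?_
  gcongr
  calc ∑ i, ‖(history π ω n i).1‖ ^ 2 ≤ ∑ _i : Fin n, ucbNorm I T ^ 2 := by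
        gcongr with i
        exact norm_history_le h i
    _ = _ := by simp

theorem sum_potential_le_logDet {π : Policy d K} {n : ℕ} {ω : Sample d K}
    (h : ∀ s < n, ω.2 s ∉ longDraws I T) :
    ∑ t ∈ Finset.range n, potential π t ω ≤ (1 + ucbNorm I T ^ 2) * logDet (history π ω n) := by
  induction n with
  | zero =>
    simp only [Finset.range_zero, Finset.sum_empty]
    exact mul_nonneg (by positivity) (logDet_nonneg _)
  | succ n ih =>
    rw [Finset.sum_range_succ, history_succ, logDet_snoc, mul_add]
    refine add_le_add (ih fun s hs => h s (by omega)) ?_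
    have h0 := potential_nonneg π n ω
    have h1 : potential π n ω ≤ ucbNorm I T ^ 2 := by
      refine (inv_design_contract _ _).trans ?_
      rw [dotProduct_self_eq_norm_sq]
      have := h n (by omega)
      simp only [longDraws, Set.mem_ofPred_eq, not_exists, not_lt] at this
      have := this (action π ω n)
      gcongr
    change _ ≤ (1 + ucbNorm I T ^ 2) * Real.log (1 + potential π n ω)
    -- `p / (1 + p) ≤ log (1 + p)`, and `p` is bounded
    have h2 := Real.one_sub_inv_le_log_of_pos (show 0 < 1 + potential π n ω by linarith)
    calc potential π n ω = (1 + potential π n ω) * (1 - (1 + potential π n ω)⁻¹) := by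
          field_simp; ring
      _ ≤ (1 + ucbNorm I T ^ 2) * (1 - (1 + potential π n ω)⁻¹) := by
          gcongr
          rw [sub_nonneg]
          exact inv_le_one_of_one_le₀ (by linarith)
      _ ≤ _ := by gcongr

open Classical in
/-- The elliptic potential lemma. The sum stops at the first round with a long context. -/
theorem sum_potential_le (hd : 1 ≤ d) (π : Policy d K) (n : ℕ) (ω : Sample d K) :
    ∑ t ∈ Finset.range n, (if ∀ s < t + 1, ω.2 s ∉ longDraws I T then potential π t ω else 0)
      ≤ (1 + ucbNorm I T ^ 2) * (d * Real.log (1 + n * ucbNorm I T ^ 2)) := by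
  induction n with
  | zero => simp
  | succ n ih =>
    -- if the last term counts, then no round so far has a long context, and all terms count
    by_cases h : ∀ s < n + 1, ω.2 s ∉ longDraws I T
    · calc _ ≤ ∑ t ∈ Finset.range (n + 1), potential π t ω := by
            refine Finset.sum_le_sum fun t _ => ?_
            split_ifs
            · exact le_rfl
            · exact potential_nonneg _ _ _
        _ ≤ (1 + ucbNorm I T ^ 2) * logDet (history π ω (n + 1)) := sum_potential_le_logDet h
        _ ≤ _ := by
            gcongr
            exact logDet_history_le hd h
    · rw [Finset.sum_range_succ, if_neg h, add_zero]
      refine ih.trans ?_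
      gcongr
      norm_num

/-- Optimism: as long as the confidence intervals are valid, the regret is at most the width of
the confidence interval of the chosen action. -/
theorem roundRegret_ucb_sq_le (hT : 1 ≤ T) {π : Policy d K} {t : ℕ} {ω : Sample d K}
    (hmax : IsArgmax (fun x => inner ℝ x (ridge (history π ω t)) + ucbWidth I T t *
        Real.sqrt (x.ofLp ⬝ᵥ (1 + gram (history π ω t))⁻¹ *ᵥ x.ofLp))
      (contexts ω t) (action π ω t)) (hω : ω ∉ ucbBad I T π t) :
    roundRegret π t ω ^ 2 ≤ 4 * (ucbWidth I T t ^ 2 * potential π t ω) := by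
  have hd : (1:ℝ) ≤ d := by exact_mod_cast one_le_d I
  have hT' : (1:ℝ) ≤ T := by exact_mod_cast hT
  have hlogT := Real.log_nonneg hT'
  simp only [ucbBad, Set.mem_union, Set.mem_ofPred_eq, not_or, not_le, not_exists, not_and] at hω
  obtain ⟨⟨⟨h1, h2⟩, h3⟩, -⟩ := hω
  set h := history π ω t
  have hlog : logDet h ≤ d * Real.log (1 + (t + 1 : ℕ) * ucbNorm I T ^ 2) := by
    refine (logDet_history_le (one_le_d I) h3).trans ?_
    gcongr
    norm_num
  have hlog0 := logDet_nonneg h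
  set D := Real.log (1 + (t + 1 : ℕ) * ucbNorm I T ^ 2) with hD
  have hD0 : 0 ≤ D := by
    refine Real.log_nonneg ?_
    have : 0 ≤ (t + 1 : ℕ) * ucbNorm I T ^ 2 := by positivity
    linarith
  -- the confidence intervals of LinUCB are wide enough
  have hw : Real.sqrt (noiseEnergy ω.1 h) + ‖ω.1‖ ≤ ucbWidth I T t := by
    have e1 : ‖ω.1‖ ≤ ‖I.mean‖ + Real.sqrt (2 * d * Real.log T) := by
      have e2 : ‖ω.1 - I.mean‖ ≤ Real.sqrt (2 * d * Real.log T) := Real.le_sqrt_of_sq_le h1.le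
      have e3 : ‖ω.1‖ ≤ ‖ω.1 - I.mean‖ + ‖I.mean‖ := by
        simpa using norm_add_le (ω.1 - I.mean) I.mean
      linarith
    have e4 : Real.sqrt (noiseEnergy ω.1 h) ≤ Real.sqrt (d * D + 4 / 3 * (d * Real.log T)) := by
      refine Real.sqrt_le_sqrt (h2.le.trans ?_)
      have : Real.log T ≤ d * Real.log T := le_mul_of_one_le_left hlogT hd
      linarith
    -- `2 + 4 / 3 ≤ 3 + 1` and `2 * (4 / 3) ≤ 3 * 1`
    have e5 := sqrt_add_sqrt_le (a := 2 * d * Real.log T) (b := d * D + 4 / 3 * (d * Real.log T))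
      (c := 3 * d * Real.log T) (e := d * (Real.log T + D)) (by positivity) (by positivity)
      (by positivity) (by positivity) (by
        have : 0 ≤ d * Real.log T := by positivity
        linarith) (by
        have e6 : 0 ≤ (d:ℝ) ^ 2 * Real.log T * D := by positivity
        have e7 : 0 ≤ (d:ℝ) ^ 2 * Real.log T ^ 2 := by positivity
        nlinarith)
    rw [ucbWidth_eq hT]
    linarith
  obtain ⟨b, hb, hbe⟩ := exists_bestReward (θ := ω.1) hmax.avail
  have hle := hmax.le hb
  have hpa : potential π t ω = (ctxVec (contexts ω t) (action π ω t)).ofLp ⬝ᵥ (1 + gram h)⁻¹ *ᵥ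
    (ctxVec (contexts ω t) (action π ω t)).ofLp := by
    unfold potential design; rfl
  set xa := ctxVec (contexts ω t) (action π ω t) with hxa
  set xb := ctxVec (contexts ω t) b with hxb
  have ha1 := abs_inner_sub_ridge_le ω.1 xa h
  have hb1 := abs_inner_sub_ridge_le ω.1 xb h
  unfold design at ha1 hb1
  simp only at hle
  rw [← hpa] at ha1 hle
  set wb := Real.sqrt (xb.ofLp ⬝ᵥ (1 + gram h)⁻¹ *ᵥ xb.ofLp)
  have hreg : roundRegret π t ω = inner ℝ xb ω.1 - inner ℝ xa ω.1 := by
    have : roundRegret π t ω = bestReward ω.1 (contexts ω t) - inner ℝ ω.1 xa := rfl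
    rw [this, hbe, real_inner_comm, real_inner_comm xa]
  have h0 : 0 ≤ roundRegret π t ω := roundRegret_nonneg hmax.avail
  have hwa := Real.sqrt_nonneg (potential π t ω)
  have hwb : 0 ≤ wb := Real.sqrt_nonneg _
  have e1 := (abs_le.1 hb1).1
  have e2 := (abs_le.1 ha1).2
  have e3 : (Real.sqrt (noiseEnergy ω.1 h) + ‖ω.1‖) * wb ≤ ucbWidth I T t * wb := by gcongr
  have e4 : (Real.sqrt (noiseEnergy ω.1 h) + ‖ω.1‖) * Real.sqrt (potential π t ω)
    ≤ ucbWidth I T t * Real.sqrt (potential π t ω) := by gcongr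
  have e5 : roundRegret π t ω ≤ 2 * (ucbWidth I T t * Real.sqrt (potential π t ω)) := by
    rw [hreg]; linarith
  calc roundRegret π t ω ^ 2 ≤ (2 * (ucbWidth I T t * Real.sqrt (potential π t ω))) ^ 2 := by gcongr
    _ = _ := by rw [mul_pow, mul_pow, Real.sq_sqrt (potential_nonneg _ _ _)]; ring

theorem sum_roundRegret_ucb_sq_le (hm : 1 ≤ ‖I.mean‖) (hT : 1 ≤ T) {π : Policy d K}
    {ω : Sample d K}
    (hmax : ∀ t < T, IsArgmax (fun x => inner ℝ x (ridge (history π ω t)) + ucbWidth I T t *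
        Real.sqrt (x.ofLp ⬝ᵥ (1 + gram (history π ω t))⁻¹ *ᵥ x.ofLp))
      (contexts ω t) (action π ω t)) :
    ∑ t ∈ Finset.range T, {ω : Sample d K | ω ∉ ucbBad I T π t ∧ ω.2 t ∉ longDraws I T}.indicator
        (fun ω => roundRegret π t ω ^ 2) ω
      ≤ 18000 * (‖I.mean‖ ^ 2 * d ^ 2 * logFactor d K T ^ 3) := by
  classical
  have hd : (1:ℝ) ≤ d := by exact_mod_cast one_le_d I
  have hl := one_le_logFactor I hT
  obtain ⟨hL1, hL2⟩ := ucbNorm_sq_le (I := I) hT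
  obtain ⟨h1, h2⟩ := log_ucb_le (I := I) hT (le_refl T)
  calc _ ≤ ∑ t ∈ Finset.range T, 240 * (‖I.mean‖ ^ 2 * d * logFactor d K T)
          * (if ∀ s < t + 1, ω.2 s ∉ longDraws I T then potential π t ω else 0) := by
        refine Finset.sum_le_sum fun t ht => ?_
        have ht' := Finset.mem_range.1 ht
        by_cases hω : ω ∉ ucbBad I T π t ∧ ω.2 t ∉ longDraws I T
        · rw [Set.indicator_of_mem (show ω ∈ {ω : Sample d K | ω ∉ ucbBad I T π t ∧ ω.2 t ∉ longDraws I T} from hω),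
            if_pos]
          · refine (roundRegret_ucb_sq_le hT (hmax t ht') hω.1).trans ?_
            have := (ucbWidth_sq_le hm hT ht').2
            have := potential_nonneg π t ω
            nlinarith
          · intro s hs hmem
            rcases Nat.lt_succ_iff_lt_or_eq.1 hs with h | rfl
            · exact hω.1 (Or.inl (Or.inr ⟨s, h, hmem⟩))
            · exact hω.2 hmem
        · rw [Set.indicator_of_notMem (show ω ∉ {ω : Sample d K |
            ω ∉ ucbBad I T π t ∧ ω.2 t ∉ longDraws I T} from hω)]
          refine mul_nonneg (by positivity) ?_
          split_ifs
          · exact potential_nonneg _ _ _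
          · exact le_rfl
    _ ≤ 240 * (‖I.mean‖ ^ 2 * d * logFactor d K T)
          * ((1 + ucbNorm I T ^ 2) * (d * Real.log (1 + T * ucbNorm I T ^ 2))) := by
        rw [← Finset.mul_sum]
        gcongr
        exact sum_potential_le (one_le_d I) π T ω
    _ ≤ 240 * (‖I.mean‖ ^ 2 * d * logFactor d K T)
          * ((15 * logFactor d K T) * (d * (5 * logFactor d K T))) := by
        gcongr
        linarith
    _ = _ := by ring

/-- The exceptional events have total probability of order `T ^ (1 / 3)`, so they cost no more
than the main term. -/
theorem bayesRegretLE_linUCB (hI : EigLeOne I) (hT : 1 ≤ T)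
    (hm : 1 + Real.sqrt (3 * Real.log T) ≤ ‖I.mean‖) {π : Policy d K}
    (hπ : IsLinUCB I T (‖I.mean‖ + Real.sqrt (3 * d * Real.log T)) (ucbNorm I T) 1 π) :
    BayesRegretLE I π T (26000 * logFactor d K T ^ 3 * ‖I.mean‖ *
      ((d : ℝ) ^ 2 * (K : ℝ) ^ (2 / 3 : ℝ) / I.rho ^ 2 * (T : ℝ) ^ (1 / 3 : ℝ))) := by
  have hm1 : 1 ≤ ‖I.mean‖ := by linarith [Real.sqrt_nonneg (3 * Real.log T)]
  have hT' : (1:ℝ) ≤ T := by exact_mod_cast hT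
  have hK : (1:ℝ) ≤ K := by exact_mod_cast one_le_K I
  have hd : (1:ℝ) ≤ d := by exact_mod_cast one_le_d I
  have hl := one_le_logFactor I hT
  have hav : ChoosesAvailable I T π := fun t ht => (hπ t ht).mono fun ω h => h.avail
  have hD2 : roundLaw I (longDraws I T) ≤ ENNReal.ofReal (1 / T ^ 2) := by
    refine (roundLaw_longDraws_le hT).trans (ENNReal.ofReal_le_ofReal ?_)
    gcongr
    norm_num
  have h := bayesRegretLE_of_sq hI hm1 hT hav 0 (ucbBad I T π)
    (fun t _ _ => measurableSet_ucbBad π t) (fun t _ _ => setDraw_mem_ucbBad π t)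
    (fun t _ _ ω hω => Or.inr hω) measurableSet_longDraws hD2
    (p := 5 * (T:ℝ) ^ (1 / 3 : ℝ)) (S := 18000 * (‖I.mean‖ ^ 2 * d ^ 2 * logFactor d K T ^ 3))
    (by positivity) (by positivity)
    (by
      rw [← Finset.range_eq_Ico]
      calc _ ≤ ∑ t ∈ Finset.range T, ENNReal.ofReal (5 * (T:ℝ) ^ (-(2 / 3) : ℝ)) :=
            Finset.sum_le_sum fun t ht => law_ucbBad_le hI hT hm π (Finset.mem_range.1 ht)
        _ = _ := by
            rw [Finset.sum_const, Finset.card_range, nsmul_eq_mul, ← ENNReal.ofReal_natCast,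
              ← ENNReal.ofReal_mul (by positivity)]
            congr 1
            have : (T:ℝ) * (T:ℝ) ^ (-(2 / 3) : ℝ) = (T:ℝ) ^ (1 / 3 : ℝ) := by
              nth_rw 1 [← Real.rpow_one (T:ℝ)]
              rw [← Real.rpow_add (by linarith)]; norm_num
            rw [mul_left_comm, this])
    (by
      rw [← Finset.range_eq_Ico, ← lintegral_finsetSum]
      · calc _ ≤ ∫⁻ _, ENNReal.ofReal (18000 * (‖I.mean‖ ^ 2 * d ^ 2 * logFactor d K T ^ 3)) ∂law I := by
              refine lintegral_mono_ae ?_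
              have hall : ∀ᵐ ω ∂law I, ∀ t ∈ Finset.range T, _ :=
                (Filter.eventually_all_finset _).2 fun t ht => hπ t (Finset.mem_range.1 ht)
              filter_upwards [hall] with ω hω
              refine le_trans (le_of_eq ?_) (ENNReal.ofReal_le_ofReal
                (sum_roundRegret_ucb_sq_le hm1 hT (π := π) (ω := ω)
                  fun t ht => hω t (Finset.mem_range.2 ht)))
              rw [ENNReal.ofReal_sum_of_nonneg]
              · refine Finset.sum_congr rfl fun t _ => ?_
                by_cases hG : ω ∈ {ω : Sample d K | ω ∉ ucbBad I T π t ∧ ω.2 t ∉ longDraws I T}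
                · rw [Set.indicator_of_mem hG, Set.indicator_of_mem hG]
                · rw [Set.indicator_of_notMem hG, Set.indicator_of_notMem hG, ENNReal.ofReal_zero]
              · exact fun t _ => Set.indicator_nonneg (fun _ _ => sq_nonneg _) _
          _ = _ := by simp
      · intro t _
        refine Measurable.indicator (by fun_prop) ?_
        have h1 : MeasurableSet {ω : Sample d K | ω.2 t ∈ longDraws I T} :=
          ((measurable_pi_apply t).comp measurable_snd) measurableSet_longDraws
        exact (measurableSet_ucbBad π t).compl.inter h1.compl)
  refine ⟨h.1, h.2.trans ?_⟩
  have hρ := I.rho_pos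
  have hρ1 := rho_le_one I
  set X := (K : ℝ) ^ (2 / 3 : ℝ) * (T : ℝ) ^ (1 / 3 : ℝ) with hX
  have hT3 : 1 ≤ (T : ℝ) ^ (1 / 3 : ℝ) := Real.one_le_rpow hT' (by norm_num)
  have hK3 : 1 ≤ (K : ℝ) ^ (2 / 3 : ℝ) := Real.one_le_rpow hK (by norm_num)
  have hX1 : (T : ℝ) ^ (1 / 3 : ℝ) ≤ X := by rw [hX]; nlinarith
  set Q := logFactor d K T ^ 3 * ‖I.mean‖ * (d ^ 2 / I.rho ^ 2) * X with hQ
  have hdr : (d:ℝ) ≤ d ^ 2 / I.rho ^ 2 := by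
    rw [le_div_iff₀ (by positivity)]
    have : I.rho ^ 2 ≤ 1 := pow_le_one₀ hρ.le hρ1
    nlinarith
  have hdr2 : (d:ℝ) ^ 2 ≤ d ^ 2 / I.rho ^ 2 := by
    rw [le_div_iff₀ (by positivity)]
    have : I.rho ^ 2 ≤ 1 := pow_le_one₀ hρ.le hρ1
    nlinarith
  have hdr3 : 1 / I.rho ≤ d ^ 2 / I.rho ^ 2 := by
    rw [div_le_div_iff₀ (by positivity) (by positivity)]
    have : I.rho ^ 2 ≤ I.rho := by nlinarith
    nlinarith [one_le_pow₀ (n := 2) hd]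
  have a1 : 1000 * (‖I.mean‖ * d * logFactor d K T ^ 3) * (5 * (T:ℝ) ^ (1 / 3 : ℝ) + 2) ≤ 7000 * Q := by
    calc _ ≤ 1000 * (‖I.mean‖ * (d ^ 2 / I.rho ^ 2) * logFactor d K T ^ 3) * (5 * X + 2 * X) := by
          gcongr; linarith
      _ = _ := by rw [hQ]; ring
  have a2 : X * (18000 * (‖I.mean‖ ^ 2 * d ^ 2 * logFactor d K T ^ 3) / ‖I.mean‖) ≤ 18000 * Q := by
    calc _ = 18000 * (logFactor d K T ^ 3 * ‖I.mean‖ * d ^ 2 * X) := by field_simp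
      _ ≤ _ := by rw [hQ]; gcongr
  have a3 : X * (3 * logFactor d K T * ‖I.mean‖ / I.rho) ≤ 3 * Q := by
    calc _ = 3 * (logFactor d K T * ‖I.mean‖ * (1 / I.rho) * X) := by ring
      _ ≤ 3 * (logFactor d K T ^ 3 * ‖I.mean‖ * (d ^ 2 / I.rho ^ 2) * X) := by
          gcongr
          exact le_self_pow₀ hl (by norm_num)
  have hQ0 : 0 ≤ Q := by positivity
  calc _ = 1000 * (‖I.mean‖ * d * logFactor d K T ^ 3) * (5 * (T:ℝ) ^ (1 / 3 : ℝ) + 2)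
        + X * (18000 * (‖I.mean‖ ^ 2 * d ^ 2 * logFactor d K T ^ 3) / ‖I.mean‖)
        + X * (3 * logFactor d K T * ‖I.mean‖ / I.rho) := by push_cast; ring
    _ ≤ 26000 * Q := by linarith
    _ = _ := by rw [hQ, hX]; ring

end LinBandit
end

section
namespace LinBandit
open scoped ENNReal NNReal

variable {d K T : ℕ} {I : ProblemInstance d K}

/-! ### Growth of the design matrix under greedy choices -/

theorem batchStart_le (Y t : ℕ) : batchStart Y t ≤ t := Nat.mul_div_le t Y

theorem lt_batchStart_add {Y : ℕ} (hY : 1 ≤ Y) (t : ℕ) : t < batchStart Y t + Y := by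
  have h1 := Nat.div_add_mod t Y
  have h2 := Nat.mod_lt t hY
  unfold batchStart
  omega

theorem le_batchStart {Y t : ℕ} (hY : 1 ≤ Y) (h : Y ≤ t) : Y ≤ batchStart Y t :=
  Nat.le_mul_of_pos_right Y (Nat.div_pos h hY)

theorem comap_history_mono (π : Policy d K) {k n : ℕ} (h : k ≤ n) :
    MeasurableSpace.comap (fun ω : Sample d K => history π ω k) inferInstance
      ≤ MeasurableSpace.comap (fun ω : Sample d K => history π ω n) inferInstance := by
  have he : (fun ω : Sample d K => history π ω k)
      = (fun f : History d n => fun i : Fin k => f (Fin.castLE h i)) ∘ fun ω => history π ω n := by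
    funext ω i
    simp only [Function.comp_apply, history_apply, Fin.val_castLE]
  rw [he, ← MeasurableSpace.comap_comp]
  refine MeasurableSpace.comap_mono ?_
  have hm : Measurable fun f : History d n => fun i : Fin k => f (Fin.castLE h i) := by fun_prop
  exact hm.comap_le

/-- The event that none of the estimates used by a batched algorithm after the first batch and
before time `t` is degenerate; `N n` is the set of histories of length `n` with a degenerate
estimate. -/
def regularSet (N : (n : ℕ) → Set (History d n)) (π : Policy d K) (Y t : ℕ) : Set (Sample d K) :=
  {ω | ∀ s < t, Y ≤ s → history π ω (batchStart Y s) ∉ N (batchStart Y s)}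

variable {N : (n : ℕ) → Set (History d n)}

theorem measurableSet_regularSet (hN : ∀ n, MeasurableSet (N n)) (π : Policy d K) (Y : ℕ) {t n : ℕ}
    (h : t ≤ n) :
    MeasurableSet[MeasurableSpace.comap (fun ω : Sample d K => history π ω n) inferInstance]
      (regularSet N π Y t) := by
  have he : regularSet N π Y t = ⋂ s, ⋂ (_ : s < t), ⋂ (_ : Y ≤ s),
      (fun ω : Sample d K => history π ω (batchStart Y s)) ⁻¹' (N (batchStart Y s))ᶜ := by
    ext ω; simp [regularSet]
  rw [he]
  refine MeasurableSet.iInter fun s => MeasurableSet.iInter fun hs => MeasurableSet.iInter fun _ => ?_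
  exact comap_history_mono π ((batchStart_le Y s).trans (hs.le.trans h)) _ ⟨_, (hN _).compl, rfl⟩

theorem comap_history_le (π : Policy d K) (n : ℕ) :
    MeasurableSpace.comap (fun ω : Sample d K => history π ω n) inferInstance
      ≤ (inferInstance : MeasurableSpace (Sample d K)) :=
  (measurable_history π n).comap_le

theorem setDraw_mem_regularSet (π : Policy d K) (Y : ℕ) {t n : ℕ} (h : t ≤ n + 1) (ω : Sample d K)
    (z : RoundDraw d K) : setDraw n (ω, z) ∈ regularSet N π Y t ↔ ω ∈ regularSet N π Y t := by
  refine forall_congr' fun s => forall_congr' fun hs => forall_congr' fun _ => ?_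
  rw [history_setDraw π ((batchStart_le Y s).trans (by omega))]

/-- The action in every round maximizes the reward predicted by the estimate `e` computed from the
history before the current batch. -/
def IsBatchGreedy (I : ProblemInstance d K) (T Y : ℕ) (π : Policy d K)
    (e : (n : ℕ) → History d n → Vec d) : Prop :=
  ∀ t < T, ∀ᵐ ω ∂law I, IsArgmax (fun x => inner ℝ x (e _ (history π ω (batchStart Y t))))
    (contexts ω t) (action π ω t)

variable {e : (n : ℕ) → History d n → Vec d} {π : Policy d K} {Y : ℕ}

/-- Integrated form of `lintegral_spread_snoc_le`. In a round whose estimate is `0`, every action is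
greedy and the choice may be uninformative, hence the restriction to `regularSet`. -/
theorem lintegral_spread_succ_le (hN : ∀ n, MeasurableSet (N n)) (hNe : ∀ n, ∀ h ∉ N n, e n h ≠ 0)
    (hπ : IsBatchGreedy I T Y π e) {t : ℕ} (ht : t < T) (hYt : Y ≤ t) :
    ∫⁻ ω, (regularSet N π Y (t + 1)).indicator
        (fun ω => ENNReal.ofReal (spread (history π ω (t + 1)))) ω ∂law I
      ≤ ∫⁻ ω, (regularSet N π Y (t + 1)).indicator
        (fun ω => ENNReal.ofReal (spread (history π ω t) - rate I / d * spread (history π ω t) ^ 2)) ω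
          ∂law I := by
  have hG : MeasurableSet (regularSet N π Y (t + 1)) :=
    comap_history_le π (t + 1) _ (measurableSet_regularSet hN π Y le_rfl)
  rw [lintegral_setDraw I t (Measurable.indicator (by fun_prop) hG)]
  refine lintegral_mono_ae ?_
  filter_upwards [ae_setDraw I t (hπ t ht)] with ω hω
  by_cases h : ω ∈ regularSet N π Y (t + 1)
  · have h' : ∀ z, setDraw t (ω, z) ∈ regularSet N π Y (t + 1) := fun z =>
      (setDraw_mem_regularSet π Y le_rfl ω z).2 h
    rw [Set.indicator_of_mem h]
    simp_rw [fun z => Set.indicator_of_mem (h' z)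
      (fun ω => ENNReal.ofReal (spread (history π ω (t + 1))))]
    -- the estimate used in round `t` is known before the round and is not degenerate
    have hv := hNe _ _ (h t (by omega) hYt)
    have hα : Measurable (π.act t (history π ω t)) :=
      (π.measurable_act t).comp (measurable_const.prodMk measurable_id)
    refine le_trans (le_of_eq ?_) (lintegral_spread_snoc_le I hv hα ?_ (history π ω t)
      (fun z => inner ℝ ω.1 (vecOf z (π.act t (history π ω t) (ctxOf z)))
        + z.2.2 (π.act t (history π ω t) (ctxOf z))))
    · refine lintegral_congr fun z => ?_
      rw [history_succ, action_setDraw, setDraw_same, history_setDraw π le_rfl]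
      rfl
    · filter_upwards [hω] with z hz
      rw [history_setDraw π (batchStart_le Y t), action_setDraw, contexts_eq, setDraw_same] at hz
      exact hz
  · rw [Set.indicator_of_notMem h]
    simp_rw [fun z => Set.indicator_of_notMem
      (fun h' => h ((setDraw_mem_regularSet π Y le_rfl ω z).1 h'))
      (fun ω => ENNReal.ofReal (spread (history π ω (t + 1))))]
    simp

/-- The trace of the inverse design matrix decays like the inverse of the number of rounds, since
`x ↦ x - c x ^ 2` with `c = rate I / d` maps `1 / (c n)` to about `1 / (c (n + 1))`. -/
theorem lintegral_spread_le (hN : ∀ n, MeasurableSet (N n)) (hNe : ∀ n, ∀ h ∉ N n, e n h ≠ 0)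
    (hπ : IsBatchGreedy I T Y π e) (j : ℕ) (hj : Y + j ≤ T) :
    ∫⁻ ω, (regularSet N π Y (Y + j)).indicator
        (fun ω => ENNReal.ofReal (spread (history π ω (Y + j)))) ω ∂law I
      ≤ ENNReal.ofReal (d / (rate I * (j + 4))) := by
  have hr := rate_pos I
  have hd : (1:ℝ) ≤ d := by exact_mod_cast one_le_d I
  induction j with
  | zero =>
    calc _ ≤ ∫⁻ _, ENNReal.ofReal (d / (rate I * ((0:ℕ) + 4))) ∂law I := by
          refine lintegral_mono fun ω => (Set.indicator_le_self _ _ _).trans (ENNReal.ofReal_le_ofReal ?_)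
          refine (spread_le _).trans ?_
          rw [le_div_iff₀ (by positivity)]
          have := rate_le I
          push_cast
          nlinarith
      _ = _ := by simp
  | succ j ih =>
    have ih := ih (by omega)
    set m : ℝ := j + 4 with hm
    have hm4 : 4 ≤ m := by have := Nat.cast_nonneg (α := ℝ) j; linarith
    have hG : MeasurableSet (regularSet N π Y (Y + j)) :=
      comap_history_le π (Y + j) _ (measurableSet_regularSet hN π Y le_rfl)
    have hm2 : 0 ≤ 1 - 2 / m := by
      rw [sub_nonneg, div_le_one (by linarith)]; linarith
    calc _ ≤ _ := lintegral_spread_succ_le hN hNe hπ (t := Y + j) (by omega) (by omega)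
      _ ≤ ∫⁻ ω, (ENNReal.ofReal (1 - 2 / m) * (regularSet N π Y (Y + j)).indicator
            (fun ω => ENNReal.ofReal (spread (history π ω (Y + j)))) ω
            + ENNReal.ofReal (d / (rate I * m ^ 2))) ∂law I := by
          refine lintegral_mono fun ω => ?_
          by_cases h : ω ∈ regularSet N π Y (Y + j + 1)
          · have h' : ω ∈ regularSet N π Y (Y + j) := fun s hs => h s (by omega)
            rw [Set.indicator_of_mem h, Set.indicator_of_mem h', ← ENNReal.ofReal_mul hm2,
              ← ENNReal.ofReal_add (mul_nonneg hm2 (spread_nonneg _)) (by positivity)]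
            refine ENNReal.ofReal_le_ofReal ?_
            -- the concave function `x ↦ x - (rate I / d) * x ^ 2` lies below its tangent at
            -- `d / (rate I * m)`; unlike the function, the tangent can be integrated
            set x := spread (history π ω (Y + j))
            have h1 : 0 ≤ rate I / d * (x - d / (rate I * m)) ^ 2 := by positivity
            have h2 : rate I / d * (x - d / (rate I * m)) ^ 2
                = rate I / d * x ^ 2 - 2 / m * x + d / (rate I * m ^ 2) := by
              field_simp
              ring
            linarith
          · rw [Set.indicator_of_notMem h]; exact zero_le
      _ ≤ ENNReal.ofReal (1 - 2 / m) * ENNReal.ofReal (d / (rate I * m))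
            + ENNReal.ofReal (d / (rate I * m ^ 2)) := by
          rw [lintegral_add_right _ measurable_const, lintegral_const_mul _
            (Measurable.indicator (by fun_prop) hG), lintegral_const, measure_univ, mul_one]
          gcongr
      _ ≤ _ := by
          rw [← ENNReal.ofReal_mul hm2, ← ENNReal.ofReal_add (by positivity) (by positivity)]
          refine ENNReal.ofReal_le_ofReal ?_
          have h1 : (1 - 2 / m) * (d / (rate I * m)) + d / (rate I * m ^ 2)
              = d / rate I * ((m - 1) / m ^ 2) := by
            field_simp; ring
          have h2 : (d:ℝ) / (rate I * ((j + 1 : ℕ) + 4)) = d / rate I * (1 / (m + 1)) := by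
            rw [hm]; push_cast; field_simp; ring_nf
          rw [h1, h2]
          refine mul_le_mul_of_nonneg_left ?_ (by positivity)
          rw [div_le_div_iff₀ (by positivity) (by positivity)]
          nlinarith

theorem lintegral_sum_norm_sq_le (hT : 1 ≤ T) (π : Policy d K) (n : ℕ) :
    ∫⁻ ω, ENNReal.ofReal (∑ i, ‖(history π ω n i).1‖ ^ 2) ∂law I
      ≤ ENNReal.ofReal (n * (34 * logFactor d K T ^ 2)) := by
  have hl := one_le_logFactor I hT
  calc _ = ∑ i : Fin n, ∫⁻ ω, ENNReal.ofReal (‖(history π ω n i).1‖ ^ 2) ∂law I := by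
        rw [← lintegral_finsetSum]
        · refine lintegral_congr fun ω => ?_
          rw [ENNReal.ofReal_sum_of_nonneg fun i _ => by positivity]
        · intro i _
          have : Measurable fun ω : Sample d K => history π ω n i :=
            (measurable_pi_apply i).comp (measurable_history π n)
          fun_prop
    _ ≤ ∑ i : Fin n, ENNReal.ofReal (34 * logFactor d K T ^ 2) := by
        refine Finset.sum_le_sum fun i _ => ?_
        calc _ ≤ ∫⁻ ω, ENNReal.ofReal (radius I (ω.2 i) ^ 2) ∂law I := by
              refine lintegral_mono_ae ?_
              filter_upwards [ae_draw I i (ae_norm_vecOf_le I)] with ω hω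
              rw [history_apply]
              have := hω (action π ω i)
              gcongr
          _ = ∫⁻ z, ENNReal.ofReal (radius I z ^ 2) ∂roundLaw I :=
              (measurePreserving_draw I i).lintegral_comp
                (f := fun z => ENNReal.ofReal (radius I z ^ 2)) (by fun_prop)
          _ ≤ _ := by
              refine (lintegral_radius_sq_le I).trans (ENNReal.ofReal_le_ofReal ?_)
              have := one_le_lkd I
              have := log_KD_le_logFactor I hT
              gcongr
    _ = _ := by
        rw [Finset.sum_const, Finset.card_univ, Fintype.card_fin, nsmul_eq_mul,
          ← ENNReal.ofReal_natCast, ← ENNReal.ofReal_mul (by positivity)]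

/-- The noise energy is of order `d` up to logarithmic factors, also after weighting with
`spread`. -/
theorem lintegral_spread_mul_energy_le (hI : EigLeOne I) (hm : 1 ≤ ‖I.mean‖) (hT : 1 ≤ T)
    (π : Policy d K) {n : ℕ} (hn : n ≤ T) {G : Set (Sample d K)} (hG : MeasurableSet G)
    (hGs : ∀ ω ∈ G, spread (history π ω n) ≤ 1) :
    ∫⁻ ω, G.indicator (fun ω => ENNReal.ofReal (spread (history π ω n)
        * (noiseEnergy ω.1 (history π ω n) + ‖ω.1‖ ^ 2))) ω ∂law I
      ≤ ENNReal.ofReal (22 * (‖I.mean‖ ^ 2 * d * logFactor d K T))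
          * ∫⁻ ω, G.indicator (fun ω => ENNReal.ofReal (spread (history π ω n))) ω ∂law I
        + ENNReal.ofReal (45 * (d * logFactor d K T ^ 2) * (1 / T)) := by
  have hl := one_le_logFactor I hT
  obtain ⟨hl1, hl2, hl3, hl4⟩ := log_le_logFactor I hT
  have hd : (1:ℝ) ≤ d := by exact_mod_cast one_le_d I
  have hT' : (1:ℝ) ≤ T := by exact_mod_cast hT
  have hn' : (n:ℝ) ≤ T := by exact_mod_cast hn
  set A : ℝ := 22 * (‖I.mean‖ ^ 2 * d * logFactor d K T) with hA
  have hA0 : 0 ≤ A := by positivity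
  -- `E1` and `E3` have expectation at most `1` and `E2` of order `T`; the noise energy and
  -- `‖θ‖ ^ 2` exceed the bound `A` by small multiples of these only
  set E1 : Sample d K → ℝ := fun ω => expMart ω.1 (history π ω n) with hE1
  set E2 : Sample d K → ℝ := fun ω => ∑ i, ‖(history π ω n i).1‖ ^ 2 with hE2
  set E3 : Sample d K → ℝ := fun ω => Real.exp (‖ω.1 - I.mean‖ ^ 2 / 4 - d) with hE3
  have hE10 : ∀ ω, 0 ≤ E1 ω := fun ω => by
    simp only [hE1, expMart]; exact (Real.exp_pos _).le
  have hE20 : ∀ ω, 0 ≤ E2 ω := fun ω => Finset.sum_nonneg fun i _ => sq_nonneg _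
  have hE30 : ∀ ω, 0 ≤ E3 ω := fun ω => (Real.exp_pos _).le
  have hE2m : Measurable E2 := by
    refine Finset.measurable_fun_sum _ fun i _ => ?_
    have : Measurable fun ω : Sample d K => history π ω n i :=
      (measurable_pi_apply i).comp (measurable_history π n)
    fun_prop
  have hE1m : Measurable E1 := measurable_expMart measurable_fst (measurable_history π n)
  have hE3m : Measurable E3 := by fun_prop
  have hE1' : ∀ ω, noiseEnergy ω.1 (history π ω n) / 2 - logDet (history π ω n) / 2
      ≤ Real.log T + (T:ℝ)⁻¹ * E1 ω := fun ω => by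
    have h1 := le_log_inv_add_mul_exp (p := (T:ℝ)⁻¹) (by positivity)
      (noiseEnergy ω.1 (history π ω n) / 2 - logDet (history π ω n) / 2)
    rwa [inv_inv] at h1
  have hE2' : ∀ ω, logDet (history π ω n) ≤ d * Real.log (1 + E2 ω) := fun ω =>
    logDet_le (one_le_d I) _
  have hE3' : ∀ ω : Sample d K, ‖ω.1 - I.mean‖ ^ 2
      ≤ 4 * (d + Real.log T) + 4 * (T:ℝ)⁻¹ * E3 ω := fun ω => by
    have h4 := norm_sq_le_log_inv_add (I := I) (p := (T:ℝ)⁻¹) (by positivity) ω.1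
    rwa [inv_inv] at h4
  have i1 : ∫⁻ ω, ENNReal.ofReal (E1 ω) ∂law I ≤ 1 := lintegral_expMart_le π I n
  have i3 : ∫⁻ ω, ENNReal.ofReal (E3 ω) ∂law I ≤ 1 := by
    rw [(measurePreserving_latent I).lintegral_comp
      (f := fun θ => ENNReal.ofReal (Real.exp (‖θ - I.mean‖ ^ 2 / 4 - d))) (by fun_prop)]
    exact lintegral_exp_sq_sub_dim_le hI
  have i2 : ∫⁻ ω, ENNReal.ofReal (1 + E2 ω) ∂law I
      ≤ ENNReal.ofReal (T * (35 * logFactor d K T ^ 2)) := by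
    calc _ = ∫⁻ ω, (ENNReal.ofReal 1 + ENNReal.ofReal (E2 ω)) ∂law I :=
          lintegral_congr fun ω => ENNReal.ofReal_add (by norm_num) (hE20 ω)
      _ ≤ ENNReal.ofReal 1 + ENNReal.ofReal (n * (34 * logFactor d K T ^ 2)) := by
          rw [lintegral_add_left (by fun_prop), lintegral_const, measure_univ, mul_one]
          gcongr
          exact lintegral_sum_norm_sq_le hT π n
      _ ≤ _ := by
          rw [← ENNReal.ofReal_add (by norm_num) (by positivity)]
          refine ENNReal.ofReal_le_ofReal ?_
          have h1 : 1 ≤ logFactor d K T ^ 2 := one_le_pow₀ hl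
          have h2 : 1 ≤ T * logFactor d K T ^ 2 := by nlinarith
          have h3 : n * (34 * logFactor d K T ^ 2) ≤ T * (34 * logFactor d K T ^ 2) := by gcongr
          nlinarith
  clear_value E1 E2 E3
  have hpt : ∀ ω, G.indicator (fun ω => ENNReal.ofReal (spread (history π ω n)
        * (noiseEnergy ω.1 (history π ω n) + ‖ω.1‖ ^ 2))) ω
      ≤ ENNReal.ofReal A * G.indicator (fun ω => ENNReal.ofReal (spread (history π ω n))) ω
        + (ENNReal.ofReal (2 / T) * ENNReal.ofReal (E1 ω)
        + (ENNReal.ofReal (d / T ^ 2) * ENNReal.ofReal (1 + E2 ω)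
        + ENNReal.ofReal (8 / T) * ENNReal.ofReal (E3 ω))) := by
    intro ω
    by_cases h : ω ∈ G
    · have hs0 := spread_nonneg (history π ω n)
      have hs1 := hGs ω h
      have := hE10 ω
      have := hE20 ω
      have := hE30 ω
      rw [Set.indicator_of_mem h, Set.indicator_of_mem h, ← ENNReal.ofReal_mul hA0,
        ← ENNReal.ofReal_mul (by positivity), ← ENNReal.ofReal_mul (by positivity),
        ← ENNReal.ofReal_mul (by positivity), ← ENNReal.ofReal_add (by positivity) (by positivity),
        ← ENNReal.ofReal_add (by positivity) (by positivity),
        ← ENNReal.ofReal_add (by positivity) (by positivity)]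
      refine ENNReal.ofReal_le_ofReal ?_
      have h1 := hE1' ω
      have h2 : logDet (history π ω n) ≤ d * (2 * Real.log T + (1 + E2 ω) / T ^ 2) := by
        refine (hE2' ω).trans (mul_le_mul_of_nonneg_left ?_ (by positivity))
        -- the logarithm is compared with its tangent at `T ^ 2`
        have h3 := Real.log_le_sub_one_of_pos (show 0 < (1 + E2 ω) / (T:ℝ) ^ 2 by positivity)
        rw [Real.log_div (by positivity) (by positivity), Real.log_pow] at h3
        push_cast at h3
        linarith
      have h4 := hE3' ω
      have h5 : ‖ω.1‖ ^ 2 ≤ 2 * ‖I.mean‖ ^ 2 + 2 * ‖ω.1 - I.mean‖ ^ 2 := by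
        have h6 : ‖ω.1‖ ≤ ‖ω.1 - I.mean‖ + ‖I.mean‖ := by
          simpa using norm_add_le (ω.1 - I.mean) I.mean
        calc ‖ω.1‖ ^ 2 ≤ (‖ω.1 - I.mean‖ + ‖I.mean‖) ^ 2 := by gcongr
          _ ≤ _ := by nlinarith [sq_nonneg (‖ω.1 - I.mean‖ - ‖I.mean‖)]
      have h7 : 2 * (d * Real.log T) + 2 * Real.log T + 2 * ‖I.mean‖ ^ 2 + 8 * (d + Real.log T) ≤ A := by
        have hm2 : 1 ≤ ‖I.mean‖ ^ 2 := one_le_pow₀ hm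
        have hlT : Real.log T ≤ logFactor d K T := by linarith
        have a1 : d * Real.log T ≤ ‖I.mean‖ ^ 2 * d * logFactor d K T := by
          calc d * Real.log T = 1 * d * Real.log T := by ring
            _ ≤ _ := by gcongr
        have a2 : Real.log T ≤ ‖I.mean‖ ^ 2 * d * logFactor d K T := by
          calc Real.log T = 1 * 1 * Real.log T := by ring
            _ ≤ _ := by gcongr
        have a3 : ‖I.mean‖ ^ 2 ≤ ‖I.mean‖ ^ 2 * d * logFactor d K T := by
          calc ‖I.mean‖ ^ 2 = ‖I.mean‖ ^ 2 * 1 * 1 := by ring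
            _ ≤ _ := by gcongr
        have a4 : d ≤ ‖I.mean‖ ^ 2 * d * logFactor d K T := by
          calc (d:ℝ) = 1 * d * 1 := by ring
            _ ≤ _ := by gcongr
        rw [hA]; linarith
      set R : ℝ := 2 / T * E1 ω + (d / T ^ 2 * (1 + E2 ω) + 8 / T * E3 ω) with hR
      have hR0 : 0 ≤ R := by positivity
      have h8 : noiseEnergy ω.1 (history π ω n) + ‖ω.1‖ ^ 2 ≤ A + R := by
        have b1 : 2 / T * E1 ω = 2 * ((T:ℝ)⁻¹ * E1 ω) := by ring
        have b2 : d / T ^ 2 * (1 + E2 ω) = d * ((1 + E2 ω) / T ^ 2) := by ring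
        have b3 : 8 / T * E3 ω = 2 * (4 * (T:ℝ)⁻¹ * E3 ω) := by ring
        rw [hR, b1, b2, b3]
        nlinarith
      calc _ ≤ spread (history π ω n) * (A + R) := mul_le_mul_of_nonneg_left h8 hs0
        _ ≤ _ := by nlinarith
    · rw [Set.indicator_of_notMem h]; exact zero_le
  refine (lintegral_mono hpt).trans ?_
  have hGm : Measurable (G.indicator fun ω => ENNReal.ofReal (spread (history π ω n))) :=
    Measurable.indicator (by fun_prop) hG
  rw [lintegral_add_right _ (by fun_prop), lintegral_add_left (by fun_prop),
    lintegral_add_left (by fun_prop), lintegral_const_mul _ hGm, lintegral_const_mul _ (by fun_prop),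
    lintegral_const_mul _ (by fun_prop), lintegral_const_mul _ (by fun_prop)]
  gcongr
  calc _ ≤ ENNReal.ofReal (2 / T) * 1 + (ENNReal.ofReal (d / T ^ 2)
          * ENNReal.ofReal (T * (35 * logFactor d K T ^ 2)) + ENNReal.ofReal (8 / T) * 1) := by
        gcongr
    _ ≤ _ := by
        rw [mul_one, mul_one, ← ENNReal.ofReal_mul (by positivity),
          ← ENNReal.ofReal_add (by positivity) (by positivity),
          ← ENNReal.ofReal_add (by positivity) (by positivity)]
        refine ENNReal.ofReal_le_ofReal ?_
        have h1 : 2 / T + (d / T ^ 2 * (T * (35 * logFactor d K T ^ 2)) + 8 / T)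
            = (10 + 35 * (d * logFactor d K T ^ 2)) * (1 / (T:ℝ)) := by
          field_simp; ring
        rw [h1]
        gcongr
        have h2 : 1 ≤ logFactor d K T ^ 2 := one_le_pow₀ hl
        nlinarith

end LinBandit
end

section
namespace LinBandit
open scoped ENNReal NNReal

variable {d K T : ℕ} {I : ProblemInstance d K} {N : (n : ℕ) → Set (History d n)}
  {e : (n : ℕ) → History d n → Vec d} {π : Policy d K} {Y : ℕ}

/-! ### Regret of batched greedy algorithms -/

/-- The harmonic sum. -/
theorem sum_one_div_le (hT : 1 ≤ T) (I : ProblemInstance d K) {n : ℕ} (hn : n ≤ T) :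
    ∑ i ∈ Finset.range n, 1 / ((i:ℝ) + 1) ≤ logFactor d K T := by
  obtain ⟨hl1, hl2, hl3, hl4⟩ := log_le_logFactor I hT
  calc ∑ i ∈ Finset.range n, 1 / ((i:ℝ) + 1) ≤ ∑ i ∈ Finset.range T, 1 / ((i:ℝ) + 1) :=
        Finset.sum_le_sum_of_subset_of_nonneg (Finset.range_mono hn) fun i _ _ => by positivity
    _ = ((harmonic T : ℚ) : ℝ) := by simp [harmonic]
    _ ≤ 1 + Real.log T := harmonic_le_one_add_log T
    _ ≤ _ := by linarith

theorem inv_rate_le (hT : 1 ≤ T) :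
    1 ≤ 1 / rate I ∧ 1 / rate I ≤ 3000000 * logFactor d K T ^ 3 / I.rho ^ 2 := by
  have hr := rate_pos I
  have hρ := I.rho_pos
  have h1 := one_le_lkd I
  have h2 := log_KD_le_logFactor I hT
  constructor
  · rw [le_div_iff₀ hr]; linarith [rate_le I]
  · rw [rate, one_div_div]
    gcongr

/-- The event that the estimate used in round `t` is based on a well conditioned design matrix,
and that no earlier estimate was degenerate. -/
def greedyGood (N : (n : ℕ) → Set (History d n)) (π : Policy d K) (Y t : ℕ) : Set (Sample d K) :=
  regularSet N π Y (batchStart Y t) ∩ {ω | spread (history π ω (batchStart Y t)) ≤ 1 / 4}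

theorem measurableSet_greedyGood (hN : ∀ n, MeasurableSet (N n)) (π : Policy d K) (Y t : ℕ) :
    MeasurableSet[MeasurableSpace.comap (fun ω : Sample d K => history π ω (batchStart Y t))
      inferInstance] (greedyGood N π Y t) :=
  (measurableSet_regularSet hN π Y le_rfl).inter
    ⟨{h | spread h ≤ 1 / 4}, measurableSet_le (measurable_spread _) measurable_const, rfl⟩

theorem setDraw_mem_greedyGood (π : Policy d K) (Y t : ℕ) (ω : Sample d K) (z : RoundDraw d K) :
    setDraw t (ω, z) ∈ greedyGood N π Y t ↔ ω ∈ greedyGood N π Y t := by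
  have h := batchStart_le Y t
  refine and_congr (setDraw_mem_regularSet π Y (by omega) ω z) ?_
  show spread _ ≤ _ ↔ spread _ ≤ _
  rw [history_setDraw π h]

/-- `lintegral_spread_le` at the beginning of a batch. -/
theorem lintegral_spread_batch_le (hY : 1 ≤ Y) (hN : ∀ n, MeasurableSet (N n))
    (hNe : ∀ n, ∀ h ∉ N n, e n h ≠ 0) (hπ : IsBatchGreedy I T Y π e) {i : ℕ} (hi : 2 * Y + i < T) :
    ∫⁻ ω, (regularSet N π Y (batchStart Y (2 * Y + i))).indicator
        (fun ω => ENNReal.ofReal (spread (history π ω (batchStart Y (2 * Y + i))))) ω ∂law I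
      ≤ ENNReal.ofReal (d / rate I * (1 / ((i:ℝ) + 1))) := by
  have h1 := batchStart_le Y (2 * Y + i)
  have h2 := lt_batchStart_add hY (2 * Y + i)
  obtain ⟨j, hj⟩ : ∃ j, batchStart Y (2 * Y + i) = Y + j := ⟨batchStart Y (2 * Y + i) - Y, by omega⟩
  rw [hj]
  -- the current batch starts at a time `Y + j` with `j ≥ i`
  refine (lintegral_spread_le hN hNe hπ j (by omega)).trans (ENNReal.ofReal_le_ofReal ?_)
  have hr := rate_pos I
  have hij : (i:ℝ) ≤ j := by exact_mod_cast (by omega : i ≤ j)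
  rw [div_mul_div_comm, mul_one]
  gcongr
  norm_num

/-- The Markov inequality for `spread`. -/
theorem law_compl_greedyGood_le (hT : 1 ≤ T) (hY : 1 ≤ Y) (hN : ∀ n, MeasurableSet (N n))
    (hNe : ∀ n, ∀ h ∉ N n, e n h ≠ 0) (hπ : IsBatchGreedy I T Y π e)
    (hbad : law I {ω | ∃ n, 1 ≤ n ∧ n < T ∧ history π ω n ∈ N n} ≤ ENNReal.ofReal (2 * (1 / T)))
    {i : ℕ} (hi : 2 * Y + i < T) :
    law I (greedyGood N π Y (2 * Y + i))ᶜ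
      ≤ ENNReal.ofReal (2 * (1 / T) + 4 * (d / rate I * (1 / ((i:ℝ) + 1)))) := by
  have hr := rate_pos I
  have hb := batchStart_le Y (2 * Y + i)
  have hsub : (greedyGood N π Y (2 * Y + i))ᶜ
      ⊆ {ω | ∃ n, 1 ≤ n ∧ n < T ∧ history π ω n ∈ N n} ∪
        {ω | ENNReal.ofReal (1 / 4) ≤ (regularSet N π Y (batchStart Y (2 * Y + i))).indicator
        (fun ω => ENNReal.ofReal (spread (history π ω (batchStart Y (2 * Y + i))))) ω} := by
    intro ω hω
    by_cases h : ω ∈ regularSet N π Y (batchStart Y (2 * Y + i))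
    · refine Or.inr ?_
      rw [Set.mem_ofPred_eq, Set.indicator_of_mem h]
      refine ENNReal.ofReal_le_ofReal ?_
      by_contra hlt
      exact hω ⟨h, (not_le.1 hlt).le⟩
    · refine Or.inl ?_
      simp only [regularSet, Set.mem_ofPred_eq, not_forall, not_not] at h
      obtain ⟨s, hs, hYs, hmem⟩ := h
      have h1 := batchStart_le Y s
      have h2 := le_batchStart hY hYs
      exact ⟨_, by omega, by omega, hmem⟩
  have hmeas : MeasurableSet (regularSet N π Y (batchStart Y (2 * Y + i))) :=
    comap_history_le π _ _ (measurableSet_regularSet hN π Y le_rfl)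
  have hmk := meas_ge_le_lintegral_div (μ := law I)
    (f := (regularSet N π Y (batchStart Y (2 * Y + i))).indicator
        (fun ω => ENNReal.ofReal (spread (history π ω (batchStart Y (2 * Y + i))))))
    (Measurable.indicator (by fun_prop) hmeas).aemeasurable (ε := ENNReal.ofReal (1 / 4)) (by simp)
    ENNReal.ofReal_ne_top
  calc _ ≤ _ := measure_mono hsub
    _ ≤ _ := measure_union_le _ _
    _ ≤ ENNReal.ofReal (2 * (1 / T))
          + ENNReal.ofReal (d / rate I * (1 / ((i:ℝ) + 1))) / ENNReal.ofReal (1 / 4) := by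
        refine add_le_add hbad (hmk.trans ?_)
        gcongr
        exact lintegral_spread_batch_le hY hN hNe hπ hi
    _ = _ := by
        rw [← ENNReal.ofReal_div_of_pos (by norm_num), ← ENNReal.ofReal_add (by positivity)
          (by positivity)]
        congr 1; ring

/-- A greedy action for the estimate `v` loses at most twice the error of `v` times the length of
the contexts. -/
theorem roundRegret_greedy_sq_le {t : ℕ} {ω : Sample d K} {v : Vec d}
    (hmax : IsArgmax (fun x => inner ℝ x v) (contexts ω t) (action π ω t)) {R : ℝ}
    (hR : ∀ a, ‖vecOf (ω.2 t) a‖ ≤ R) :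
    roundRegret π t ω ^ 2 ≤ 4 * R ^ 2 * ‖ω.1 - v‖ ^ 2 := by
  have h0 : 0 ≤ roundRegret π t ω := roundRegret_nonneg hmax.avail
  obtain ⟨b, hb, hbe⟩ := exists_bestReward (θ := ω.1) hmax.avail
  have hle := hmax.le hb
  have hreg : roundRegret π t ω
      = inner ℝ ω.1 (vecOf (ω.2 t) b) - inner ℝ ω.1 (vecOf (ω.2 t) (action π ω t)) := by
    have : roundRegret π t ω
      = bestReward ω.1 (contexts ω t) - inner ℝ ω.1 (vecOf (ω.2 t) (action π ω t)) := rfl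
    rw [this, hbe]; rfl
  change inner ℝ (vecOf (ω.2 t) b) v ≤ inner ℝ (vecOf (ω.2 t) (action π ω t)) v at hle
  have hb' := hR b
  have ha' := hR (action π ω t)
  set xa := vecOf (ω.2 t) (action π ω t)
  set xb := vecOf (ω.2 t) b
  have h1 : inner ℝ ω.1 xb - inner ℝ ω.1 xa
      = inner ℝ (ω.1 - v) (xb - xa) + (inner ℝ xb v - inner ℝ xa v) := by
    rw [inner_sub_left, inner_sub_right, inner_sub_right, real_inner_comm v xb, real_inner_comm v xa]
    ring
  have h2 : inner ℝ (ω.1 - v) (xb - xa) ≤ ‖ω.1 - v‖ * (2 * R) := by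
    refine (real_inner_le_norm _ _).trans ?_
    gcongr
    have := norm_sub_le xb xa
    linarith
  have h3 : roundRegret π t ω ≤ ‖ω.1 - v‖ * (2 * R) := by rw [hreg, h1]; linarith
  calc roundRegret π t ω ^ 2 ≤ (‖ω.1 - v‖ * (2 * R)) ^ 2 := by gcongr
    _ = _ := by ring

/-- `H` bounds the squared error of the estimate `e` at time `n` wherever the design matrix is well
conditioned, and is on average at most of the order of the error of ridge regression. -/
def IsErrorBound (I : ProblemInstance d K) (π : Policy d K) {n : ℕ} (e : History d n → Vec d)
    (H : Vec d × History d n → ℝ≥0∞) : Prop :=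
  Measurable H ∧ ∀ G : Set (Sample d K),
    MeasurableSet[MeasurableSpace.comap (fun ω : Sample d K => history π ω n) inferInstance] G →
    (∀ ω ∈ G, spread (history π ω n) ≤ 1 / 2) →
    (∀ ω ∈ G, ENNReal.ofReal (‖ω.1 - e (history π ω n)‖ ^ 2) ≤ H (ω.1, history π ω n)) ∧
    ∫⁻ ω, G.indicator (fun ω => H (ω.1, history π ω n)) ω ∂law I
      ≤ ENNReal.ofReal 8 * ∫⁻ ω, G.indicator (fun ω => ENNReal.ofReal (spread (history π ω n)
        * (noiseEnergy ω.1 (history π ω n) + ‖ω.1‖ ^ 2))) ω ∂law I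

/-- The squared regret after `i` rounds beyond the first two batches is of order `d ^ 2 / i`, and
these bounds have a logarithmic sum. -/
theorem lintegral_roundRegret_greedy_sq_le (hI : EigLeOne I) (hm : 1 ≤ ‖I.mean‖) (hT : 1 ≤ T)
    (hY : 1 ≤ Y) (hN : ∀ n, MeasurableSet (N n))
    (hNe : ∀ n, ∀ h ∉ N n, e n h ≠ 0) (hπ : IsBatchGreedy I T Y π e)
    (herr : ∀ n, 1 ≤ n → n < T → ∃ H, IsErrorBound I π (e n) H) {i : ℕ} (hi : 2 * Y + i < T) :
    ∫⁻ ω, (greedyGood N π Y (2 * Y + i)).indicator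
        (fun ω => ENNReal.ofReal (roundRegret π (2 * Y + i) ω ^ 2)) ω ∂law I
      ≤ ENNReal.ofReal (1088 * logFactor d K T ^ 2
        * (22 * (‖I.mean‖ ^ 2 * d * logFactor d K T) * (d / rate I * (1 / ((i:ℝ) + 1)))
          + 45 * (d * logFactor d K T ^ 2) * (1 / T))) := by
  have hr := rate_pos I
  have hl := one_le_logFactor I hT
  set t := 2 * Y + i with ht
  have h1 := batchStart_le Y t
  have h2 := le_batchStart hY (show Y ≤ t by omega)
  obtain ⟨H, hHm, hH⟩ := herr (batchStart Y t) (by omega) (by omega)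
  have hGc := measurableSet_greedyGood hN π Y t
  have hG : MeasurableSet (greedyGood N π Y t) := comap_history_le π _ _ hGc
  obtain ⟨hH1, hH2⟩ := hH _ hGc fun ω hω => hω.2.trans (by norm_num)
  have hHm' : Measurable fun ω : Sample d K => H (ω.1, history π ω (batchStart Y t)) :=
    hHm.comp (measurable_fst.prodMk (measurable_history π _))
  have hGH : Measurable ((greedyGood N π Y t).indicator
      fun ω => H (ω.1, history π ω (batchStart Y t))) := hHm'.indicator hG
  have hrm : Measurable fun z : RoundDraw d K => ENNReal.ofReal (4 * radius I z ^ 2) := by fun_prop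
  calc _ ≤ ∫⁻ ω, (greedyGood N π Y t).indicator (fun ω => H (ω.1, history π ω (batchStart Y t))) ω
          * ENNReal.ofReal (4 * radius I (ω.2 t) ^ 2) ∂law I := by
        refine lintegral_mono_ae ?_
        filter_upwards [hπ t hi, ae_draw I t (ae_norm_vecOf_le I)] with ω hω hrad
        by_cases h : ω ∈ greedyGood N π Y t
        · rw [Set.indicator_of_mem h, Set.indicator_of_mem h, mul_comm]
          refine le_trans (ENNReal.ofReal_le_ofReal (roundRegret_greedy_sq_le hω hrad)) ?_
          rw [ENNReal.ofReal_mul (by positivity)]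
          gcongr
          exact hH1 ω h
        · rw [Set.indicator_of_notMem h]; exact zero_le
    -- the contexts of round `t` are independent of the estimate and of the latent vector
    _ = (∫⁻ ω, (greedyGood N π Y t).indicator (fun ω => H (ω.1, history π ω (batchStart Y t))) ω ∂law I)
          * ∫⁻ z, ENNReal.ofReal (4 * radius I z ^ 2) ∂roundLaw I := by
        rw [lintegral_setDraw I t (F := fun ω => (greedyGood N π Y t).indicator
          (fun ω => H (ω.1, history π ω (batchStart Y t))) ω
          * ENNReal.ofReal (4 * radius I (ω.2 t) ^ 2)) (hGH.mul (by fun_prop)),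
          ← lintegral_mul_const _ hGH]
        refine lintegral_congr fun ω => ?_
        rw [← lintegral_const_mul _ hrm]
        refine lintegral_congr fun z => ?_
        simp only [setDraw_same]
        congr 1
        by_cases h : ω ∈ greedyGood N π Y t
        · rw [Set.indicator_of_mem h, Set.indicator_of_mem ((setDraw_mem_greedyGood π Y t ω z).2 h),
            history_setDraw π h1]; rfl
        · rw [Set.indicator_of_notMem h, Set.indicator_of_notMem
            (fun h' => h ((setDraw_mem_greedyGood π Y t ω z).1 h'))]
    _ ≤ (ENNReal.ofReal 8 * (ENNReal.ofReal (22 * (‖I.mean‖ ^ 2 * d * logFactor d K T))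
          * ENNReal.ofReal (d / rate I * (1 / ((i:ℝ) + 1)))
          + ENNReal.ofReal (45 * (d * logFactor d K T ^ 2) * (1 / T))))
          * ENNReal.ofReal (136 * logFactor d K T ^ 2) := by
        gcongr
        · refine hH2.trans ?_
          gcongr
          refine (lintegral_spread_mul_energy_le hI hm hT π (by omega) hG
            fun ω hω => hω.2.trans (by norm_num)).trans ?_
          gcongr
          refine le_trans (lintegral_mono fun ω => ?_) (lintegral_spread_batch_le hY hN hNe hπ hi)
          exact Set.indicator_le_indicator_of_subset (fun ω hω => hω.1) (fun _ => zero_le) ω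
        · simp_rw [ENNReal.ofReal_mul (show (0:ℝ) ≤ 4 by norm_num)]
          rw [lintegral_const_mul _ (by fun_prop)]
          have h3 : 136 * logFactor d K T ^ 2 = 4 * (34 * logFactor d K T ^ 2) := by ring
          rw [h3, ENNReal.ofReal_mul (p := 4) (by norm_num)]
          gcongr
          refine (lintegral_radius_sq_le I).trans (ENNReal.ofReal_le_ofReal ?_)
          have := one_le_lkd I
          have := log_KD_le_logFactor I hT
          gcongr
    _ = _ := by
        rw [← ENNReal.ofReal_mul (by positivity), ← ENNReal.ofReal_add (by positivity) (by positivity),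
          ← ENNReal.ofReal_mul (by positivity), ← ENNReal.ofReal_mul (by positivity)]
        congr 1; ring

/-- The arithmetic of the final bound; `X` stands for `K ^ (2 / 3) * T ^ (1 / 3)` and `l` for the
logarithmic factor. -/
theorem batchGreedy_bound_le {d l m ρ X Y : ℝ} (hd : 1 ≤ d) (hl : 1 ≤ l) (hm : 1 ≤ m) (hρ : 0 < ρ)
    (hρ1 : ρ ≤ 1) (hX : 1 ≤ X) (hY : 0 ≤ Y) :
    408 * l ^ 3 * m * (2 * Y)
      + 1000 * (m * d * l ^ 3) * (3 + 4 * (d * (3000000 * l ^ 3 / ρ ^ 2) * l) + 2)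
      + X * (1088 * l ^ 2 * (67 * (m ^ 2 * d ^ 2 * l ^ 2 * (3000000 * l ^ 3 / ρ ^ 2))) / m
        + 3 * l * m / ρ)
      ≤ 10 ^ 12 * l ^ 7 * m * (d ^ 2 / ρ ^ 2 * X + Y) := by
  have hl7 : l ^ 3 ≤ l ^ 7 := pow_le_pow_right₀ hl (by norm_num)
  have hl1 : l ≤ l ^ 7 := le_self_pow₀ hl (by norm_num)
  set Q := l ^ 7 * m * (d ^ 2 / ρ ^ 2) * X with hQ
  have hQ0 : 0 ≤ Q := by positivity
  have hdr : d ≤ d ^ 2 / ρ ^ 2 := by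
    rw [le_div_iff₀ (by positivity)]
    have : ρ ^ 2 ≤ 1 := pow_le_one₀ hρ.le hρ1
    nlinarith
  have hdr3 : 1 / ρ ≤ d ^ 2 / ρ ^ 2 := by
    rw [div_le_div_iff₀ (by positivity) (by positivity)]
    have : ρ ^ 2 ≤ ρ := by nlinarith
    nlinarith [one_le_pow₀ (n := 2) hd]
  have a0 : 408 * l ^ 3 * m * (2 * Y) ≤ 816 * (l ^ 7 * m * Y) := by
    calc _ = 816 * (l ^ 3 * m * Y) := by ring
      _ ≤ _ := by gcongr
  have b1 : 1000 * (m * d * l ^ 3) * 5 ≤ 5000 * Q := by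
    calc _ = 5000 * (l ^ 3 * m * d * 1) := by ring
      _ ≤ _ := by rw [hQ]; gcongr
  have b2 : 1000 * (m * d * l ^ 3) * (4 * (d * (3000000 * l ^ 3 / ρ ^ 2) * l))
      ≤ 12000000000 * Q := by
    calc _ = 12000000000 * (l ^ 7 * m * (d ^ 2 / ρ ^ 2) * 1) := by ring
      _ ≤ _ := by rw [hQ]; gcongr
  have a2 : X * (1088 * l ^ 2 * (67 * (m ^ 2 * d ^ 2 * l ^ 2 * (3000000 * l ^ 3 / ρ ^ 2))) / m)
      = 218688000000 * Q := by
    rw [hQ]; field_simp; ring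
  have a3 : X * (3 * l * m / ρ) ≤ 3 * Q := by
    calc _ = 3 * (l * m * (1 / ρ) * X) := by ring
      _ ≤ 3 * (l ^ 7 * m * (d ^ 2 / ρ ^ 2) * X) := by gcongr
  have hY0 : 0 ≤ l ^ 7 * m * Y := by positivity
  calc _ ≤ 10 ^ 12 * (Q + l ^ 7 * m * Y) := by rw [mul_add X]; linarith
    _ = _ := by rw [hQ]; ring

/-- The regret of a batched greedy algorithm for any estimate that is as accurate as ridge
regression and is unlikely to be degenerate. No estimate is accurate during the first two batches:
the first is played without data, the second with the data of the first, which may be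
uninformative. -/
theorem bayesRegretLE_batchGreedy (hI : EigLeOne I) (hT : 1 ≤ T)
    (hm : 1 + Real.sqrt (3 * Real.log T) ≤ ‖I.mean‖) (hY : 1 ≤ Y)
    (hN : ∀ n, MeasurableSet (N n)) (hNe : ∀ n, ∀ h ∉ N n, e n h ≠ 0)
    (hπ : IsBatchGreedy I T Y π e)
    (hbad : law I {ω | ∃ n, 1 ≤ n ∧ n < T ∧ history π ω n ∈ N n} ≤ ENNReal.ofReal (2 * (1 / T)))
    (herr : ∀ n, 1 ≤ n → n < T → ∃ H, IsErrorBound I π (e n) H) :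
    BayesRegretLE I π T (10 ^ 12 * logFactor d K T ^ 7 * ‖I.mean‖ *
      ((d : ℝ) ^ 2 * (K : ℝ) ^ (2 / 3 : ℝ) / I.rho ^ 2 * (T : ℝ) ^ (1 / 3 : ℝ) + Y)) := by
  have hm1 : 1 ≤ ‖I.mean‖ := by linarith [Real.sqrt_nonneg (3 * Real.log T)]
  have hT' : (1:ℝ) ≤ T := by exact_mod_cast hT
  have hK : (1:ℝ) ≤ K := by exact_mod_cast one_le_K I
  have hd : (1:ℝ) ≤ d := by exact_mod_cast one_le_d I
  have hl := one_le_logFactor I hT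
  have hr := rate_pos I
  have hρ := I.rho_pos
  obtain ⟨hr1, hr2⟩ := inv_rate_le (I := I) hT
  have hav : ChoosesAvailable I T π := fun t ht => (hπ t ht).mono fun ω h => h.avail
  set Z : ℝ := 3000000 * logFactor d K T ^ 3 / I.rho ^ 2 with hZ
  have hZ1 : 1 ≤ Z := hr1.trans hr2
  set B : ℕ → Set (Sample d K) := fun t => (greedyGood N π Y t)ᶜ ∪ {ω | ‖ω.1‖ < normFloor I T} with hB
  have hGm : ∀ t, MeasurableSet (greedyGood N π Y t) := fun t =>
    comap_history_le π _ _ (measurableSet_greedyGood hN π Y t)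
  have hBm : ∀ t, MeasurableSet (B t) := fun t =>
    (hGm t).compl.union (measurableSet_lt (by fun_prop) (by fun_prop))
  have hfloor : law I {ω | ‖ω.1‖ < normFloor I T} ≤ ENNReal.ofReal (1 / T) := by
    refine (law_norm_lt_normFloor_le hI hT hm).trans (ENNReal.ofReal_le_ofReal ?_)
    rw [one_div, ← Real.rpow_neg_one]
    exact Real.rpow_le_rpow_of_exponent_le hT' (by norm_num)
  have hreindex : ∀ f : ℕ → ℝ≥0∞, ∑ t ∈ Finset.Ico (2 * Y) T, f t
      = ∑ i ∈ Finset.range (T - 2 * Y), f (2 * Y + i) := fun f => Finset.sum_Ico_eq_sum_range f _ _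
  have hsum := sum_one_div_le hT I (Nat.sub_le T (2 * Y))
  have hsumT : ∑ _i ∈ Finset.range (T - 2 * Y), (1 / (T:ℝ)) ≤ 1 := by
    rw [Finset.sum_const, Finset.card_range, nsmul_eq_mul, mul_one_div, div_le_one (by linarith)]
    exact_mod_cast Nat.sub_le T (2 * Y)
  have hp : ∑ t ∈ Finset.Ico (2 * Y) T, law I (B t)
      ≤ ENNReal.ofReal (3 + 4 * (d * Z * logFactor d K T)) := by
    rw [hreindex]
    calc _ ≤ ∑ i ∈ Finset.range (T - 2 * Y),
            ENNReal.ofReal (3 * (1 / T) + 4 * (d * Z) * (1 / ((i:ℝ) + 1))) := by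
          refine Finset.sum_le_sum fun i hi => ?_
          have hi' : 2 * Y + i < T := by have := Finset.mem_range.1 hi; omega
          refine (measure_union_le _ _).trans ((add_le_add
            (law_compl_greedyGood_le hT hY hN hNe hπ hbad hi') hfloor).trans ?_)
          rw [← ENNReal.ofReal_add (by positivity) (by positivity)]
          refine ENNReal.ofReal_le_ofReal ?_
          have h1 : (d:ℝ) / rate I ≤ d * Z := by rw [div_eq_mul_one_div]; gcongr
          have h2 : (d:ℝ) / rate I * (1 / ((i:ℝ) + 1)) ≤ d * Z * (1 / ((i:ℝ) + 1)) := by gcongr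
          linarith
      _ = ENNReal.ofReal (∑ i ∈ Finset.range (T - 2 * Y),
            (3 * (1 / T) + 4 * (d * Z) * (1 / ((i:ℝ) + 1)))) :=
          (ENNReal.ofReal_sum_of_nonneg fun i _ => by positivity).symm
      _ ≤ _ := by
          refine ENNReal.ofReal_le_ofReal ?_
          rw [Finset.sum_add_distrib, ← Finset.mul_sum, ← Finset.mul_sum]
          calc _ ≤ 3 * 1 + 4 * (d * Z) * logFactor d K T := by gcongr
            _ = _ := by ring
  set S : ℝ := 1088 * logFactor d K T ^ 2 * (67 * (‖I.mean‖ ^ 2 * d ^ 2 * logFactor d K T ^ 2 * Z))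
    with hS
  have hsq : ∑ t ∈ Finset.Ico (2 * Y) T, ∫⁻ ω, {ω : Sample d K | ω ∉ B t ∧ ω.2 t ∉ (∅ : Set _)}.indicator
          (fun ω => ENNReal.ofReal (roundRegret π t ω ^ 2)) ω ∂law I ≤ ENNReal.ofReal S := by
    rw [hreindex]
    calc _ ≤ ∑ i ∈ Finset.range (T - 2 * Y), ENNReal.ofReal (1088 * logFactor d K T ^ 2
            * (22 * (‖I.mean‖ ^ 2 * d * logFactor d K T) * (d / rate I * (1 / ((i:ℝ) + 1)))
            + 45 * (d * logFactor d K T ^ 2) * (1 / T))) := by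
          refine Finset.sum_le_sum fun i hi => ?_
          have hi' : 2 * Y + i < T := by have := Finset.mem_range.1 hi; omega
          refine le_trans (lintegral_mono fun ω => ?_)
            (lintegral_roundRegret_greedy_sq_le hI hm1 hT hY hN hNe hπ herr hi')
          refine Set.indicator_le_indicator_of_subset (fun ω hω => ?_) (fun _ => zero_le) ω
          by_contra h
          exact hω.1 (Or.inl h)
      _ = ENNReal.ofReal (∑ i ∈ Finset.range (T - 2 * Y), 1088 * logFactor d K T ^ 2
            * (22 * (‖I.mean‖ ^ 2 * d * logFactor d K T) * (d / rate I * (1 / ((i:ℝ) + 1)))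
            + 45 * (d * logFactor d K T ^ 2) * (1 / T))) :=
          (ENNReal.ofReal_sum_of_nonneg fun i _ => by positivity).symm
      _ ≤ _ := by
          refine ENNReal.ofReal_le_ofReal ?_
          rw [← Finset.mul_sum, Finset.sum_add_distrib, ← Finset.mul_sum, ← Finset.mul_sum,
            ← Finset.mul_sum, hS]
          refine mul_le_mul_of_nonneg_left ?_ (by positivity)
          have h1 : (d:ℝ) / rate I ≤ d * Z := by rw [div_eq_mul_one_div]; gcongr
          have h4 : 1 ≤ ‖I.mean‖ ^ 2 * d * Z :=
            one_le_mul_of_one_le_of_one_le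
              (one_le_mul_of_one_le_of_one_le (one_le_pow₀ hm1) hd) hZ1
          have h5 : (d:ℝ) / rate I * ∑ i ∈ Finset.range (T - 2 * Y), 1 / ((i:ℝ) + 1)
              ≤ d * Z * logFactor d K T :=
            mul_le_mul h1 hsum (Finset.sum_nonneg fun i _ => by positivity) (by positivity)
          calc _ ≤ 22 * (‖I.mean‖ ^ 2 * d * logFactor d K T) * (d * Z * logFactor d K T)
                + 45 * (d * logFactor d K T ^ 2) * (‖I.mean‖ ^ 2 * d * Z) :=
                add_le_add (mul_le_mul_of_nonneg_left h5 (by positivity))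
                  (mul_le_mul_of_nonneg_left (hsumT.trans h4) (by positivity))
            _ = _ := by ring
  have h := bayesRegretLE_of_sq hI hm1 hT hav (2 * Y) B (fun t _ _ => hBm t)
    (fun t _ _ ω z => or_congr (not_congr (setDraw_mem_greedyGood π Y t ω z)) Iff.rfl)
    (fun t _ _ ω hω => Or.inr hω) MeasurableSet.empty (by simp) (by positivity) (by positivity) hp hsq
  refine ⟨h.1, h.2.trans ?_⟩
  have hT3 : 1 ≤ (T : ℝ) ^ (1 / 3 : ℝ) := Real.one_le_rpow hT' (by norm_num)
  have hK3 : 1 ≤ (K : ℝ) ^ (2 / 3 : ℝ) := Real.one_le_rpow hK (by norm_num)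
  have hX1 : 1 ≤ (K : ℝ) ^ (2 / 3 : ℝ) * (T : ℝ) ^ (1 / 3 : ℝ) := by nlinarith
  refine le_trans (le_of_eq ?_) ((batchGreedy_bound_le hd hl hm1 I.rho_pos (rho_le_one I) hX1
    (Nat.cast_nonneg Y)).trans (le_of_eq ?_))
  · rw [hS, hZ]; push_cast; ring
  · ring

end LinBandit
end

section
namespace LinBandit
open Matrix
open scoped ENNReal NNReal

variable {d K T : ℕ} {I : ProblemInstance d K} {π : Policy d K} {Y : ℕ}

/-! ### Batched frequentist greedy -/

/-- The histories for which `0` is a least squares estimate. -/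
def zeroFitSet (d n : ℕ) : Set (History d n) := {h | ∑ i, (h i).2 • (h i).1.ofLp = 0}

theorem measurableSet_zeroFitSet (n : ℕ) : MeasurableSet (zeroFitSet d n) := by
  have h1 : Continuous fun h : History d n => ∑ i, (h i).2 • (h i).1.ofLp := by fun_prop
  exact h1.measurable (measurableSet_singleton 0)

/-- Since the last reward has a continuous distribution given everything else, the least squares
estimate does not vanish. -/
theorem law_zeroFitSet_succ {n : ℕ} (hav : ∀ᵐ ω ∂law I, Avail (ctxOf (ω.2 n)) (action π ω n)) :
    law I {ω | history π ω (n + 1) ∈ zeroFitSet d (n + 1)} = 0 := by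
  have hm : MeasurableSet {ω | history π ω (n + 1) ∈ zeroFitSet d (n + 1)} :=
    measurable_history π (n + 1) (measurableSet_zeroFitSet (n + 1))
  rw [← lintegral_indicator_one hm, lintegral_setDraw I n (measurable_one.indicator hm),
    lintegral_eq_zero_iff' (by
      refine AEMeasurable.lintegral_prod_right' (f := fun p : Sample d K × RoundDraw d K =>
        {ω | history π ω (n + 1) ∈ zeroFitSet d (n + 1)}.indicator 1 (setDraw n p)) ?_
      exact ((measurable_one.indicator hm).comp (measurable_setDraw n)).aemeasurable)]
  filter_upwards [ae_setDraw I n hav] with ω hω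
  set h := history π ω n
  set α := π.act n h with hαdef
  have hα : Measurable α := (π.measurable_act n).comp (measurable_const.prodMk measurable_id)
  set s : Fin d → ℝ := ∑ i, (h i).2 • (h i).1.ofLp with hs
  -- the contexts and noises of round `n` for which the moment vector after the round vanishes
  set A : Set (Contexts d K × ℝ) := {q | s + (inner ℝ ω.1 (ctxVec q.1 (α q.1)) + q.2)
    • (ctxVec q.1 (α q.1)).ofLp = 0} with hA
  have hAm : MeasurableSet A := by
    have h1 : Measurable fun q : Contexts d K × ℝ => ctxVec q.1 (α q.1) :=
      measurable_uncurry_ctxVec measurable_fst (hα.comp measurable_fst)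
    have h2 : Continuous fun q : Vec d × ℝ => s + (inner ℝ ω.1 q.1 + q.2) • q.1.ofLp := by fun_prop
    exact (h2.measurable.comp (h1.prodMk measurable_snd)) (measurableSet_singleton 0)
  have hstep : ∀ z, ({ω | history π ω (n + 1) ∈ zeroFitSet d (n + 1)}.indicator 1
      (setDraw n (ω, z)) : ℝ≥0∞) = A.indicator 1 (ctxOf z, z.2.2 (α (ctxOf z))) := by
    intro z
    have hiff : setDraw n (ω, z) ∈ {ω | history π ω (n + 1) ∈ zeroFitSet d (n + 1)}
        ↔ (ctxOf z, z.2.2 (α (ctxOf z))) ∈ A := by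
      simp only [zeroFitSet, Set.mem_ofPred_eq, hA]
      rw [history_succ, action_setDraw, setDraw_same, history_setDraw π le_rfl,
        Fin.sum_univ_castSucc]
      simp only [Fin.snoc_castSucc, Fin.snoc_last]
      exact Iff.rfl
    by_cases hz : (ctxOf z, z.2.2 (α (ctxOf z))) ∈ A
    · rw [Set.indicator_of_mem hz, Set.indicator_of_mem (hiff.2 hz)]; rfl
    · rw [Set.indicator_of_notMem hz, Set.indicator_of_notMem fun h => hz (hiff.1 h)]
  simp_rw [hstep]
  rw [lintegral_chosen_noise I hα (measurable_one.indicator hAm)]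
  have hall : ∀ᵐ z ∂roundLaw I, ∀ a, Avail (ctxOf z) a → vecOf z a ≠ 0 :=
    ae_all_iff.2 (ae_vecOf_ne_zero I)
  refine (lintegral_congr_ae ?_).trans lintegral_zero
  filter_upwards [hω, hall] with z hz hne
  rw [action_setDraw, setDraw_same] at hz
  have hx : ctxVec (ctxOf z) (α (ctxOf z)) ≠ 0 := hne _ hz
  have hsub : {η : ℝ | (ctxOf z, η) ∈ A}.Subsingleton := by
    intro η₁ h1 η₂ h2
    have h3 : s + (inner ℝ ω.1 (ctxVec (ctxOf z) (α (ctxOf z))) + η₁)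
        • (ctxVec (ctxOf z) (α (ctxOf z))).ofLp = 0 := h1
    have h4 : s + (inner ℝ ω.1 (ctxVec (ctxOf z) (α (ctxOf z))) + η₂)
        • (ctxVec (ctxOf z) (α (ctxOf z))).ofLp = 0 := h2
    have h5 : (η₁ - η₂) • (ctxVec (ctxOf z) (α (ctxOf z))).ofLp = 0 := by
      have : (η₁ - η₂) • (ctxVec (ctxOf z) (α (ctxOf z))).ofLp
          = (s + (inner ℝ ω.1 (ctxVec (ctxOf z) (α (ctxOf z))) + η₁)
            • (ctxVec (ctxOf z) (α (ctxOf z))).ofLp)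
          - (s + (inner ℝ ω.1 (ctxVec (ctxOf z) (α (ctxOf z))) + η₂)
            • (ctxVec (ctxOf z) (α (ctxOf z))).ofLp) := by module
      rw [this, h3, h4, sub_zero]
    rcases smul_eq_zero.1 h5 with h | h
    · linarith
    · exact absurd ((WithLp.ofLp_eq_zero 2).1 h) hx
  have hmA : MeasurableSet {η : ℝ | (ctxOf z, η) ∈ A} := measurable_prodMk_left hAm
  have hind : ∀ η : ℝ, (A.indicator 1 (ctxOf z, η) : ℝ≥0∞)
      = {η : ℝ | (ctxOf z, η) ∈ A}.indicator 1 η := fun η => rfl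
  simp_rw [hind]
  rw [lintegral_indicator_one hmA]
  have := nullSingletonClass_gaussianReal (μ := 0) (v := 1) one_ne_zero
  exact hsub.measure_zero _

/-- The estimate is almost surely nonzero as soon as there are data. -/
theorem bayesRegretLE_freqGreedy (hI : EigLeOne I) (hT : 1 ≤ T)
    (hm : 1 + Real.sqrt (3 * Real.log T) ≤ ‖I.mean‖) (hY : 1 ≤ Y)
    (hπ : IsBatchFreqGreedy I T Y π) :
    BayesRegretLE I π T (10 ^ 12 * logFactor d K T ^ 7 * ‖I.mean‖ *
      ((d : ℝ) ^ 2 * (K : ℝ) ^ (2 / 3 : ℝ) / I.rho ^ 2 * (T : ℝ) ^ (1 / 3 : ℝ) + Y)) := by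
  obtain ⟨est, hest, hmax⟩ := hπ
  refine bayesRegretLE_batchGreedy (N := fun n => zeroFitSet d n) (e := est) hI hT hm hY
    measurableSet_zeroFitSet (fun n h hh h0 => hh ?_) hmax ?_ fun n _ _ => ?_
  · have h1 := gram_mulVec_of_isMinOn_sqLoss (hest n h)
    rw [h0, WithLp.ofLp_zero, mulVec_zero] at h1
    exact h1.symm
  · have hsub : {ω : Sample d K | ∃ n, 1 ≤ n ∧ n < T ∧ history π ω n ∈ zeroFitSet d n}
        ⊆ ⋃ n, ⋃ (_ : n < T), {ω | history π ω (n + 1) ∈ zeroFitSet d (n + 1)} := by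
      rintro ω ⟨n, h1, h2, h3⟩
      obtain ⟨k, rfl⟩ : ∃ k, n = k + 1 := ⟨n - 1, by omega⟩
      exact Set.mem_iUnion₂.2 ⟨k, by omega, h3⟩
    refine (measure_mono hsub).trans (le_of_eq_of_le ?_ zero_le)
    exact measure_iUnion_null fun n => measure_iUnion_null fun hn =>
      law_zeroFitSet_succ ((hmax n hn).mono fun ω h => h.avail)
  · refine ⟨fun p => ENNReal.ofReal (4 * spread p.2 * noiseEnergy p.1 p.2), ?_, fun G hG hs =>
      ⟨fun ω hω => ENNReal.ofReal_le_ofReal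
        (norm_isMinOn_sqLoss_sub_sq_le (hest n _) (hs ω hω) ω.1), ?_⟩⟩
    · have h1 : Measurable fun p : Vec d × History d n => spread p.2 :=
        (measurable_spread n).comp measurable_snd
      have h2 : Measurable fun p : Vec d × History d n => noiseEnergy p.1 p.2 :=
        measurable_noiseEnergy measurable_fst measurable_snd
      exact ((h1.const_mul 4).mul h2).ennreal_ofReal
    · rw [← lintegral_const_mul' _ _ ENNReal.ofReal_ne_top]
      refine lintegral_mono fun ω => ?_
      by_cases h : ω ∈ G
      · rw [Set.indicator_of_mem h, Set.indicator_of_mem h, ← ENNReal.ofReal_mul (by norm_num)]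
        refine ENNReal.ofReal_le_ofReal ?_
        have h1 := spread_nonneg (history π ω n)
        have h2 := noiseEnergy_nonneg ω.1 (history π ω n)
        have h3 : 0 ≤ spread (history π ω n) * noiseEnergy ω.1 (history π ω n) := by positivity
        have h4 : 0 ≤ spread (history π ω n) * ‖ω.1‖ ^ 2 := by positivity
        linarith
      · rw [Set.indicator_of_notMem h]; exact zero_le

/-! ### Batched Bayesian greedy -/

/-- On an event that is known given the conditioning, the conditional expectation is, up to a
constant, as good a predictor as any other one. -/
theorem lintegral_sub_condExp_sq_le {Ω E : Type*} {m m0 : MeasurableSpace Ω} {μ : Measure Ω}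
    [IsProbabilityMeasure μ] [NormedAddCommGroup E] [NormedSpace ℝ E] [CompleteSpace E]
    (hm : m ≤ m0) {X r : Ω → E} (hX : Integrable X μ) (hr : StronglyMeasurable[m] r) {G : Set Ω}
    (hG : MeasurableSet[m] G) :
    ∫⁻ ω, G.indicator (fun ω => ‖X ω - (μ[X | m]) ω‖ₑ ^ 2) ω ∂μ
      ≤ 4 * ∫⁻ ω, G.indicator (fun ω => ‖X ω - r ω‖ₑ ^ 2) ω ∂μ := by
  set f : Ω → E := G.indicator (X - r) with hf
  set g : Ω → E := G.indicator (μ[X | m] - r) with hg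
  have hGm := hm _ hG
  have hfm : AEStronglyMeasurable f μ :=
    (hX.aestronglyMeasurable.sub (hr.mono hm).aestronglyMeasurable).indicator hGm
  have hgm : AEStronglyMeasurable g μ :=
    ((stronglyMeasurable_condExp.mono hm).sub (hr.mono hm)).aestronglyMeasurable.indicator hGm
  have hsq : ∀ f : Ω → E, ∫⁻ ω, ‖f ω‖ₑ ^ 2 ∂μ = eLpNorm f 2 μ ^ 2 := fun f => by
    have := eLpNorm_nnreal_pow_eq_lintegral (f := f) (μ := μ) (p := 2) two_ne_zero
    simpa using this.symm
  have hRHS : ∫⁻ ω, G.indicator (fun ω => ‖X ω - r ω‖ₑ ^ 2) ω ∂μ = ∫⁻ ω, ‖f ω‖ₑ ^ 2 ∂μ := by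
    refine lintegral_congr fun ω => ?_
    by_cases h : ω ∈ G
    · rw [hf, Set.indicator_of_mem h, Set.indicator_of_mem h]; rfl
    · rw [hf, Set.indicator_of_notMem h, Set.indicator_of_notMem h]; simp
  rw [hRHS]
  by_cases htop : ∫⁻ ω, ‖f ω‖ₑ ^ 2 ∂μ = ∞
  · rw [htop, ENNReal.mul_top (by norm_num)]; exact le_top
  have hf2 : MemLp f 2 μ := by
    refine ⟨hfm, lt_top_iff_ne_top.2 fun h => htop ?_⟩
    rw [hsq, h]; simp
  have hfi : Integrable f μ := hf2.integrable (by norm_num)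
  have hri : Integrable (G.indicator r) μ := by
    have : G.indicator r = G.indicator X - f := by
      rw [hf, ← Set.indicator_sub']; congr 1; abel
    rw [this]
    exact (hX.indicator hGm).sub hfi
  -- the conditional expectation of `X - r` on `G` is `μ[X | m] - r`, and conditioning contracts
  -- the norm of `L²`
  have hcond : μ[f | m] =ᵐ[μ] g := by
    have h1 : f = G.indicator X - G.indicator r := by rw [hf, Set.indicator_sub']
    have h2 := condExp_sub (hX.indicator hGm) hri m
    rw [← h1] at h2
    have h3 := condExp_of_stronglyMeasurable hm (hr.indicator hG) hri
    filter_upwards [h2, condExp_indicator hX hG] with ω h4 h5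
    rw [h4, Pi.sub_apply, h5, h3, hg, Set.indicator_sub', Pi.sub_apply]
  have hgf : ∫⁻ ω, ‖g ω‖ₑ ^ 2 ∂μ ≤ ∫⁻ ω, ‖f ω‖ₑ ^ 2 ∂μ := by
    rw [hsq, hsq, ← eLpNorm_congr_ae hcond]
    gcongr
    exact eLpNorm_condExp_le_eLpNorm f (by norm_num)
  have hpt : ∀ ω, G.indicator (fun ω => ‖X ω - (μ[X | m]) ω‖ₑ ^ 2) ω
      ≤ 2 * ‖f ω‖ₑ ^ 2 + 2 * ‖g ω‖ₑ ^ 2 := by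
    intro ω
    by_cases h : ω ∈ G
    · rw [Set.indicator_of_mem h, hf, hg, Set.indicator_of_mem h, Set.indicator_of_mem h]
      have h1 : X ω - (μ[X | m]) ω = (X - r) ω - (μ[X | m] - r) ω := by
        simp only [Pi.sub_apply]; abel
      rw [h1, ← ofReal_norm, ← ofReal_norm, ← ofReal_norm,
        ← ENNReal.ofReal_pow (norm_nonneg _), ← ENNReal.ofReal_pow (norm_nonneg _),
        ← ENNReal.ofReal_pow (norm_nonneg _), ← ENNReal.ofReal_ofNat 2,
        ← ENNReal.ofReal_mul (by norm_num), ← ENNReal.ofReal_mul (by norm_num),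
        ← ENNReal.ofReal_add (by positivity) (by positivity)]
      refine ENNReal.ofReal_le_ofReal ?_
      set a := (X - r) ω
      set b := (μ[X | m] - r) ω
      have h2 := norm_sub_le a b
      calc ‖a - b‖ ^ 2 ≤ (‖a‖ + ‖b‖) ^ 2 := by gcongr
        _ ≤ _ := by nlinarith [sq_nonneg (‖a‖ - ‖b‖)]
    · rw [Set.indicator_of_notMem h]; exact zero_le
  calc _ ≤ ∫⁻ ω, (2 * ‖f ω‖ₑ ^ 2 + 2 * ‖g ω‖ₑ ^ 2) ∂μ := lintegral_mono hpt
    _ = 2 * (∫⁻ ω, ‖f ω‖ₑ ^ 2 ∂μ) + 2 * ∫⁻ ω, ‖g ω‖ₑ ^ 2 ∂μ := by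
        rw [lintegral_add_left' ((hfm.enorm.pow_const 2).const_mul 2), lintegral_const_mul'' _
          (hfm.enorm.pow_const 2), lintegral_const_mul'' _ (hgm.enorm.pow_const 2)]
    _ ≤ 2 * (∫⁻ ω, ‖f ω‖ₑ ^ 2 ∂μ) + 2 * ∫⁻ ω, ‖f ω‖ₑ ^ 2 ∂μ := by gcongr
    _ = _ := by rw [← add_mul]; norm_num

theorem integrable_latent (I : ProblemInstance d K) :
    Integrable (fun ω : Sample d K => ω.1) (law I) := by
  have h : Integrable (fun θ : Vec d => θ) (prior I) :=
    (IsGaussian.memLp_id (prior I) 1 (by norm_num)).integrable le_rfl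
  exact (measurePreserving_latent I).integrable_comp_of_integrable h

/-- The posterior means form a martingale, so the latent vector has expectation `0` on the event
that one of them vanishes; but its component in the direction of the prior mean is at least `1`
with high probability. -/
theorem law_exists_condExp_eq_zero_le (hI : EigLeOne I) (hT : 1 ≤ T)
    (hm : 1 + Real.sqrt (3 * Real.log T) ≤ ‖I.mean‖) {g : (n : ℕ) → History d n → Vec d}
    (hg : ∀ n, Measurable (g n))
    (hgc : ∀ n, (law I)[fun ω' : Sample d K => ω'.1 |
      MeasurableSpace.comap (fun ω' => history π ω' n) inferInstance] = g n ∘ fun ω => history π ω n) :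
    law I {ω | ∃ n, 1 ≤ n ∧ n < T ∧ history π ω n ∈ {h | g n h = 0}}
      ≤ ENNReal.ofReal (2 * (1 / T)) := by
  have hT' : (1:ℝ) ≤ T := by exact_mod_cast hT
  set Z : ℕ → Set (Sample d K) := fun n => {ω | g n (history π ω n) = 0} with hZ
  have hZc : ∀ k n, k ≤ n → MeasurableSet[MeasurableSpace.comap
      (fun ω : Sample d K => history π ω n) inferInstance] (Z k) := fun k n hkn =>
    comap_history_mono π hkn _ ⟨_, hg k (measurableSet_singleton 0), rfl⟩
  -- the event that the posterior mean vanishes for the first time at time `n`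
  set A : ℕ → Set (Sample d K) := fun n => Z n ∩ ⋂ k, ⋂ (_ : k < n), ⋂ (_ : 1 ≤ k), (Z k)ᶜ with hA
  have hAc : ∀ n, MeasurableSet[MeasurableSpace.comap
      (fun ω : Sample d K => history π ω n) inferInstance] (A n) := fun n =>
    (hZc n n le_rfl).inter (MeasurableSet.iInter fun k => MeasurableSet.iInter fun hk =>
      MeasurableSet.iInter fun _ => (hZc k n hk.le).compl)
  have hAm : ∀ n, MeasurableSet (A n) := fun n => comap_history_le π n _ (hAc n)
  have hint := integrable_latent I
  have hA0 : ∀ n, ∫ ω in A n, ω.1 ∂law I = 0 := by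
    intro n
    rw [← setIntegral_condExp (comap_history_le π n) hint (hAc n), hgc n]
    refine setIntegral_eq_zero_of_forall_eq_zero fun ω hω => ?_
    exact hω.1
  set U : Set (Sample d K) := ⋃ n ∈ Finset.Ico 1 T, A n with hU
  have hUm : MeasurableSet U := Finset.measurableSet_biUnion _ fun n _ => hAm n
  have hsub : {ω | ∃ n, 1 ≤ n ∧ n < T ∧ history π ω n ∈ {h | g n h = 0}} ⊆ U := by
    classical
    rintro ω ⟨n, h1, h2, h3⟩
    have hex : ∃ n, 1 ≤ n ∧ ω ∈ Z n := ⟨n, h1, h3⟩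
    obtain ⟨h4, h5⟩ := Nat.find_spec hex
    have h6 : Nat.find hex ≤ n := Nat.find_min' hex ⟨h1, h3⟩
    refine Set.mem_iUnion₂.2 ⟨Nat.find hex, Finset.mem_Ico.2 ⟨h4, by omega⟩, h5, ?_⟩
    simp only [Set.mem_iInter]
    exact fun k hk hk1 hkZ => Nat.find_min hex hk ⟨hk1, hkZ⟩
  have hU0 : ∫ ω in U, ω.1 ∂law I = 0 := by
    rw [integral_biUnion_finset _ (fun n _ => hAm n) ?_ fun n _ => hint.integrableOn]
    · exact Finset.sum_eq_zero fun n _ => hA0 n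
    · intro i hi j hj hij
      refine Set.disjoint_left.2 fun ω hωi hωj => ?_
      have hi1 := (Finset.mem_Ico.1 (Finset.mem_coe.1 hi)).1
      have hj1 := (Finset.mem_Ico.1 (Finset.mem_coe.1 hj)).1
      rcases lt_or_gt_of_ne hij with h | h
      · have := hωj.2
        simp only [Set.mem_iInter] at this
        exact this i h hi1 hωi.1
      · have := hωi.2
        simp only [Set.mem_iInter] at this
        exact this j h hj1 hωj.1
  set f : Sample d K → ℝ := fun ω => inner ℝ (meanDir I) ω.1 with hf
  have hfm : Measurable f := by fun_prop
  have hfi : Integrable f (law I) := hint.const_inner _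
  have hfU : ∫ ω in U, f ω ∂law I = 0 := by
    rw [integral_inner hint.integrableOn, hU0, inner_zero_right]
  -- so the positive part has the same small integral as the negative part
  have hfU' : ∫⁻ ω in U, ENNReal.ofReal (f ω) ∂law I = ∫⁻ ω in U, ENNReal.ofReal (-f ω) ∂law I := by
    have h := integral_eq_lintegral_pos_part_sub_lintegral_neg_part (hfi.integrableOn (s := U))
    rw [hfU, eq_comm, sub_eq_zero] at h
    exact (ENNReal.toReal_eq_toReal_iff' hfi.integrableOn.lintegral_lt_top.ne
      hfi.integrableOn.neg.lintegral_lt_top.ne).1 h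
  have hrpow : (T:ℝ) ^ (-(3/2) : ℝ) ≤ 1 / T := by
    rw [one_div, ← Real.rpow_neg_one]
    exact Real.rpow_le_rpow_of_exponent_le hT' (by norm_num)
  have hneg : ∫⁻ ω in U, ENNReal.ofReal (-f ω) ∂law I ≤ ENNReal.ofReal (1 / T) := by
    refine (setLIntegral_le_lintegral _ _).trans ?_
    rw [(measurePreserving_latent I).lintegral_comp
      (f := fun θ => ENNReal.ofReal (-inner ℝ (meanDir I) θ)) (by fun_prop)]
    exact (lintegral_neg_inner_meanDir_le hI hT' hm).trans (ENNReal.ofReal_le_ofReal hrpow)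
  have hsmall : law I {ω | f ω < 1} ≤ ENNReal.ofReal (1 / T) := by
    have h := (measurePreserving_latent I).measure_preimage
      (s := {θ : Vec d | inner ℝ (meanDir I) θ < (1:ℝ)})
      (measurableSet_lt (by fun_prop) (by fun_prop)).nullMeasurableSet
    refine (le_of_eq h).trans (le_trans (measure_mono fun θ hθ => ?_)
      ((prior_inner_meanDir_lt hI hT').trans (ENNReal.ofReal_le_ofReal hrpow)))
    have h1 : inner ℝ (meanDir I) θ < (1:ℝ) := hθ
    show inner ℝ (meanDir I) θ ≤ _
    linarith
  calc _ ≤ law I U := measure_mono hsub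
    _ ≤ law I ({ω | f ω < 1} ∪ ({ω | 1 ≤ f ω} ∩ U)) := by
        refine measure_mono fun ω hω => ?_
        rcases lt_or_ge (f ω) 1 with h | h
        · exact Or.inl h
        · exact Or.inr ⟨h, hω⟩
    _ ≤ law I {ω | f ω < 1} + law I ({ω | 1 ≤ f ω} ∩ U) := measure_union_le _ _
    _ ≤ ENNReal.ofReal (1 / T) + ENNReal.ofReal (1 / T) := by
        refine add_le_add hsmall (le_trans ?_ (hfU'.trans_le hneg))
        have hm1 : MeasurableSet {ω | 1 ≤ f ω} := measurableSet_le measurable_const hfm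
        rw [← Measure.restrict_apply hm1, ← lintegral_indicator_one hm1]
        refine lintegral_mono fun ω => ?_
        by_cases h : ω ∈ {ω | 1 ≤ f ω}
        · rw [Set.indicator_of_mem h, Pi.one_apply, ← ENNReal.ofReal_one]
          exact ENNReal.ofReal_le_ofReal h
        · rw [Set.indicator_of_notMem h]; exact zero_le
    _ = _ := by
        rw [← ENNReal.ofReal_add (by positivity) (by positivity)]
        congr 1; ring

/-- The posterior mean is compared with the ridge estimate, which depends on the same history. -/
theorem bayesRegretLE_bayesGreedy (hI : EigLeOne I) (hT : 1 ≤ T)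
    (hm : 1 + Real.sqrt (3 * Real.log T) ≤ ‖I.mean‖) (hY : 1 ≤ Y)
    (hπ : IsBatchBayesGreedy I T Y π) :
    BayesRegretLE I π T (10 ^ 12 * logFactor d K T ^ 7 * ‖I.mean‖ *
      ((d : ℝ) ^ 2 * (K : ℝ) ^ (2 / 3 : ℝ) / I.rho ^ 2 * (T : ℝ) ^ (1 / 3 : ℝ) + Y)) := by
  have hfac : ∀ n, ∃ g : History d n → Vec d, StronglyMeasurable g ∧
      (law I)[fun ω' : Sample d K => ω'.1 |
        MeasurableSpace.comap (fun ω' => history π ω' n) inferInstance]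
      = g ∘ fun ω => history π ω n := fun n =>
    StronglyMeasurable.exists_eq_measurable_comp stronglyMeasurable_condExp
  choose g hgm hgc using hfac
  refine bayesRegretLE_batchGreedy (N := fun n => {h | g n h = 0}) (e := g) hI hT hm hY
    (fun n => (hgm n).measurable (measurableSet_singleton 0)) (fun n h hh => hh) ?_
    (law_exists_condExp_eq_zero_le hI hT hm (fun n => (hgm n).measurable) hgc) fun n _ _ => ?_
  · intro t ht
    filter_upwards [hπ t ht] with ω hω
    rw [hgc] at hω
    exact hω
  · refine ⟨fun p => ENNReal.ofReal (‖p.1 - g n p.2‖ ^ 2), ?_, fun G hG hs => ⟨fun ω _ => le_rfl, ?_⟩⟩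
    · have h1 : Measurable fun p : Vec d × History d n => g n p.2 :=
        (hgm n).measurable.comp measurable_snd
      fun_prop
    · have hof : ∀ x : Vec d, ENNReal.ofReal (‖x‖ ^ 2) = ‖x‖ₑ ^ 2 := fun x => by
        rw [ENNReal.ofReal_pow (norm_nonneg _), ofReal_norm]
      have hr : StronglyMeasurable[MeasurableSpace.comap (fun ω : Sample d K => history π ω n)
          inferInstance] fun ω => ridge (history π ω n) :=
        ((measurable_ridge n).comp (comap_measurable _)).stronglyMeasurable
      have h := lintegral_sub_condExp_sq_le (comap_history_le π n) (integrable_latent I) hr hG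
      rw [hgc n] at h
      simp only [hof]
      refine h.trans ?_
      have h8 : ENNReal.ofReal 8 = 4 * ENNReal.ofReal 2 := by
        rw [← ENNReal.ofReal_ofNat 4, ← ENNReal.ofReal_mul (by norm_num)]; norm_num
      rw [h8, mul_assoc, ← lintegral_const_mul' _ _ ENNReal.ofReal_ne_top]
      gcongr with ω
      by_cases hω : ω ∈ G
      · rw [Set.indicator_of_mem hω, Set.indicator_of_mem hω, ← hof,
          ← ENNReal.ofReal_mul (by norm_num)]
        refine ENNReal.ofReal_le_ofReal ((norm_ridge_sub_sq_le ω.1 (history π ω n)).trans ?_)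
        rw [mul_assoc]
      · rw [Set.indicator_of_notMem hω]; exact zero_le

end LinBandit
end

theorem mainTheorem2 :
    ∃ (A C : ℝ) (p q : ℕ), 0 < A ∧ 0 < C ∧
      ∀ (d K T : ℕ) (I : LinBandit.ProblemInstance d K), 1 ≤ T →
        (∀ i, I.cov_posDef.isHermitian.eigenvalues i ≤ 1) →
        1 + Real.sqrt (3 * Real.log T) ≤ ‖I.mean‖ →
        (∀ π : LinBandit.Policy d K,
          LinBandit.IsLinUCB I T
            (‖I.mean‖ + Real.sqrt (3 * d * Real.log T))
            (1 + I.rho * Real.sqrt (2 * d * Real.log (2 * (T : ℝ) ^ 3 * K * d)))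
            1 π →
          LinBandit.BayesRegretLE I π T
            (C * (1 + Real.log (T * K * d)) ^ q * ‖I.mean‖ *
              ((d : ℝ) ^ 2 * (K : ℝ) ^ (2 / 3 : ℝ) / I.rho ^ 2 * (T : ℝ) ^ (1 / 3 : ℝ)))) ∧
        (∀ Y : ℕ, A * (1 + Real.log (d * T)) ^ p / I.rho ^ 2 ≤ Y →
          ∀ π : LinBandit.Policy d K,
            (LinBandit.IsBatchBayesGreedy I T Y π ∨ LinBandit.IsBatchFreqGreedy I T Y π) →
            LinBandit.BayesRegretLE I π T
              (C * (1 + Real.log (T * K * d)) ^ q * ‖I.mean‖ *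
                ((d : ℝ) ^ 2 * (K : ℝ) ^ (2 / 3 : ℝ) / I.rho ^ 2 * (T : ℝ) ^ (1 / 3 : ℝ)
                  + Y))) := by
  refine ⟨1, 10 ^ 12, 0, 7, one_pos, by norm_num, fun d K T I hT hI hm => ⟨fun π hπ => ?_,
    fun Y hY π hπ => ?_⟩⟩
  · have hm1 : 1 ≤ ‖I.mean‖ := by linarith [Real.sqrt_nonneg (3 * Real.log T)]
    have hl := LinBandit.one_le_logFactor I hT
    have hρ := I.rho_pos
    obtain ⟨h1, h2⟩ := LinBandit.bayesRegretLE_linUCB hI hT hm hπ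
    refine ⟨h1, h2.trans ?_⟩
    rw [LinBandit.logFactor] at hl ⊢
    gcongr
    · norm_num
    · norm_num
  · have hY1 : 1 ≤ Y := by
      have h1 : 0 < (Y:ℝ) := by
        refine lt_of_lt_of_le ?_ hY
        have := I.rho_pos
        positivity
      exact_mod_cast h1
    exact hπ.elim (LinBandit.bayesRegretLE_bayesGreedy hI hT hm hY1)
      (LinBandit.bayesRegretLE_freqGreedy hI hT hm hY1)
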